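/- Let $\mathbb T=\mathbb R/\mathbb Z$, let $c>0$ and $c_1,c_2\in\mathbb R$, and let $\dot W_1,\dot W$ be independent space-time Gaussian white noises on $[0,\infty)\times\mathbb T$ defined on a probability space $(\Omega,\mathcal F,P)$. For every real $K\ge 1$ let $\Psi^K(0)$ be a (possibly random) element of $L^2(\mathbb T)$ with $\sup_{K\ge1}E\big[\|\Psi^K(0)\|_{L^2(\mathbb T)}^2\big]<\infty$ (for deterministic initial values: $\sup_{K\ge1}\|\Psi^K(0)\|_{L^2(\mathbb T)}<\infty$), and let $\Psi^K$ be a $\mathcal D'(\mathbb T)$-valued solution, with initial value $\Psi^K(0)$, of $$\partial_t\Psi=\Delta\Psi-cK\Psi+c_1K^{-1/4}\,\nabla\cdot\dot W_1+c_2K^{1/4}\,\dot W\quad\text{on }[0,\infty)\times\mathbb T,$$ that is, for every $\varphi\in C^\infty(\mathbb T)$ the real process $\langle\Psi^K(t),\varphi\rangle$ has a.s. continuous paths on $[0,\infty)$ and, for every $t\ge0$, almost surely $$\langle\Psi^K(t),\varphi\rangle=\langle\Psi^K(0),\varphi\rangle+\int_0^t\langle\Psi^K(s),\Delta\varphi-cK\varphi\rangle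 ds-c_1K^{-1/4}\int_0^t\!\!\int_{\mathbb T}\varphi'(y)\,W_1(ds\,dy)+c_2K^{1/4}\int_0^t\!\!\int_{\mathbb T}\varphi(y)\,W(ds\,dy).$$ Then there is a decomposition $\Psi^K(t)=\Psi_1^K(t)+\Psi_2^K(t)$ in $\mathcal D'(\mathbb T)$, a.s. for each $K\ge1$ and $t\ge0$, such that: (a) $\Psi_1^K(t)$ is a random distribution on $\mathbb T$ of order at most one (a continuous linear functional on $C^1(\mathbb T)$); for each $\varphi\in C^1(\mathbb T)$, $\langle\Psi_1^K(t),\varphi\rangle\in L^2(\Omega)$ is a.s. the sum of $\int_{\mathbb T}\Psi^K(0,x)\,g(x)\,dx$ for some deterministic $g\in L^2(\mathbb T)$ and of $\iint h\,dW_1$ for some deterministic $h\in L^2([0,\infty)\times\mathbb T)$; and for every $t>0$ and $\varphi\in C^1(\mathbb T)$, $\langle\Psi_1^K(t),\varphi\rangle\to0$ in $L^2(\Omega)$ as $K\to\infty$. (b) $\Psi_2^K(t)\in C(\mathbb T)$; for each $t\ge0$ and $x\in\mathbb T$, $\Psi_2^K(t,x)$ is a.s. equal to $\iint h\,dW$ for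 some deterministic $h\in L^2([0,\infty)\times\mathbb T)$; and $(\Psi_2^K(t,x))_{t\ge0,\,x\in\mathbb T}$ is a centered Gaussian process. (c) There is a random field $(\Psi_2(t,x))_{t>0,\,x\in\mathbb T}$ on some probability space such that $\Psi_2^K(t,x)$ converges in law to $\Psi_2(t,x)$ as $K\to\infty$ for every $t>0$, $x\in\mathbb T$, and more generally $(\Psi_2^K(t_i,x_i))_{i=1}^n$ converges in law to $(\Psi_2(t_i,x_i))_{i=1}^n$ for all $t_1,\dots,t_n>0$ and $x_1,\dots,x_n\in\mathbb T$. Each $\Psi_2(t,x)$ is a real Gaussian random variable with mean $0$ and variance $$\sigma^2=\frac{c_2^2}{\sqrt{8\pi}}\int_0^\infty\frac{e^{-2cu}}{\sqrt u}\,du,$$ and the random variables $\Psi_2(t,x)$, $(t,x)\in(0,\infty)\times\mathbb T$, are independent; in particular $\Psi_2(t_1,x_1)$ and $\Psi_2(t_2,x_2)$ are independent whenever $t_1\ne t_2$ or $x_1\ne x_2$. -/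

import Mathlib

open MeasureTheory ProbabilityTheory Filter
open scoped Topology NNReal ENNReal

namespace TorusSPDE

/-- Derivative of a function on the circle `𝕋 = ℝ/ℤ` along the circle. -/
noncomputable def tderiv (φ : UnitAddCircle → ℝ) (x : UnitAddCircle) : ℝ :=
  deriv (fun r : ℝ ↦ φ (x + (r : UnitAddCircle))) 0

/-- The space `C^n(𝕋)`, `n ∈ ℕ ∪ {∞}`: functions on the circle whose `1`-periodic lift to `ℝ` is
of class `C^n`. -/
def Ck (n : ℕ∞) : Submodule ℝ (UnitAddCircle → ℝ) where
  carrier := {φ | ContDiff ℝ (n : WithTop ℕ∞) (fun r : ℝ ↦ φ (r : UnitAddCircle))}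
  add_mem' := by
    intro f g hf hg
    simp only [Set.mem_ofPred_eq] at hf hg ⊢
    exact hf.add hg
  zero_mem' := by
    simp only [Set.mem_ofPred_eq]
    exact contDiff_const
  smul_mem' := by
    intro a f hf
    simp only [Set.mem_ofPred_eq] at hf ⊢
    exact hf.const_smul a

theorem mem_Ck {n : ℕ∞} {φ : UnitAddCircle → ℝ} :
    φ ∈ Ck n ↔ ContDiff ℝ (n : WithTop ℕ∞) (fun r : ℝ ↦ φ (r : UnitAddCircle)) :=
  Iff.rfl

theorem tderiv_coe (φ : UnitAddCircle → ℝ) (y : ℝ) :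
    tderiv φ (y : UnitAddCircle) = deriv (fun r : ℝ ↦ φ (r : UnitAddCircle)) y := by
  have h : (fun r : ℝ ↦ φ ((y : UnitAddCircle) + (r : UnitAddCircle)))
      = fun r : ℝ ↦ (fun s : ℝ ↦ φ (s : UnitAddCircle)) (y + r) := by
    funext r
    simp
  rw [tderiv, h, deriv_comp_const_add (fun s : ℝ ↦ φ (s : UnitAddCircle)) y 0]
  simp

theorem tderiv_mem {φ : UnitAddCircle → ℝ} (hφ : φ ∈ Ck ⊤) : tderiv φ ∈ Ck ⊤ := by
  rw [mem_Ck] at hφ ⊢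
  simp only [tderiv_coe]
  have h : ContDiff ℝ (((⊤ : ℕ∞) : WithTop ℕ∞) + 1) (fun r : ℝ ↦ φ (r : UnitAddCircle)) := by
    simpa using hφ
  exact ((contDiff_succ_iff_deriv).1 h).2.2

/-- The inclusion `C^∞(𝕋) ⊆ C^1(𝕋)`. -/
def toC1 (φ : Ck ⊤) : Ck 1 :=
  ⟨φ.1, mem_Ck.2 ((mem_Ck.1 φ.2).of_le (by exact_mod_cast (le_top : (1 : ℕ∞) ≤ ⊤)))⟩

/-- The operator `Δ - λ` on test functions. -/
noncomputable def laplaceSub (lam : ℝ) (φ : Ck ⊤) : Ck ⊤ :=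
  ⟨tderiv (tderiv φ.1), tderiv_mem (tderiv_mem φ.2)⟩ - lam • φ

/-- The continuous dual of `C^n(𝕋)`: the linear functionals bounded by a finite number `m ≤ n` of
sup-norms of derivatives. For `n = ∞` these are the distributions on `𝕋`; for `n = 1` they are the
distributions of order at most one. -/
structure DualCk (n : ℕ∞) where
  toLin : Ck n →ₗ[ℝ] ℝ
  bounded : ∃ m : ℕ, (m : ℕ∞) ≤ n ∧ ∃ C : ℝ, ∀ (φ : Ck n) (M : ℝ),
    (∀ j ≤ m, ∀ x, |tderiv^[j] φ.1 x| ≤ M) → |toLin φ| ≤ C * M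

/-- The space `𝒟'(𝕋)` of distributions. -/
abbrev Distrib : Type := DualCk ⊤

/-- Lebesgue measure on `[0, ∞) × 𝕋`, as a measure on `ℝ × 𝕋`. -/
noncomputable def stMeasure : Measure (ℝ × UnitAddCircle) :=
  ((volume : Measure ℝ).restrict (Set.Ici 0)).prod volume

/-- The deterministic (square integrable) integrands on `[0, ∞) × 𝕋`. -/
abbrev Integrand : Type := {f : ℝ × UnitAddCircle → ℝ // MemLp f 2 stMeasure}

/-- `W` is a space-time Gaussian white noise on `[0, ∞) × 𝕋`: `W f` stands for
`∫∫ f(s, y) W(ds dy)`, and `(W f)`, `f ∈ L²`, is a centred Gaussian family with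
`E[W f · W g] = ∫∫ f g ds dy`. -/
structure IsWhiteNoise {Ω : Type*} [MeasurableSpace Ω] (P : Measure Ω)
    (W : Integrand → Ω → ℝ) : Prop where
  measurable : ∀ f, Measurable (W f)
  gaussian : IsGaussianProcess W P
  mean_zero : ∀ f, ∫ ω, W f ω ∂P = 0
  covariance : ∀ f g, ∫ ω, W f ω * W g ω ∂P = ∫ z, f.1 z * g.1 z ∂stMeasure

theorem memLp_slab (t : ℝ) {φ : UnitAddCircle → ℝ} (hφ : φ ∈ Ck ⊤) :
    MemLp (fun z : ℝ × UnitAddCircle ↦ (Set.Ioc 0 t).indicator (fun _ ↦ (1 : ℝ)) z.1 * φ z.2)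
      2 stMeasure := by
  have hc : Continuous φ := by
    have h1 : Continuous (fun r : ℝ ↦ φ (r : UnitAddCircle)) := (mem_Ck.1 hφ).continuous
    exact (QuotientAddGroup.isQuotientMap_mk (N := AddSubgroup.zmultiples (1 : ℝ))).continuous_iff.2
      h1
  have ha : MemLp ((Set.Ioc 0 t).indicator (fun _ ↦ (1 : ℝ))) 2
      ((volume : Measure ℝ).restrict (Set.Ici 0)) := by
    refine memLp_indicator_const 2 measurableSet_Ioc 1 (Or.inr ?_)
    exact ne_of_lt (lt_of_le_of_lt (Measure.restrict_apply_le _ _) measure_Ioc_lt_top)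
  have hb : MemLp φ 2 (volume : Measure UnitAddCircle) :=
    hc.memLp_of_hasCompactSupport (HasCompactSupport.of_compactSpace φ)
  refine (memLp_two_iff_integrable_sq (ha.1.comp_fst.mul hb.1.comp_snd)).2 ?_
  exact (ha.integrable_sq.mul_prod hb.integrable_sq).congr
    (ae_of_all _ fun z ↦ (mul_pow _ _ 2).symm)

/-- The integrand `(s, y) ↦ 1_{(0, t]}(s) φ(y)`. -/
noncomputable def slab (t : ℝ) (φ : UnitAddCircle → ℝ) (hφ : φ ∈ Ck ⊤) : Integrand :=
  ⟨fun z ↦ (Set.Ioc 0 t).indicator (fun _ ↦ (1 : ℝ)) z.1 * φ z.2, memLp_slab t hφ⟩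

/-- `Ψ` is a (probabilistically strong, analytically weak) `𝒟'(𝕋)`-valued solution of
`∂ₜΨ = ΔΨ - c K Ψ + c₁ K^{-1/4} ∇·Ẇ₁ + c₂ K^{1/4} Ẇ` on `[0, ∞) × 𝕋` with `Ψ(0) = u₀`. -/
structure IsSolution {Ω : Type*} [MeasurableSpace Ω] (P : Measure Ω) (W₁ W : Integrand → Ω → ℝ)
    (c c₁ c₂ K : ℝ) (u₀ : Ω → Lp ℝ 2 (volume : Measure UnitAddCircle))
    (Ψ : ℝ → Ω → Distrib) : Prop where
  aemeasurable : ∀ t, 0 ≤ t → ∀ φ : Ck ⊤, AEMeasurable (fun ω ↦ (Ψ t ω).toLin φ) P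
  continuousOn : ∀ φ : Ck ⊤, ∀ᵐ ω ∂P, ContinuousOn (fun t ↦ (Ψ t ω).toLin φ) (Set.Ici 0)
  weak_eq : ∀ φ : Ck ⊤, ∀ t, 0 ≤ t → ∀ᵐ ω ∂P,
    (Ψ t ω).toLin φ = (∫ x, u₀ ω x * φ.1 x)
      + (∫ s in (0 : ℝ)..t, (Ψ s ω).toLin (laplaceSub (c * K) φ))
      - c₁ * K ^ (-(1 / 4) : ℝ) * W₁ (slab t (tderiv φ.1) (tderiv_mem φ.2)) ω
      + c₂ * K ^ (1 / 4 : ℝ) * W (slab t φ.1 φ.2) ω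

/-- The variance `σ² = c₂² (8π)^{-1/2} ∫_0^∞ e^{-2cu} u^{-1/2} du`. -/
noncomputable def sigmaSq (c c₂ : ℝ) : ℝ :=
  c₂ ^ 2 / Real.sqrt (8 * Real.pi) *
    ∫ u in Set.Ioi (0 : ℝ), Real.exp (-2 * c * u) / Real.sqrt u

end TorusSPDE

/-!
Expand everything along the Hartley basis `cas_k(x) = cos(2πkx) + sin(2πkx)`, `k ∈ ℤ`, which is an
orthonormal basis of `L²(𝕋)` made of eigenfunctions of the Laplacian, with `cas_k' = 2πk cas_{-k}`.
Testing the equation with `cas_k` shows that the `k`-th mode of a solution is an Ornstein-Uhlenbeck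
process of rate `λ_k = cK + (2πk)²`. The stochastic integrals only appear through the isometry
`L²([0, ∞) × 𝕋) → L²(Ω)` given by the white noise, so the mode is identified by variation of
constants for an equation that holds almost surely at each time (`variation_of_constants`,
`IsSolution.toLin_casTest`).

The first part collects the contributions of the initial value and of `W₁`. Its coefficients are
almost surely square summable against the weight `(1 + (2πk)²)⁻¹`, so it lies in `H^{-1}(𝕋)` and
acts on `C¹(𝕋)` (`dualOfCoeff`). Since the Fourier coefficients of a `C¹` function are absolutely
summable, its `L²(Ω)` norm is at most a constant times `e^{-cKt} + K^{-1/4}`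
(`eLpNorm_dualOfCoeff_zeta_le`).

The second part is the stochastic convolution of `W` with the heat kernel. Its dyadic Fourier blocks
have fourth moments, in a Sobolev norm controlling the supremum, that decay geometrically, so they
sum to a continuous function (`stochConv`), whose value at `x` is the image under white noise of an
explicit integrand `heatIntegrand`.

The covariance of the second part at times `t, s` and points `x, y` is `c₂² √K` times the series
`∑ₖ cas_k(x) cas_k(y) (e^{-λ_k|t-s|} - e^{-λ_k(t+s)}) / (2λ_k)`. A term with a factor `e^{-λ_k τ}`,
`τ > 0`, is exponentially small in `K`. What remains when `t = s` is half the Green function of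
`cK - Δ` on the circle, which is explicit: `√K` times it tends to `1/(4√c)` on the diagonal and to
`0` off the diagonal (`tendsto_cov`). As `σ² = c₂²/(4√c)` (`sigmaSq_eq`), the characteristic
functions of all finite-dimensional distributions converge to those of independent variables of
variance `σ²`.
-/

namespace TorusSPDE

/-! ### The real Fourier basis of the circle -/

/-- The Hartley functions `cas_k(x) = cos(2πkx) + sin(2πkx)`, `k ∈ ℤ`: a real orthonormal basis of
`L²(𝕋)` which is indexed by `ℤ` and in which all elements are given by the same formula. -/
noncomputable def cas (k : ℤ) : C(UnitAddCircle, ℝ) where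
  toFun x := (fourier k x).re + (fourier k x).im
  continuous_toFun := (Complex.continuous_re.comp (fourier k).continuous).add
    (Complex.continuous_im.comp (fourier k).continuous)

theorem cas_def (k : ℤ) (x : UnitAddCircle) : cas k x = (fourier k x).re + (fourier k x).im := rfl

theorem cas_coe (k : ℤ) (r : ℝ) :
    cas k (r : UnitAddCircle)
      = Real.cos (2 * Real.pi * k * r) + Real.sin (2 * Real.pi * k * r) := by
  have h : (fourier k (r : UnitAddCircle) : ℂ)
      = Complex.exp ((2 * Real.pi * k * r : ℝ) * Complex.I) := by
    rw [fourier_coe_apply]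
    congr 1
    push_cast
    ring
  rw [cas_def, h, Complex.exp_ofReal_mul_I_re, Complex.exp_ofReal_mul_I_im]

theorem cas_neg (k : ℤ) (x : UnitAddCircle) :
    cas (-k) x = (fourier k x).re - (fourier k x).im := by
  rw [cas_def, fourier_neg, Complex.conj_re, Complex.conj_im, sub_eq_add_neg]

theorem abs_cas_le (k : ℤ) (x : UnitAddCircle) : |cas k x| ≤ 2 := by
  induction x using QuotientAddGroup.induction_on with
  | H r =>
    have h := cas_coe k r
    rw [h]
    refine (abs_add_le _ _).trans ?_
    linarith [Real.abs_cos_le_one (2 * Real.pi * k * r), Real.abs_sin_le_one (2 * Real.pi * k * r)]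

theorem hasDerivAt_cas (k : ℤ) (r : ℝ) :
    HasDerivAt (fun r : ℝ ↦ cas k (r : UnitAddCircle))
      (2 * Real.pi * k * cas (-k) (r : UnitAddCircle)) r := by
  have h : HasDerivAt (fun r : ℝ ↦ 2 * Real.pi * k * r) (2 * Real.pi * k) r := by
    simpa using (hasDerivAt_id r).const_mul (2 * Real.pi * k)
  simp only [cas_coe]
  refine (h.cos.add h.sin).congr_deriv ?_
  rw [show (2 * Real.pi * ((-k : ℤ) : ℝ) * r) = -(2 * Real.pi * k * r) by push_cast; ring,
    Real.cos_neg, Real.sin_neg]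
  ring

theorem tderiv_cas (k : ℤ) : tderiv (cas k) = (2 * Real.pi * k) • ⇑(cas (-k)) := by
  funext x
  induction x using QuotientAddGroup.induction_on with
  | H r => exact (tderiv_coe _ r).trans (hasDerivAt_cas k r).deriv

theorem cas_mem_Ck (n : ℕ∞) (k : ℤ) : ⇑(cas k) ∈ Ck n := by
  rw [mem_Ck]
  simp only [cas_coe]
  fun_prop

/-- `cas_k` as a test function. -/
noncomputable def casTest (k : ℤ) : Ck ⊤ := ⟨cas k, cas_mem_Ck ⊤ k⟩

/-- The product at one point. Only the first term contributes to the integral. -/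
theorem cas_mul_cas (k l : ℤ) (x : UnitAddCircle) :
    cas k x * cas l x = (fourier (k - l) x).re + (fourier (k + l) x).im := by
  rw [cas_def, cas_def, sub_eq_add_neg, fourier_add, fourier_add, fourier_neg]
  simp only [Complex.mul_re, Complex.mul_im, Complex.conj_re, Complex.conj_im]
  ring

/-- The product at two points is `cos(2πk(x - y)) + sin(2πk(x + y))`, whose second term is odd in
`k` and disappears in sums weighted by an even function of `k`. -/
theorem cas_mul_cas' (k : ℤ) (x y : UnitAddCircle) :
    cas k x * cas k y = (fourier k (x - y)).re + (fourier k (x + y)).im := by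
  have h1 : (fourier k (x + y) : ℂ) = fourier k x * fourier k y := by
    simp only [fourier_apply, smul_add, AddCircle.toCircle_add, Circle.coe_mul]
  have h2 : (fourier k (x - y) : ℂ) = fourier k x * (starRingEnd ℂ) (fourier k y) := by
    rw [← fourier_neg]
    simp only [fourier_apply, sub_eq_add_neg, smul_add, smul_neg, AddCircle.toCircle_add,
      Circle.coe_mul, neg_smul]
  rw [cas_def, cas_def, h1, h2]
  simp only [Complex.mul_re, Complex.mul_im, Complex.conj_re, Complex.conj_im]
  ring

theorem volume_eq_haar : (volume : Measure UnitAddCircle) = AddCircle.haarAddCircle := by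
  rw [AddCircle.volume_eq_smul_haarAddCircle, ENNReal.ofReal_one, one_smul]

instance : IsProbabilityMeasure (volume : Measure UnitAddCircle) := by
  rw [volume_eq_haar]; infer_instance

theorem integrable_of_continuous {E : Type*} [NormedAddCommGroup E] {f : UnitAddCircle → E}
    (hf : Continuous f) : Integrable f :=
  hf.integrable_of_hasCompactSupport (HasCompactSupport.of_compactSpace f)

theorem integral_fourier (n : ℤ) :
    ∫ x : UnitAddCircle, (fourier n x : ℂ) = if n = 0 then 1 else 0 := by
  have h := congrFun (fourierCoeff_fourier (T := 1) n) 0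
  rw [fourierCoeff, ← volume_eq_haar] at h
  simp only [neg_zero, fourier_zero, one_smul, Pi.single_apply, eq_comm (a := (0 : ℤ))] at h
  exact h

theorem integral_cas_mul_cas (k l : ℤ) :
    ∫ x, cas k x * cas l x = if k = l then 1 else 0 := by
  have hi (n : ℤ) : Integrable (fun x : UnitAddCircle ↦ (fourier n x : ℂ)) :=
    integrable_of_continuous (fourier n).continuous
  have hre (n : ℤ) : ∫ x : UnitAddCircle, (fourier n x : ℂ).re = if n = 0 then 1 else 0 := by
    have := integral_re (𝕜 := ℂ) (hi n)
    simp only [RCLike.re_eq_complex_re] at this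
    rw [this, integral_fourier]
    split_ifs <;> simp
  have him (n : ℤ) : ∫ x : UnitAddCircle, (fourier n x : ℂ).im = 0 := by
    have := integral_im (𝕜 := ℂ) (hi n)
    simp only [RCLike.im_eq_complex_im] at this
    rw [this, integral_fourier]
    split_ifs <;> simp
  simp only [cas_mul_cas]
  have h1 : Integrable (fun x : UnitAddCircle ↦ (fourier (k - l) x : ℂ).re) := (hi (k - l)).re
  have h2 : Integrable (fun x : UnitAddCircle ↦ (fourier (k + l) x : ℂ).im) := (hi (k + l)).im
  rw [integral_add h1 h2, hre, him, add_zero]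
  simp only [sub_eq_zero]

/-- The coefficient `⟨f, cas_k⟩` of a function on the circle. -/
noncomputable def casCoeff (f : UnitAddCircle → ℝ) (k : ℤ) : ℝ := ∫ x, f x * cas k x

theorem hasSum_zero_of_odd {f : ℤ → ℝ} (hf : Summable f) (hodd : ∀ k, f (-k) = -f k) :
    HasSum f 0 := by
  have h1 := hf.hasSum
  have h2 := (Equiv.neg ℤ).hasSum_iff.2 h1
  have h3 : HasSum (fun k ↦ -f k) (∑' k, f k) := by
    refine h2.congr_fun ?_
    intro k
    exact (hodd k).symm
  have := h3.unique h1.neg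
  rw [show (0 : ℝ) = ∑' k, f k by linarith]
  exact h1

/-- The real and imaginary parts of the complex Fourier coefficients of a real function are the
even and odd parts of its Hartley coefficients. -/
theorem fourierCoeff_eq_casCoeff {f : UnitAddCircle → ℝ} (hf : Continuous f) (k : ℤ) :
    fourierCoeff (fun x ↦ (f x : ℂ)) k = ⟨(casCoeff f k + casCoeff f (-k)) / 2,
      -((casCoeff f k - casCoeff f (-k)) / 2)⟩ := by
  have hi (n : ℤ) : Integrable (fun x : UnitAddCircle ↦ f x * cas n x) :=
    integrable_of_continuous (hf.mul (cas n).continuous)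
  have hint : Integrable (fun x : UnitAddCircle ↦ (fourier (-k) x : ℂ) • (f x : ℂ)) :=
    integrable_of_continuous
      ((fourier (-k)).continuous.smul (Complex.continuous_ofReal.comp hf))
  rw [fourierCoeff, ← volume_eq_haar]
  apply Complex.ext
  · have h := integral_re (𝕜 := ℂ) hint
    simp only [RCLike.re_eq_complex_re] at h
    rw [← h, casCoeff, casCoeff, ← integral_add (hi k) (hi (-k)), ← integral_div]
    refine integral_congr_ae (ae_of_all _ fun x ↦ ?_)
    simp only [cas_neg, cas_def k, fourier_neg, smul_eq_mul, Complex.re_mul_ofReal, Complex.conj_re]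
    ring
  · have h := integral_im (𝕜 := ℂ) hint
    simp only [RCLike.im_eq_complex_im] at h
    rw [← h, casCoeff, casCoeff, ← integral_sub (hi k) (hi (-k)), ← integral_div, ← integral_neg]
    refine integral_congr_ae (ae_of_all _ fun x ↦ ?_)
    simp only [cas_neg, cas_def k, fourier_neg, smul_eq_mul, Complex.im_mul_ofReal, Complex.conj_im]
    ring

theorem summable_mul_cas {c : ℤ → ℝ} (hs : Summable fun k ↦ |c k|) (x : UnitAddCircle) :
    Summable fun k ↦ c k * cas k x := by
  refine Summable.of_norm_bounded (hs.mul_right 2) fun k ↦ ?_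
  rw [norm_mul, Real.norm_eq_abs]
  exact mul_le_mul_of_nonneg_left (abs_cas_le _ _) (abs_nonneg _)

/-- The Hartley expansion of a continuous function with summable coefficients. -/
theorem hasSum_casCoeff {f : UnitAddCircle → ℝ} (hf : Continuous f)
    (hs : Summable fun k ↦ |casCoeff f k|) (x : UnitAddCircle) :
    HasSum (fun k ↦ casCoeff f k * cas k x) (f x) := by
  let g : C(UnitAddCircle, ℂ) := ⟨fun x ↦ (f x : ℂ), Complex.continuous_ofReal.comp hf⟩
  have hc : fourierCoeff g = fun k ↦ ⟨(casCoeff f k + casCoeff f (-k)) / 2,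
      -((casCoeff f k - casCoeff f (-k)) / 2)⟩ := funext fun k ↦ fourierCoeff_eq_casCoeff hf k
  have hsn : Summable fun k ↦ |casCoeff f (-k)| :=
    (Equiv.neg ℤ).summable_iff (f := fun k ↦ |casCoeff f k|) |>.2 hs
  have hsum : Summable (fourierCoeff g) := by
    rw [hc]
    refine Summable.of_norm_bounded (hs.add hsn) fun k ↦
      (Complex.norm_le_abs_re_add_abs_im _).trans ?_
    simp only [abs_neg, abs_div, abs_two]
    linarith [abs_add_le (casCoeff f k) (casCoeff f (-k)), abs_sub (casCoeff f k) (casCoeff f (-k))]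
  have h := Complex.hasSum_re (has_pointwise_sum_fourier_series_of_summable hsum x)
  rw [hc] at h
  -- what remains is odd in `k`, and sums to zero
  have hodd := hasSum_zero_of_odd (f := fun k ↦ casCoeff f k * cas k x / 2
    - casCoeff f (-k) * cas (-k) x / 2) ?_ (fun k ↦ by simp only [neg_neg]; ring)
  · have := h.add hodd
    rw [add_zero] at this
    refine this.congr_fun fun k ↦ ?_
    simp only [smul_eq_mul, Complex.mul_re, cas_neg, cas_def k]
    ring
  · have hneg {c : ℤ → ℝ} (hc : Summable fun k ↦ |c k|) : Summable fun k ↦ c k * cas (-k) x := by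
      refine Summable.of_norm_bounded (hc.mul_right 2) fun k ↦ ?_
      rw [norm_mul, Real.norm_eq_abs]
      exact mul_le_mul_of_nonneg_left (abs_cas_le _ _) (abs_nonneg _)
    exact ((summable_mul_cas hs x).div_const 2).sub ((hneg hsn).div_const 2)

theorem continuous_of_mem_Ck {n : ℕ∞} {f : UnitAddCircle → ℝ} (hf : f ∈ Ck n) : Continuous f :=
  (QuotientAddGroup.isQuotientMap_mk (N := AddSubgroup.zmultiples (1 : ℝ))).continuous_iff.2
    (mem_Ck.1 hf).continuous

theorem hasDerivAt_of_mem_Ck {f : UnitAddCircle → ℝ} (hf : f ∈ Ck 1) (r : ℝ) :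
    HasDerivAt (fun r : ℝ ↦ f (r : UnitAddCircle)) (tderiv f (r : UnitAddCircle)) r := by
  rw [tderiv_coe]
  exact ((mem_Ck.1 hf).differentiable (by norm_num)).differentiableAt.hasDerivAt

theorem continuous_tderiv {f : UnitAddCircle → ℝ} (hf : f ∈ Ck 1) : Continuous (tderiv f) := by
  refine (QuotientAddGroup.isQuotientMap_mk
    (N := AddSubgroup.zmultiples (1 : ℝ))).continuous_iff.2 ?_
  have : (tderiv f ∘ (QuotientAddGroup.mk : ℝ → UnitAddCircle))
      = deriv fun r : ℝ ↦ f (r : UnitAddCircle) := by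
    funext r
    exact tderiv_coe f r
  rw [this]
  exact (mem_Ck.1 hf).continuous_deriv (by norm_num)

/-- Integration by parts on the circle, against a Hartley function. -/
theorem casCoeff_tderiv {f : UnitAddCircle → ℝ} (hf : f ∈ Ck 1) (k : ℤ) :
    casCoeff (tderiv f) k = -(2 * Real.pi * k) * casCoeff f (-k) := by
  have hcf := continuous_of_mem_Ck hf
  have hcd := continuous_tderiv hf
  have hper : ∫ x, (tderiv f x * cas k x + f x * (2 * Real.pi * k * cas (-k) x)) = 0 := by
    rw [← UnitAddCircle.intervalIntegral_preimage 0]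
    have hd (r : ℝ) := (hasDerivAt_of_mem_Ck hf r).mul (hasDerivAt_cas k r)
    rw [intervalIntegral.integral_eq_sub_of_hasDerivAt (fun r _ ↦ hd r)]
    · have h1 : ((0 + 1 : ℝ) : UnitAddCircle) = ((0 : ℝ) : UnitAddCircle) := by
        rw [zero_add]; exact AddCircle.coe_period 1
      simp only [Pi.mul_apply, h1, sub_self]
    · refine Continuous.intervalIntegrable ?_ _ _
      have hq : Continuous fun r : ℝ ↦ (r : UnitAddCircle) := continuous_quotient_mk'
      exact ((hcd.comp hq).mul ((cas k).continuous.comp hq)).add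
        ((hcf.comp hq).mul (continuous_const.mul ((cas (-k)).continuous.comp hq)))
  have hi1 : Integrable fun x ↦ tderiv f x * cas k x :=
    integrable_of_continuous (hcd.mul (cas k).continuous)
  have hi2 : Integrable fun x ↦ f x * (2 * Real.pi * k * cas (-k) x) :=
    integrable_of_continuous (hcf.mul (continuous_const.mul (cas (-k)).continuous))
  rw [integral_add hi1 hi2] at hper
  have h2 : ∫ x, f x * (2 * Real.pi * k * cas (-k) x) = 2 * Real.pi * k * casCoeff f (-k) := by
    rw [casCoeff, ← integral_const_mul]
    exact integral_congr_ae (ae_of_all _ fun x ↦ by ring)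
  rw [h2] at hper
  rw [casCoeff]
  linarith

/-- `cas_k` as an element of `L²(𝕋)`. -/
noncomputable def casLp (k : ℤ) : Lp ℝ 2 (volume : Measure UnitAddCircle) :=
  ContinuousMap.toLp 2 volume ℝ (cas k)

theorem inner_toLp (f g : C(UnitAddCircle, ℝ)) :
    inner ℝ (ContinuousMap.toLp 2 (volume : Measure UnitAddCircle) ℝ f)
      (ContinuousMap.toLp 2 volume ℝ g) = ∫ x, f x * g x := by
  rw [L2.inner_def]
  refine integral_congr_ae ?_
  filter_upwards [ContinuousMap.coeFn_toLp (p := 2) (𝕜 := ℝ) volume f,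
    ContinuousMap.coeFn_toLp (p := 2) (𝕜 := ℝ) volume g] with x hx hy
  rw [hx, hy]
  simp [mul_comm]

theorem inner_toLp_right (u : Lp ℝ 2 (volume : Measure UnitAddCircle)) (f : C(UnitAddCircle, ℝ)) :
    inner ℝ u (ContinuousMap.toLp 2 (volume : Measure UnitAddCircle) ℝ f) = ∫ x, u x * f x := by
  rw [L2.inner_def]
  refine integral_congr_ae ?_
  filter_upwards [ContinuousMap.coeFn_toLp (p := 2) (𝕜 := ℝ) volume f] with x hx
  rw [hx]
  simp [mul_comm]

theorem orthonormal_casLp : Orthonormal ℝ casLp := by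
  rw [orthonormal_iff_ite]
  intro k l
  rw [casLp, casLp, inner_toLp, integral_cas_mul_cas]

/-- Bessel's inequality. -/
theorem bessel_casCoeff (f : C(UnitAddCircle, ℝ)) {M : ℝ} (hM : ∀ x, |f x| ≤ M) :
    Summable (fun k ↦ casCoeff f k ^ 2) ∧ ∑' k, casCoeff f k ^ 2 ≤ M ^ 2 := by
  have h1 (k : ℤ) : ‖inner ℝ (casLp k) (ContinuousMap.toLp 2 (volume : Measure UnitAddCircle) ℝ f)‖
      ^ 2 = casCoeff f k ^ 2 := by
    rw [casLp, inner_toLp, Real.norm_eq_abs, sq_abs, casCoeff]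
    simp only [mul_comm]
  have hs := orthonormal_casLp.inner_products_summable
    (ContinuousMap.toLp 2 (volume : Measure UnitAddCircle) ℝ f)
  have hb := orthonormal_casLp.tsum_inner_products_le
    (x := ContinuousMap.toLp 2 (volume : Measure UnitAddCircle) ℝ f)
  simp only [h1] at hs hb
  refine ⟨hs, hb.trans ?_⟩
  rw [← real_inner_self_eq_norm_sq, inner_toLp]
  have hle : ∫ x, f x * f x ≤ ∫ _x : UnitAddCircle, M ^ 2 := by
    refine integral_mono (integrable_of_continuous (f.continuous.mul f.continuous))
      (integrable_const _) fun x ↦ ?_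
    have := sq_le_sq' (abs_le.1 (hM x)).1 (abs_le.1 (hM x)).2
    simpa [sq] using this
  simpa using hle

/-! ### Hartley coefficients of smooth functions and distributions -/

theorem summable_weight : Summable fun k : ℤ ↦ (1 + (2 * Real.pi * k) ^ 2)⁻¹ := by
  have h0 : Summable fun k : ℤ ↦ (Pi.single 0 1 : ℤ → ℝ) k + 1 / (k : ℝ) ^ 2 :=
    (hasSum_pi_single (0 : ℤ) (1 : ℝ)).summable.add (Real.summable_one_div_int_pow.2 one_lt_two)
  refine Summable.of_nonneg_of_le (fun k ↦ by positivity) (fun k ↦ ?_) h0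
  rcases eq_or_ne k 0 with rfl | hk
  · simp
  · have hk' : (0 : ℝ) < (k : ℝ) ^ 2 := by positivity
    rw [Pi.single_eq_of_ne hk, zero_add, ← one_div]
    refine one_div_le_one_div_of_le hk' ?_
    have : (1 : ℝ) ≤ (2 * Real.pi) ^ 2 := by nlinarith [Real.pi_gt_three]
    nlinarith [mul_pow (2 * Real.pi) (k : ℝ) 2]

/-- Bessel's inequality for a function and its derivative. -/
theorem summable_weight_mul_sq {f : UnitAddCircle → ℝ} (hf : f ∈ Ck 1) {M : ℝ}
    (hM : ∀ x, |f x| ≤ M) (hM' : ∀ x, |tderiv f x| ≤ M) :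
    Summable (fun k : ℤ ↦ (1 + (2 * Real.pi * k) ^ 2) * casCoeff f k ^ 2) ∧
      ∑' k : ℤ, (1 + (2 * Real.pi * k) ^ 2) * casCoeff f k ^ 2 ≤ 2 * M ^ 2 := by
  obtain ⟨s1, b1⟩ := bessel_casCoeff ⟨f, continuous_of_mem_Ck hf⟩ hM
  obtain ⟨s2, b2⟩ := bessel_casCoeff ⟨tderiv f, continuous_tderiv hf⟩ hM'
  simp only [ContinuousMap.coe_mk] at s1 b1 s2 b2
  have he (k : ℤ) : casCoeff (tderiv f) (-k) ^ 2 = (2 * Real.pi * k) ^ 2 * casCoeff f k ^ 2 := by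
    rw [casCoeff_tderiv hf, neg_neg]
    push_cast
    ring
  have s3 : Summable fun k : ℤ ↦ (2 * Real.pi * k) ^ 2 * casCoeff f k ^ 2 :=
    ((Equiv.neg ℤ).summable_iff (f := fun k ↦ casCoeff (tderiv f) k ^ 2) |>.2 s2).congr
      fun k ↦ he k
  have b3 : ∑' k : ℤ, (2 * Real.pi * k) ^ 2 * casCoeff f k ^ 2 ≤ M ^ 2 := by
    refine le_of_eq_of_le ?_ b2
    rw [← (Equiv.neg ℤ).tsum_eq fun k ↦ casCoeff (tderiv f) k ^ 2]
    exact tsum_congr fun k ↦ (he k).symm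
  simp only [add_mul, one_mul]
  refine ⟨s1.add s3, ?_⟩
  rw [s1.tsum_add s3]
  linarith

theorem exists_bound_of_continuous {f : UnitAddCircle → ℝ} (hf : Continuous f) :
    ∃ M, ∀ x, |f x| ≤ M :=
  ⟨‖(⟨f, hf⟩ : C(UnitAddCircle, ℝ))‖, fun x ↦ ContinuousMap.norm_coe_le_norm ⟨f, hf⟩ x⟩

theorem exists_C1_bound {f : UnitAddCircle → ℝ} (hf : f ∈ Ck 1) :
    ∃ M, (∀ x, |f x| ≤ M) ∧ ∀ x, |tderiv f x| ≤ M := by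
  obtain ⟨M, hM⟩ := exists_bound_of_continuous (continuous_of_mem_Ck hf)
  obtain ⟨M', hM'⟩ := exists_bound_of_continuous (continuous_tderiv hf)
  exact ⟨max M M', fun x ↦ (hM x).trans (le_max_left _ _), fun x ↦ (hM' x).trans (le_max_right _ _)⟩

/-- `C¹` functions have absolutely convergent Fourier series: Cauchy-Schwarz with the weight
`1 + (2πk)²`. -/
theorem summable_abs_casCoeff {f : UnitAddCircle → ℝ} (hf : f ∈ Ck 1) :
    Summable fun k ↦ |casCoeff f k| := by
  obtain ⟨M, hM, hM'⟩ := exists_C1_bound hf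
  have hs := (summable_weight_mul_sq hf hM hM').1
  refine Summable.of_nonneg_of_le (fun k ↦ abs_nonneg _) (fun k ↦ ?_) (summable_weight.add hs)
  set w : ℝ := 1 + (2 * Real.pi * k) ^ 2
  have hw : 0 < w := by positivity
  have h := two_mul_le_add_sq (√w)⁻¹ (√w * |casCoeff f k|)
  rw [inv_pow, mul_pow, Real.sq_sqrt hw.le, sq_abs] at h
  have h2 : 2 * (√w)⁻¹ * (√w * |casCoeff f k|) = 2 * |casCoeff f k| := by
    have : √w ≠ 0 := (Real.sqrt_pos.2 hw).ne'
    field_simp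
  linarith [abs_nonneg (casCoeff f k)]

theorem abs_le_tsum_casCoeff {f : UnitAddCircle → ℝ} (hf : f ∈ Ck 1) (x : UnitAddCircle) :
    |f x| ≤ 2 * ∑' k, |casCoeff f k| := by
  have hs := summable_abs_casCoeff hf
  rw [← (hasSum_casCoeff (continuous_of_mem_Ck hf) hs x).tsum_eq, ← tsum_mul_left]
  rw [← Real.norm_eq_abs]
  refine tsum_of_norm_bounded (hs.mul_left 2).hasSum fun k ↦ ?_
  rw [norm_mul, Real.norm_eq_abs, mul_comm]
  exact mul_le_mul_of_nonneg_right (abs_cas_le _ _) (abs_nonneg _)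

theorem Ck_top_le_one {f : UnitAddCircle → ℝ} (hf : f ∈ Ck ⊤) : f ∈ Ck 1 := (toC1 ⟨f, hf⟩).2

theorem tderiv_iterate_mem {f : UnitAddCircle → ℝ} (hf : f ∈ Ck ⊤) (j : ℕ) :
    tderiv^[j] f ∈ Ck ⊤ := by
  induction j with
  | zero => exact hf
  | succ j ih =>
    rw [Function.iterate_succ_apply']
    exact tderiv_mem ih

/-- Each derivative exchanges the frequencies `k` and `-k`, whence the sign `(-1) ^ j`. -/
theorem abs_casCoeff_iterate {f : UnitAddCircle → ℝ} (hf : f ∈ Ck ⊤) (j : ℕ) (k : ℤ) :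
    |casCoeff (tderiv^[j] f) k| = |2 * Real.pi * k| ^ j * |casCoeff f ((-1) ^ j * k)| := by
  induction j generalizing k with
  | zero => simp
  | succ j ih =>
    rw [Function.iterate_succ_apply', casCoeff_tderiv (Ck_top_le_one (tderiv_iterate_mem hf j)),
      abs_mul, ih, abs_neg]
    have : (-1 : ℤ) ^ j * -k = (-1) ^ (j + 1) * k := by ring
    rw [this, Int.cast_neg, mul_neg, abs_neg]
    ring

/-- All derivatives of a smooth function are controlled by its Hartley coefficients. -/
theorem abs_iterate_tderiv_le {f : UnitAddCircle → ℝ} (hf : f ∈ Ck ⊤) (j : ℕ) :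
    Summable (fun k : ℤ ↦ |2 * Real.pi * k| ^ j * |casCoeff f k|) ∧
      ∀ x, |tderiv^[j] f x| ≤ 2 * ∑' k : ℤ, |2 * Real.pi * k| ^ j * |casCoeff f k| := by
  have hs := summable_abs_casCoeff (Ck_top_le_one (tderiv_iterate_mem hf j))
  have hb := abs_le_tsum_casCoeff (Ck_top_le_one (tderiv_iterate_mem hf j))
  simp only [abs_casCoeff_iterate hf] at hs hb
  rcases neg_one_pow_eq_or ℤ j with h | h
  · simp only [h, one_mul] at hs hb
    exact ⟨hs, hb⟩
  · simp only [h, neg_mul, one_mul] at hs hb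
    have he : (fun k : ℤ ↦ |2 * Real.pi * k| ^ j * |casCoeff f k|)
        = (fun k : ℤ ↦ |2 * Real.pi * k| ^ j * |casCoeff f (-k)|) ∘ Equiv.neg ℤ := by
      funext k
      simp
    refine ⟨by rw [he]; exact (Equiv.neg ℤ).summable_iff.2 hs, fun x ↦ (hb x).trans_eq ?_⟩
    rw [he]
    exact congrArg _ ((Equiv.neg ℤ).tsum_eq
      (fun k : ℤ ↦ |2 * Real.pi * k| ^ j * |casCoeff f (-k)|)).symm

theorem casCoeff_sub_sum (φ : Ck ⊤) (S : Finset ℤ) (k : ℤ) :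
    casCoeff (φ - ∑ l ∈ S, casCoeff φ.1 l • casTest l : Ck ⊤).1 k
      = if k ∈ S then 0 else casCoeff φ.1 k := by
  have hval (x : UnitAddCircle) : (φ - ∑ l ∈ S, casCoeff φ.1 l • casTest l : Ck ⊤).1 x * cas k x
      = φ.1 x * cas k x - ∑ l ∈ S, casCoeff φ.1 l * (cas l x * cas k x) := by
    simp only [Submodule.coe_sub, AddSubmonoidClass.coe_finsetSum, Submodule.coe_smul, Pi.sub_apply,
      Finset.sum_apply, Pi.smul_apply, smul_eq_mul, sub_mul, Finset.sum_mul, casTest, mul_assoc]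
  have hi (l : ℤ) : Integrable fun x ↦ casCoeff φ.1 l * (cas l x * cas k x) :=
    (integrable_of_continuous ((cas l).continuous.mul (cas k).continuous)).const_mul _
  have hi0 : Integrable fun x ↦ φ.1 x * cas k x :=
    integrable_of_continuous ((continuous_of_mem_Ck φ.2).mul (cas k).continuous)
  rw [casCoeff]
  simp only [hval]
  rw [integral_sub hi0 (integrable_finsetSum _ fun l _ ↦ hi l),
    integral_finsetSum _ fun l _ ↦ hi l]
  simp only [integral_const_mul, integral_cas_mul_cas, mul_ite, mul_one, mul_zero,
    Finset.sum_ite_eq']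
  rw [← casCoeff]
  split_ifs <;> simp

/-- The Hartley expansion of a smooth function converges in every `C^j`, so that a distribution is
determined by its values on the Hartley functions. -/
theorem hasSum_distrib (T : Distrib) (φ : Ck ⊤) :
    HasSum (fun k ↦ casCoeff φ.1 k * T.toLin (casTest k)) (T.toLin φ) := by
  obtain ⟨m, -, C, hC⟩ := T.bounded
  set u : ℕ → ℤ → ℝ := fun j k ↦ |2 * Real.pi * k| ^ j * |casCoeff φ.1 k| with hu
  have hus (j : ℕ) : Summable (u j) := (abs_iterate_tderiv_le φ.2 j).1
  have hres (S : Finset ℤ) (j : ℕ) (x : UnitAddCircle) :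
      |tderiv^[j] (φ - ∑ l ∈ S, casCoeff φ.1 l • casTest l : Ck ⊤).1 x|
        ≤ 2 * (∑' k, u j k - ∑ k ∈ S, u j k) := by
    refine ((abs_iterate_tderiv_le (Subtype.prop _) j).2 x).trans_eq ?_
    congr 1
    have h1 : HasSum (fun k ↦ if k ∈ S then u j k else 0) (∑ k ∈ S, u j k) := by
      have : HasSum (fun k ↦ if k ∈ S then u j k else 0)
          (∑ k ∈ S, if k ∈ S then u j k else 0) :=
        hasSum_sum_of_ne_finset_zero fun k hk ↦ if_neg hk
      rwa [Finset.sum_congr rfl fun k hk ↦ if_pos hk] at this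
    rw [← ((hus j).hasSum.sub h1).tsum_eq]
    refine tsum_congr fun k ↦ ?_
    rw [casCoeff_sub_sum]
    split_ifs <;> simp [hu]
  have hlim : Tendsto (fun S : Finset ℤ ↦
      C * ∑ j ∈ Finset.range (m + 1), 2 * (∑' k, u j k - ∑ k ∈ S, u j k)) atTop (𝓝 0) := by
    have h (j : ℕ) : Tendsto (fun S : Finset ℤ ↦ 2 * (∑' k, u j k - ∑ k ∈ S, u j k)) atTop
        (𝓝 0) := by
      simpa using ((hus j).hasSum.const_sub (∑' k, u j k)).const_mul 2
    simpa using (tendsto_finsetSum (Finset.range (m + 1)) fun j _ ↦ h j).const_mul C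
  have hT (S : Finset ℤ) : |T.toLin φ - ∑ k ∈ S, casCoeff φ.1 k * T.toLin (casTest k)|
      ≤ C * ∑ j ∈ Finset.range (m + 1), 2 * (∑' k, u j k - ∑ k ∈ S, u j k) := by
    have h1 : T.toLin φ - ∑ k ∈ S, casCoeff φ.1 k * T.toLin (casTest k)
        = T.toLin (φ - ∑ l ∈ S, casCoeff φ.1 l • casTest l) := by
      simp [map_sub, map_sum, map_smul]
    rw [h1]
    refine hC _ _ fun j hj x ↦ (hres S j x).trans ?_
    refine Finset.single_le_sum (f := fun j ↦ 2 * (∑' k, u j k - ∑ k ∈ S, u j k))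
      (fun i _ ↦ (abs_nonneg _).trans (hres S i x)) ?_
    exact Finset.mem_range.2 (Nat.lt_succ_of_le hj)
  have h0 : Tendsto (fun S : Finset ℤ ↦ T.toLin φ - ∑ k ∈ S, casCoeff φ.1 k * T.toLin (casTest k))
      atTop (𝓝 0) := squeeze_zero_norm (fun S ↦ hT S) hlim
  have := h0.const_sub (T.toLin φ)
  simpa [HasSum, SummationFilter.unconditional_filter] using this

/-! ### The resolvent kernel of the Laplacian on the circle -/

/-- The Fourier coefficients of `e^{-bx} + e^{-b(1-x)}`, `x ∈ [0, 1]`, which is a multiple of the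
Green function of `b² - Δ` on the circle. -/
theorem integral_fourier_mul_resolvent {b : ℝ} (hb : 0 < b) (n : ℤ) :
    ∫ x in (0 : ℝ)..1, Complex.exp (2 * Real.pi * Complex.I * (-n : ℤ) * x)
      * ((Real.exp (-b * x) + Real.exp (-b * (1 - x)) : ℝ) : ℂ)
      = (((1 - Real.exp (-b)) * (2 * b) / ((2 * Real.pi * n) ^ 2 + b ^ 2) : ℝ) : ℂ) := by
  set z : ℂ := 2 * Real.pi * Complex.I * (-n : ℤ) with hz
  have hz1 : Complex.exp z = 1 := by
    rw [hz, mul_comm]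
    exact Complex.exp_int_mul_two_pi_mul_I (-n)
  have hzre : z.re = 0 := by simp [hz]
  have h1 : z - b ≠ 0 := fun h ↦ hb.ne' (by simpa [hzre] using congrArg Complex.re h)
  have h2 : z + b ≠ 0 := fun h ↦ hb.ne' (by simpa [hzre] using congrArg Complex.re h)
  have hsplit (x : ℝ) :
      Complex.exp (z * x) * ((Real.exp (-b * x) + Real.exp (-b * (1 - x)) : ℝ) : ℂ)
      = Complex.exp ((z - b) * x) + Complex.exp (-b) * Complex.exp ((z + b) * x) := by
    push_cast
    rw [mul_add, ← Complex.exp_add, ← Complex.exp_add, ← Complex.exp_add]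
    congr 2 <;> ring
  simp only [hsplit]
  rw [intervalIntegral.integral_add (Continuous.intervalIntegrable (by fun_prop) _ _)
    (Continuous.intervalIntegrable (by fun_prop) _ _), intervalIntegral.integral_const_mul,
    integral_exp_mul_complex h1, integral_exp_mul_complex h2]
  simp only [Complex.ofReal_one, Complex.ofReal_zero, mul_one, mul_zero, Complex.exp_zero]
  rw [show Complex.exp (z - b) = Complex.exp (-b) by
      rw [sub_eq_add_neg, Complex.exp_add, hz1, one_mul],
    Complex.exp_add, hz1]
  have h3 : Complex.exp (-(b : ℂ)) * Complex.exp b = 1 := by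
    rw [← Complex.exp_add, neg_add_cancel, Complex.exp_zero]
  have h4 : (2 * Real.pi * n : ℂ) ^ 2 + b ^ 2 = -((z - b) * (z + b)) := by
    rw [hz]
    push_cast
    linear_combination ((2 * Real.pi * n : ℂ) ^ 2) * Complex.I_sq
  push_cast
  rw [h4]
  clear_value z
  field_simp
  linear_combination (z - b) * h3

/-- The Fourier series of the Green function of `b² - Δ`. -/
theorem hasSum_resolvent {b : ℝ} (hb : 0 < b) {r : ℝ} (hr : r ∈ Set.Ico (0 : ℝ) 1) :
    HasSum (fun k : ℤ ↦ (fourier k (r : UnitAddCircle) : ℂ).re / ((2 * Real.pi * k) ^ 2 + b ^ 2))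
      ((Real.exp (-b * r) + Real.exp (-b * (1 - r))) / (2 * b * (1 - Real.exp (-b)))) := by
  let F : ℝ → ℂ := fun x ↦ ((Real.exp (-b * x) + Real.exp (-b * (1 - x)) : ℝ) : ℂ)
  have hF01 : F 0 = F (0 + 1) := by
    simp only [F]
    congr 1
    norm_num [add_comm]
  have hFc : Continuous F := by fun_prop
  let f : C(UnitAddCircle, ℂ) := ⟨AddCircle.liftIco 1 0 F,
    AddCircle.liftIco_continuous hF01 hFc.continuousOn⟩
  have hf {x : ℝ} (hx : x ∈ Set.Icc (0 : ℝ) 1) : f (x : UnitAddCircle) = F x := by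
    rcases hx.2.lt_or_eq with h | rfl
    · exact AddCircle.liftIco_coe_apply (f := F) ⟨hx.1, by simpa using h⟩
    · have h1 : ((1 : ℝ) : UnitAddCircle) = ((0 : ℝ) : UnitAddCircle) := AddCircle.coe_period 1
      have h2 : F 1 = F 0 := by rw [hF01, zero_add]
      rw [h1, h2]
      exact AddCircle.liftIco_coe_apply (f := F) ⟨le_rfl, by norm_num⟩
  have hcoef (n : ℤ) : fourierCoeff f n
      = (((1 - Real.exp (-b)) * (2 * b) / ((2 * Real.pi * n) ^ 2 + b ^ 2) : ℝ) : ℂ) := by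
    rw [fourierCoeff_eq_intervalIntegral f n 0, ← integral_fourier_mul_resolvent hb]
    simp only [zero_add, div_one, one_smul]
    refine intervalIntegral.integral_congr fun x hx ↦ ?_
    rw [Set.uIcc_of_le zero_le_one] at hx
    simp only [hf hx, smul_eq_mul, F]
    rw [fourier_coe_apply]
    congr 2
    push_cast
    ring
  have hsr : Summable fun n : ℤ ↦
      (1 - Real.exp (-b)) * (2 * b) / ((2 * Real.pi * n) ^ 2 + b ^ 2) := by
    have hm : 0 < min 1 (b ^ 2) := lt_min one_pos (by positivity)
    have he : Real.exp (-b) < 1 := Real.exp_lt_one_iff.2 (by linarith)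
    have hn : 0 ≤ (1 - Real.exp (-b)) * (2 * b) := mul_nonneg (by linarith) (by linarith)
    refine Summable.of_nonneg_of_le (fun n ↦ by positivity) (fun n ↦ ?_)
      ((summable_weight.mul_left ((min 1 (b ^ 2))⁻¹)).mul_left ((1 - Real.exp (-b)) * (2 * b)))
    rw [div_eq_mul_inv, ← mul_inv]
    refine mul_le_mul_of_nonneg_left (inv_anti₀ (by positivity) ?_) hn
    nlinarith [min_le_left 1 (b ^ 2), min_le_right 1 (b ^ 2), sq_nonneg (2 * Real.pi * n)]
  have hs : Summable (fourierCoeff f) := by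
    rw [funext hcoef]
    exact Complex.summable_ofReal.2 hsr
  have h := Complex.hasSum_re (has_pointwise_sum_fourier_series_of_summable hs (r : UnitAddCircle))
  rw [hf ⟨hr.1, hr.2.le⟩, funext hcoef] at h
  simp only [smul_eq_mul, Complex.re_ofReal_mul, F, Complex.ofReal_re] at h
  have he : Real.exp (-b) < 1 := Real.exp_lt_one_iff.2 (by linarith)
  have hne : 1 - Real.exp (-b) ≠ 0 := by linarith
  have h2 := h.div_const (2 * b * (1 - Real.exp (-b)))
  refine h2.congr_fun fun k ↦ ?_
  field_simp

/-! ### Asymptotics of the covariance -/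

/-- The eigenvalues `(2πk)² + λ` of `λ - Δ`. -/
noncomputable def eig (lam : ℝ) (k : ℤ) : ℝ := (2 * Real.pi * k) ^ 2 + lam

theorem eig_pos {lam : ℝ} (h : 0 < lam) (k : ℤ) : 0 < eig lam k :=
  add_pos_of_nonneg_of_pos (sq_nonneg _) h

theorem eig_neg (lam : ℝ) (k : ℤ) : eig lam (-k) = eig lam k := by
  simp [eig]

theorem le_eig (lam : ℝ) (k : ℤ) : lam ≤ eig lam k := le_add_of_nonneg_left (sq_nonneg _)

theorem summable_inv_eig {lam : ℝ} (h : 0 < lam) : Summable fun k ↦ (eig lam k)⁻¹ := by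
  refine Summable.of_nonneg_of_le (fun k ↦ (inv_pos.2 (eig_pos h k)).le) (fun k ↦ ?_)
    (summable_weight.mul_left ((min 1 lam)⁻¹))
  have hm : 0 < min 1 lam := lt_min one_pos h
  rw [← mul_inv]
  refine inv_anti₀ (by positivity) ?_
  rw [eig]
  nlinarith [min_le_left 1 lam, min_le_right 1 lam, sq_nonneg (2 * Real.pi * k)]

theorem abs_cas_mul_cas_le (k : ℤ) (x y : UnitAddCircle) : |cas k x * cas k y| ≤ 4 := by
  rw [abs_mul]
  calc |cas k x| * |cas k y| ≤ 2 * 2 :=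
        mul_le_mul (abs_cas_le k x) (abs_cas_le k y) (abs_nonneg _) zero_le_two
    _ = 4 := by norm_num

/-- The Green function of `λ - Δ` on the circle. -/
theorem hasSum_cas_mul_cas_div_eig {lam : ℝ} (h : 0 < lam) {x y : UnitAddCircle} {r : ℝ}
    (hr : r ∈ Set.Ico (0 : ℝ) 1) (hxy : x - y = (r : UnitAddCircle)) :
    HasSum (fun k : ℤ ↦ cas k x * cas k y / eig lam k)
      ((Real.exp (-√lam * r) + Real.exp (-√lam * (1 - r)))
        / (2 * √lam * (1 - Real.exp (-√lam)))) := by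
  have h1 := hasSum_resolvent (Real.sqrt_pos.2 h) hr
  rw [Real.sq_sqrt h.le] at h1
  have h2 := hasSum_zero_of_odd (f := fun k ↦ (fourier k (x + y)).im / eig lam k) ?_ ?_
  · have h3 := h1.add h2
    rw [add_zero] at h3
    refine h3.congr_fun fun k ↦ ?_
    rw [cas_mul_cas', hxy, add_div, eig]
  · refine Summable.of_norm_bounded (summable_inv_eig h) fun k ↦ ?_
    rw [norm_div, Real.norm_of_nonneg (eig_pos h k).le, div_eq_mul_inv]
    refine mul_le_of_le_one_left (inv_pos.2 (eig_pos h k)).le ?_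
    refine (Complex.abs_im_le_norm _).trans ?_
    rw [fourier_apply, Circle.norm_coe]
  · intro k
    rw [fourier_neg, Complex.conj_im, eig_neg, neg_div]

/-- A sum over the modes with a time factor `e^{-aτ}`, `τ > 0`, is exponentially small in `λ`. -/
theorem tendsto_damped_sum {c τ : ℝ} (hc : 0 < c) (hτ : 0 < τ) (x y : UnitAddCircle) :
    Tendsto (fun K : ℝ ↦ √K * ∑' k, cas k x * cas k y *
      (Real.exp (-(eig (c * K) k * τ)) / (2 * eig (c * K) k))) atTop (𝓝 0) := by
  set D := ∑' k, (eig c k)⁻¹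
  have hlim : Tendsto (fun K : ℝ ↦ (2 * D) * (K ^ (1 / 2 : ℝ) * Real.exp (-(c * τ) * K))) atTop
      (𝓝 0) := by
    simpa using (tendsto_rpow_mul_exp_neg_mul_atTop_nhds_zero (1 / 2) (c * τ)
      (mul_pos hc hτ)).const_mul (2 * D)
  refine squeeze_zero_norm' ?_ hlim
  filter_upwards [eventually_ge_atTop (1 : ℝ)] with K hK
  have hcK : 0 < c * K := by positivity
  have hle : c ≤ c * K := le_mul_of_one_le_right hc.le hK
  have hb : |∑' k, cas k x * cas k y * (Real.exp (-(eig (c * K) k * τ)) / (2 * eig (c * K) k))|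
      ≤ Real.exp (-(c * τ) * K) * 2 * D := by
    rw [← Real.norm_eq_abs]
    refine tsum_of_norm_bounded ((summable_inv_eig hc).hasSum.mul_left _) fun k ↦ ?_
    have he := eig_pos hcK k
    have hce : eig c k ≤ eig (c * K) k := add_le_add_right hle _
    have h1 : Real.exp (-(eig (c * K) k * τ)) ≤ Real.exp (-(c * τ) * K) := by
      refine Real.exp_le_exp.2 ?_
      nlinarith [mul_le_mul_of_nonneg_right (le_eig (c * K) k) hτ.le]
    have h2 : (eig (c * K) k)⁻¹ ≤ (eig c k)⁻¹ := inv_anti₀ (eig_pos hc k) hce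
    rw [norm_mul, Real.norm_eq_abs, Real.norm_of_nonneg (by positivity)]
    calc |cas k x * cas k y| * (Real.exp (-(eig (c * K) k * τ)) / (2 * eig (c * K) k))
        ≤ 4 * (Real.exp (-(eig (c * K) k * τ)) / (2 * eig (c * K) k)) :=
          mul_le_mul_of_nonneg_right (abs_cas_mul_cas_le k x y) (by positivity)
      _ = 2 * (Real.exp (-(eig (c * K) k * τ)) * (eig (c * K) k)⁻¹) := by field_simp; norm_num
      _ ≤ 2 * (Real.exp (-(c * τ) * K) * (eig c k)⁻¹) := by gcongr
      _ = Real.exp (-(c * τ) * K) * 2 * (eig c k)⁻¹ := by ring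
  rw [norm_mul, Real.norm_of_nonneg (Real.sqrt_nonneg _), Real.norm_eq_abs, Real.sqrt_eq_rpow]
  calc K ^ (1 / 2 : ℝ) * |_| ≤ K ^ (1 / 2 : ℝ) * (Real.exp (-(c * τ) * K) * 2 * D) :=
        mul_le_mul_of_nonneg_left hb (by positivity)
    _ = _ := by ring

/-- The rescaled Green function concentrates on the diagonal. -/
theorem tendsto_green {c : ℝ} (hc : 0 < c) (x y : UnitAddCircle) :
    Tendsto (fun K : ℝ ↦ √K * ∑' k, cas k x * cas k y * (1 / (2 * eig (c * K) k))) atTop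
      (𝓝 (if x = y then 1 / (4 * √c) else 0)) := by
  obtain ⟨r, hr, hxy⟩ : ∃ r ∈ Set.Ico (0 : ℝ) 1, x - y = (r : UnitAddCircle) := by
    refine ⟨(AddCircle.equivIco 1 0 (x - y) : ℝ), ?_, (AddCircle.coe_equivIco).symm⟩
    simpa using (AddCircle.equivIco 1 0 (x - y)).2
  have hr0 : x = y ↔ r = 0 := by
    rw [← sub_eq_zero, hxy, AddCircle.coe_eq_zero_iff_of_mem_Ico (by simpa using hr)]
  have hb : Tendsto (fun K : ℝ ↦ √(c * K)) atTop atTop :=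
    Real.tendsto_sqrt_atTop.comp (tendsto_id.const_mul_atTop hc)
  have hexp {s : ℝ} (hs : 0 < s) : Tendsto (fun K : ℝ ↦ Real.exp (-√(c * K) * s)) atTop (𝓝 0) := by
    have : Tendsto (fun K : ℝ ↦ √(c * K) * s) atTop atTop := hb.atTop_mul_const hs
    simpa only [neg_mul, Function.comp_def] using Real.tendsto_exp_neg_atTop_nhds_zero.comp this
  have hnum : Tendsto (fun K : ℝ ↦ 1 / (4 * √c) * ((Real.exp (-√(c * K) * r)
      + Real.exp (-√(c * K) * (1 - r))) / (1 - Real.exp (-√(c * K) * 1)))) atTop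
      (𝓝 (if x = y then 1 / (4 * √c) else 0)) := by
    have h1 : Tendsto (fun K : ℝ ↦ Real.exp (-√(c * K) * r)) atTop
        (𝓝 (if x = y then 1 else 0)) := by
      split_ifs with h
      · simp [hr0.1 h]
      · exact hexp (lt_of_le_of_ne hr.1 fun h' ↦ h (hr0.2 h'.symm))
    have h2 := ((h1.add (hexp (sub_pos.2 hr.2))).div
      ((hexp one_pos).const_sub 1) (by simp)).const_mul (1 / (4 * √c))
    refine h2.trans_eq ?_
    split_ifs <;> simp
  refine hnum.congr' ?_
  filter_upwards [eventually_gt_atTop (0 : ℝ)] with K hK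
  have h := (hasSum_cas_mul_cas_div_eig (mul_pos hc hK) hr hxy).div_const 2
  have h' : HasSum (fun k ↦ cas k x * cas k y * (1 / (2 * eig (c * K) k))) _ :=
    h.congr_fun fun k ↦ by rw [mul_one_div, div_div, mul_comm (2 : ℝ)]
  rw [h'.tsum_eq, Real.sqrt_mul hc.le, mul_one]
  have h1 : 0 < √c := Real.sqrt_pos.2 hc
  have h2 : 0 < √K := Real.sqrt_pos.2 hK
  have h3 : 1 - Real.exp (-(√c * √K)) ≠ 0 := by
    have : Real.exp (-(√c * √K)) < 1 := Real.exp_lt_one_iff.2 (neg_lt_zero.2 (mul_pos h1 h2))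
    linarith
  field_simp
  norm_num

/-- The covariance `E[X(t) X(s)]` of the Ornstein-Uhlenbeck process `dX = -aX dt + dB`,
`X(0) = 0`. -/
noncomputable def ouCov (a t s : ℝ) : ℝ :=
  (Real.exp (-(a * |t - s|)) - Real.exp (-(a * (t + s)))) / (2 * a)

/-- Asymptotics of the covariance function of the rescaled solution. -/
theorem tendsto_cov {c t s : ℝ} (hc : 0 < c) (ht : 0 < t) (hs : 0 < s) (x y : UnitAddCircle) :
    Tendsto (fun K : ℝ ↦ √K * ∑' k, cas k x * cas k y * ouCov (eig (c * K) k) t s) atTop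
      (𝓝 (if t = s ∧ x = y then 1 / (4 * √c) else 0)) := by
  have hsum {K : ℝ} (hK : 0 < K) {τ : ℝ} (hτ : 0 ≤ τ) : Summable fun k ↦ cas k x * cas k y *
      (Real.exp (-(eig (c * K) k * τ)) / (2 * eig (c * K) k)) := by
    refine Summable.of_norm_bounded ((summable_inv_eig (mul_pos hc hK)).mul_left 4) fun k ↦ ?_
    have he := eig_pos (mul_pos hc hK) k
    rw [norm_mul, Real.norm_of_nonneg (r := _ / _) (by positivity)]
    refine mul_le_mul (abs_cas_mul_cas_le k x y) ?_ (by positivity) (by norm_num)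
    rw [← one_div]
    refine div_le_div₀ zero_le_one (Real.exp_le_one_iff.2 ?_) he (by linarith)
    exact neg_nonpos.2 (mul_nonneg he.le hτ)
  have h1 : Tendsto (fun K : ℝ ↦ √K * ∑' k, cas k x * cas k y *
      (Real.exp (-(eig (c * K) k * |t - s|)) / (2 * eig (c * K) k))) atTop
      (𝓝 (if t = s ∧ x = y then 1 / (4 * √c) else 0)) := by
    by_cases hts : t = s
    · simpa [hts] using tendsto_green hc x y
    · simpa [hts] using tendsto_damped_sum hc (abs_pos.2 (sub_ne_zero.2 hts)) x y
  have h2 := h1.sub (tendsto_damped_sum hc (add_pos ht hs) x y)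
  rw [sub_zero] at h2
  refine h2.congr' ?_
  filter_upwards [eventually_gt_atTop (0 : ℝ)] with K hK
  rw [← mul_sub, ← (hsum hK (abs_nonneg _)).tsum_sub (hsum hK (add_pos ht hs).le)]
  congr 1
  refine tsum_congr fun k ↦ ?_
  rw [ouCov]
  ring

/-- The integral is `Γ(1/2) (2c)^{-1/2} = √(π / (2c))`. -/
theorem sigmaSq_eq {c : ℝ} (hc : 0 < c) (c₂ : ℝ) : sigmaSq c c₂ = c₂ ^ 2 * (1 / (4 * √c)) := by
  have h := Real.integral_rpow_mul_exp_neg_mul_Ioi (a := 1 / 2) (r := 2 * c) (by norm_num)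
    (by positivity)
  have h1 : ∫ u in Set.Ioi (0 : ℝ), Real.exp (-2 * c * u) / Real.sqrt u
      = (1 / (2 * c)) ^ (1 / 2 : ℝ) * Real.Gamma (1 / 2) := by
    rw [← h]
    refine setIntegral_congr_fun measurableSet_Ioi fun u hu ↦ ?_
    have hu' : (0 : ℝ) < u := hu
    rw [Real.sqrt_eq_rpow, div_eq_mul_inv, ← Real.rpow_neg hu'.le, mul_comm]
    norm_num
  rw [sigmaSq, h1, Real.Gamma_one_half_eq, ← Real.sqrt_eq_rpow, Real.sqrt_div zero_le_one,
    Real.sqrt_one, Real.sqrt_mul zero_le_two, Real.sqrt_mul (by norm_num : (0 : ℝ) ≤ 8),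
    show (8 : ℝ) = 2 ^ 2 * 2 by norm_num, Real.sqrt_mul (by norm_num), Real.sqrt_sq zero_le_two]
  have hs := Real.sq_sqrt (zero_le_two : (0 : ℝ) ≤ 2)
  have hp : 0 < √Real.pi := Real.sqrt_pos.2 Real.pi_pos
  have hc' : 0 < √c := Real.sqrt_pos.2 hc
  field_simp
  rw [hs]
  ring

/-! ### White noise as a linear isometry -/

section

/-- A map between inner product spaces that preserves inner products is linear. -/
noncomputable def isometryOfInnerEq {E F : Type*} [NormedAddCommGroup E] [InnerProductSpace ℝ E]
    [NormedAddCommGroup F] [InnerProductSpace ℝ F] (J : E → F)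
    (hJ : ∀ f g, inner ℝ (J f) (J g) = inner ℝ f g) : E →ₗᵢ[ℝ] F :=
  LinearMap.isometryOfInner
    { toFun := J
      map_add' := fun f g ↦ by
        rw [← sub_eq_zero, ← inner_self_eq_zero (𝕜 := ℝ)]
        simp only [inner_sub_left, inner_sub_right, inner_add_left, inner_add_right, hJ]
        ring
      map_smul' := fun r f ↦ by
        rw [← sub_eq_zero, ← inner_self_eq_zero (𝕜 := ℝ)]
        simp only [inner_sub_left, inner_sub_right, inner_smul_left, inner_smul_right, hJ,
          RingHom.id_apply]
        ring } hJ

theorem inner_toLp_two {α : Type*} [MeasurableSpace α] {μ : Measure α} {f g : α → ℝ}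
    (hf : MemLp f 2 μ) (hg : MemLp g 2 μ) :
    inner ℝ (hf.toLp f) (hg.toLp g) = ∫ z, f z * g z ∂μ := by
  rw [L2.inner_def]
  refine integral_congr_ae ?_
  filter_upwards [hf.coeFn_toLp, hg.coeFn_toLp] with z h1 h2
  simp [h1, h2, mul_comm]

variable {Ω : Type*} [MeasurableSpace Ω] {P : Measure Ω} {W : Integrand → Ω → ℝ}

theorem IsWhiteNoise.memLp (hW : IsWhiteNoise P W) (f : Integrand) : MemLp (W f) 2 P :=
  (hW.gaussian.hasGaussianLaw_eval f).memLp_two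

/-- White noise as an isometry from `L²([0, ∞) × 𝕋)` to `L²(Ω)`. -/
noncomputable def IsWhiteNoise.isometry (hW : IsWhiteNoise P W) :
    Lp ℝ 2 stMeasure →ₗᵢ[ℝ] Lp ℝ 2 P :=
  isometryOfInnerEq (fun f ↦ (hW.memLp ⟨f, Lp.memLp f⟩).toLp _) fun f g ↦ by
    rw [inner_toLp_two, hW.covariance, L2.inner_def]
    exact integral_congr_ae (ae_of_all _ fun z ↦ mul_comm _ _)

theorem IsWhiteNoise.coeFn_isometry (hW : IsWhiteNoise P W) (f : Lp ℝ 2 stMeasure) :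
    hW.isometry f =ᵐ[P] W ⟨f, Lp.memLp f⟩ :=
  (hW.memLp ⟨f, Lp.memLp f⟩).coeFn_toLp

/-- The value of white noise at an integrand depends, almost surely, only on the class of the
integrand: this is forced by the covariance. -/
theorem IsWhiteNoise.ae_eq_isometry (hW : IsWhiteNoise P W) (f : Integrand) :
    W f =ᵐ[P] hW.isometry (f.2.toLp f.1) := by
  set g : Integrand := ⟨f.2.toLp f.1, Lp.memLp _⟩
  have hfg : g.1 =ᵐ[stMeasure] f.1 := f.2.coeFn_toLp
  have h0 : (hW.memLp f).toLp _ - (hW.memLp g).toLp _ = 0 := by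
    rw [← inner_self_eq_zero (𝕜 := ℝ)]
    simp only [inner_sub_left, inner_sub_right, inner_toLp_two, hW.covariance]
    have h1 : ∫ z, f.1 z * g.1 z ∂stMeasure = ∫ z, f.1 z * f.1 z ∂stMeasure :=
      integral_congr_ae (hfg.mono fun z hz ↦ by simp only [hz])
    have h2 : ∫ z, g.1 z * f.1 z ∂stMeasure = ∫ z, f.1 z * f.1 z ∂stMeasure :=
      integral_congr_ae (hfg.mono fun z hz ↦ by simp only [hz])
    have h3 : ∫ z, g.1 z * g.1 z ∂stMeasure = ∫ z, f.1 z * f.1 z ∂stMeasure :=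
      integral_congr_ae (hfg.mono fun z hz ↦ by simp only [hz])
    rw [h1, h2, h3]
    ring
  have h4 := (hW.memLp f).coeFn_toLp
  rw [sub_eq_zero.1 h0] at h4
  exact h4.symm

theorem IsWhiteNoise.isGaussianProcess_isometry (hW : IsWhiteNoise P W) {T : Type*}
    (f : T → Lp ℝ 2 stMeasure) : IsGaussianProcess (fun t ↦ ⇑(hW.isometry (f t))) P :=
  (hW.gaussian.comp_right fun t ↦ ⟨f t, Lp.memLp (f t)⟩).congr fun t ↦
    (hW.coeFn_isometry (f t)).symm

theorem IsWhiteNoise.integral_isometry (hW : IsWhiteNoise P W) (f : Lp ℝ 2 stMeasure) :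
    ∫ ω, hW.isometry f ω ∂P = 0 := by
  rw [integral_congr_ae (hW.coeFn_isometry f), hW.mean_zero]

theorem IsWhiteNoise.map_isometry [IsProbabilityMeasure P] (hW : IsWhiteNoise P W)
    (f : Lp ℝ 2 stMeasure) :
    P.map (hW.isometry f) = gaussianReal 0 (‖f‖ ^ 2).toNNReal := by
  have hm : MemLp (hW.isometry f) 2 P := Lp.memLp _
  have hv : Var[hW.isometry f; P] = ‖f‖ ^ 2 := by
    rw [variance_of_integral_eq_zero hm.1.aemeasurable (hW.integral_isometry f),
      ← hW.isometry.norm_map f, ← real_inner_self_eq_norm_sq, L2.inner_def]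
    refine integral_congr_ae (ae_of_all _ fun ω ↦ ?_)
    simp [sq]
  have hg := (hW.isGaussianProcess_isometry fun _ : Unit ↦ f).hasGaussianLaw_eval ()
  rw [hg.map_eq_gaussianReal, hW.integral_isometry, hv]

/-- The fourth moment of a standard normal variable. -/
noncomputable def gaussFourth : ℝ≥0∞ := ∫⁻ x, ENNReal.ofReal (x ^ 4) ∂(gaussianReal 0 1)

theorem gaussFourth_lt_top : gaussFourth < ∞ := by
  have h : Integrable (fun x : ℝ ↦ x ^ 4) (gaussianReal 0 1) := by
    have := (memLp_id_gaussianReal (μ := 0) (v := 1) 4).integrable_norm_pow (by norm_num)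
    refine this.congr (ae_of_all _ fun x ↦ ?_)
    simp only [id, Real.norm_eq_abs]
    exact Even.pow_abs (by decide) x
  exact h.lintegral_lt_top

/-- `hW.isometry f` is distributed like `‖f‖` times a standard normal variable. -/
theorem IsWhiteNoise.lintegral_fourth [IsProbabilityMeasure P] (hW : IsWhiteNoise P W)
    (f : Lp ℝ 2 stMeasure) :
    ∫⁻ ω, ENNReal.ofReal (hW.isometry f ω ^ 4) ∂P = ENNReal.ofReal (‖f‖ ^ 4) * gaussFourth := by
  have hmeas : Measurable fun x : ℝ ↦ ENNReal.ofReal (x ^ 4) := by fun_prop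
  have h1 : P.map (hW.isometry f) = (gaussianReal 0 1).map (‖f‖ * ·) := by
    rw [hW.map_isometry, gaussianReal_map_const_mul]
    congr 1
    · simp
    · rw [mul_one]
      exact NNReal.eq (Real.coe_toNNReal _ (sq_nonneg _))
  rw [← lintegral_map' (f := fun x ↦ ENNReal.ofReal (x ^ 4)) hmeas.aemeasurable
    (Lp.memLp (hW.isometry f)).1.aemeasurable, h1, lintegral_map hmeas (measurable_const_mul _),
    gaussFourth, ← lintegral_const_mul _ hmeas]
  refine lintegral_congr fun x ↦ ?_
  rw [mul_pow, ENNReal.ofReal_mul (by positivity)]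

end

/-! ### Variation of constants -/

section

theorem abs_exp_neg_sub_exp_neg_le {u v : ℝ} (hu : 0 ≤ u) (hv : 0 ≤ v) :
    |Real.exp (-u) - Real.exp (-v)| ≤ |u - v| := by
  wlog h : u ≤ v generalizing u v
  · rw [abs_sub_comm, abs_sub_comm u]
    exact this hv hu (le_of_not_ge h)
  have h1 : Real.exp (-v) = Real.exp (-u) * Real.exp (-(v - u)) := by
    rw [← Real.exp_add]
    ring_nf
  have h2 : 1 - (v - u) ≤ Real.exp (-(v - u)) := by linarith [Real.add_one_le_exp (-(v - u))]
  have h3 : Real.exp (-(v - u)) ≤ 1 := Real.exp_le_one_iff.2 (by linarith)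
  have h4 : Real.exp (-u) ≤ 1 := Real.exp_le_one_iff.2 (by linarith)
  rw [abs_of_nonneg (sub_nonneg.2 (Real.exp_le_exp.2 (by linarith))), abs_of_nonpos (by linarith),
    h1]
  nlinarith [Real.exp_pos (-u)]

/-- The error of the Riemann sums in the summation by parts of `e^{as} X(s)`. -/
theorem tendsto_riemann_error {X : ℝ → ℝ} {a t : ℝ} (ha : 0 < a) (ht : 0 ≤ t)
    (hX : ContinuousOn X (Set.Ici 0)) :
    Tendsto (fun n : ℕ ↦ ∑ i ∈ Finset.range n,
      ((Real.exp (-(a * (t - (i + 1 : ℕ) * (t / n)))) - Real.exp (-(a * (t - i * (t / n)))))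
          * X (i * (t / n))
        - a * Real.exp (-(a * (t - (i + 1 : ℕ) * (t / n))))
          * ∫ s in (i * (t / n))..((i + 1 : ℕ) * (t / n)), X s)) atTop (𝓝 0) := by
  have hXI : ContinuousOn X (Set.Icc 0 t) := hX.mono Set.Icc_subset_Ici_self
  have huc := isCompact_Icc.uniformContinuousOn_of_continuous hXI
  obtain ⟨M, hM⟩ := isCompact_Icc.exists_bound_of_continuousOn hXI
  have hM0 : 0 ≤ M := (norm_nonneg _).trans (hM 0 ⟨le_rfl, ht⟩)
  rw [Metric.tendsto_atTop]
  intro η hη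
  set ε : ℝ := η / (2 * (a * t + 1))
  have hε : 0 < ε := by positivity
  obtain ⟨δ, hδ, hδ'⟩ := Metric.uniformContinuousOn_iff.1 huc ε hε
  have hlim : Tendsto (fun n : ℕ ↦ t / (n : ℝ)) atTop (𝓝 0) :=
    tendsto_const_div_atTop_nhds_zero_nat t
  have hlim2 : Tendsto (fun n : ℕ ↦ a * t * (M * a * (t / (n : ℝ)))) atTop (𝓝 0) := by
    simpa using (hlim.const_mul (M * a)).const_mul (a * t)
  obtain ⟨n0, hn0⟩ := eventually_atTop.1 (((hlim.eventually (gt_mem_nhds hδ)).and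
    (hlim2.eventually (gt_mem_nhds (half_pos hη)))).and (eventually_ge_atTop 1))
  refine ⟨n0, fun n hn ↦ ?_⟩
  obtain ⟨⟨hn1, hn2⟩, hn3⟩ := hn0 n hn
  have hnpos : (0 : ℝ) < n := by exact_mod_cast hn3
  set d : ℝ := t / n with hd
  have hd0 : 0 ≤ d := by positivity
  have hnd : n * d = t := by rw [hd]; field_simp
  rw [dist_zero_right]
  have hterm (i : ℕ) (hi : i ∈ Finset.range n) :
      ‖(Real.exp (-(a * (t - (i + 1 : ℕ) * d))) - Real.exp (-(a * (t - i * d)))) * X (i * d)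
        - a * Real.exp (-(a * (t - (i + 1 : ℕ) * d))) * ∫ s in (i * d)..((i + 1 : ℕ) * d), X s‖
      ≤ (a * (ε + M * a * d)) * d := by
    have hi' : ((i + 1 : ℕ) : ℝ) ≤ n := by exact_mod_cast Finset.mem_range.1 hi
    have hle : (i : ℝ) * d ≤ (i + 1 : ℕ) * d := by push_cast; linarith
    have hlen : ((i + 1 : ℕ) : ℝ) * d - i * d = d := by push_cast; ring
    have hi0 : 0 ≤ (i : ℝ) * d := by positivity
    have hit : ((i + 1 : ℕ) : ℝ) * d ≤ t := by
      rw [← hnd]; exact mul_le_mul_of_nonneg_right hi' hd0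
    have hXint : IntervalIntegrable X volume (i * d) ((i + 1 : ℕ) * d) := by
      refine (hX.mono fun s hs ↦ ?_).intervalIntegrable
      rw [Set.uIcc_of_le hle] at hs
      exact hi0.trans hs.1
    have hEi : IntervalIntegrable (fun s ↦ a * Real.exp (-(a * (t - s)))) volume
      (i * d) ((i + 1 : ℕ) * d) := Continuous.intervalIntegrable (by fun_prop) _ _
    have hEint : ∫ s in (i * d)..((i + 1 : ℕ) * d), a * Real.exp (-(a * (t - s)))
        = Real.exp (-(a * (t - (i + 1 : ℕ) * d))) - Real.exp (-(a * (t - i * d))) := by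
      refine intervalIntegral.integral_eq_sub_of_hasDerivAt
        (f := fun s ↦ Real.exp (-(a * (t - s)))) (fun s _ ↦ ?_) hEi
      have h1 : HasDerivAt (fun s ↦ -(a * (t - s))) a s := by
        exact (((hasDerivAt_id s).const_sub t).const_mul a).neg.congr_deriv (by simp)
      simpa [mul_comm] using h1.exp
    rw [← hEint, ← intervalIntegral.integral_mul_const, ← intervalIntegral.integral_const_mul,
      ← intervalIntegral.integral_sub (hEi.mul_const _) (hXint.const_mul _)]
    refine (intervalIntegral.norm_integral_le_of_norm_le_const (C := a * (ε + M * a * d))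
      fun s hs ↦ ?_).trans_eq ?_
    · rw [Set.uIoc_of_le hle] at hs
      have hs0 : 0 ≤ s := hi0.trans hs.1.le
      have hst : s ≤ t := hs.2.trans hit
      have hsI : s ∈ Set.Icc 0 t := ⟨hs0, hst⟩
      have hiI : (i : ℝ) * d ∈ Set.Icc 0 t := ⟨hi0, hle.trans hit⟩
      have hdist : |s - i * d| ≤ d := by
        rw [abs_of_nonneg (by linarith [hs.1])]
        linarith [hs.2]
      have hx : |X (i * d) - X s| ≤ ε := by
        have := hδ' _ hiI _ hsI (by rw [dist_comm, Real.dist_eq]; exact hdist.trans_lt hn1)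
        rw [Real.dist_eq] at this
        exact this.le
      have he := abs_exp_neg_sub_exp_neg_le (u := a * (t - s)) (v := a * (t - (i + 1 : ℕ) * d))
        (mul_nonneg ha.le (by linarith)) (mul_nonneg ha.le (by linarith))
      have he2 : |a * (t - s) - a * (t - (i + 1 : ℕ) * d)| ≤ a * d := by
        rw [← mul_sub, abs_mul, abs_of_pos ha, abs_of_nonneg (by linarith [hs.2])]
        exact mul_le_mul_of_nonneg_left (by linarith [hs.1]) ha.le
      have he1 : Real.exp (-(a * (t - s))) ≤ 1 :=
        Real.exp_le_one_iff.2 (neg_nonpos.2 (mul_nonneg ha.le (by linarith)))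
      have hsplit : a * Real.exp (-(a * (t - s))) * X (i * d)
          - a * Real.exp (-(a * (t - (i + 1 : ℕ) * d))) * X s
          = a * (Real.exp (-(a * (t - s))) * (X (i * d) - X s)
            + (Real.exp (-(a * (t - s))) - Real.exp (-(a * (t - (i + 1 : ℕ) * d)))) * X s) := by
        ring
      rw [hsplit, norm_mul, Real.norm_of_nonneg ha.le]
      refine mul_le_mul_of_nonneg_left ((norm_add_le _ _).trans (add_le_add ?_ ?_)) ha.le
      · rw [norm_mul, Real.norm_of_nonneg (Real.exp_pos _).le, Real.norm_eq_abs]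
        calc _ ≤ 1 * ε := mul_le_mul he1 hx (abs_nonneg _) zero_le_one
          _ = ε := one_mul _
      · rw [norm_mul, Real.norm_eq_abs]
        calc _ ≤ (a * d) * M := mul_le_mul (he.trans he2) (hM s hsI) (norm_nonneg _) (by positivity)
          _ = M * a * d := by ring
    · rw [hlen, abs_of_nonneg hd0]
  refine (norm_sum_le_of_le _ hterm).trans_lt ?_
  rw [Finset.sum_const, Finset.card_range, nsmul_eq_mul]
  have h1 : (n : ℝ) * (a * (ε + M * a * d) * d) = a * t * ε + a * t * (M * a * d) := by
    rw [← hnd]; ring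
  rw [h1]
  have h2 : a * t * ε ≤ η / 2 := by
    have : (a * t + 1) * ε = η / 2 := by
      simp only [ε]
      field_simp
    nlinarith
  linarith

/-- Summation by parts of `e^{-a(t-s)} X(s)` along a partition, for a solution of
`X(t) = X(0) - a ∫₀ᵗ X ds + N(t)`. -/
theorem summation_by_parts {X N : ℝ → ℝ} {a t x₀ : ℝ} (hX : ContinuousOn X (Set.Ici 0))
    (ht : 0 ≤ t) {n : ℕ} (hn : 0 < n)
    (h : ∀ i ≤ n, X (i * (t / n))
      = x₀ - a * (∫ s in (0 : ℝ)..(i * (t / n)), X s) + N (i * (t / n))) :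
    X t - Real.exp (-(a * t)) * X 0
      = ∑ i ∈ Finset.range n,
      ((Real.exp (-(a * (t - (i + 1 : ℕ) * (t / n)))) - Real.exp (-(a * (t - i * (t / n)))))
          * X (i * (t / n))
        - a * Real.exp (-(a * (t - (i + 1 : ℕ) * (t / n))))
          * ∫ s in (i * (t / n))..((i + 1 : ℕ) * (t / n)), X s)
      + ∑ i ∈ Finset.range n, Real.exp (-(a * (t - (i + 1 : ℕ) * (t / n))))
        * (N ((i + 1 : ℕ) * (t / n)) - N (i * (t / n))) := by
  have hnpos : (0 : ℝ) < n := by exact_mod_cast hn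
  have htel := Finset.sum_range_sub
    (fun i : ℕ ↦ Real.exp (-(a * (t - i * (t / n)))) * X (i * (t / n))) n
  have hnt : (n : ℝ) * (t / n) = t := by field_simp
  simp only [hnt, sub_self, mul_zero, neg_zero, Real.exp_zero, one_mul, Nat.cast_zero, zero_mul,
    sub_zero] at htel
  rw [← htel, ← Finset.sum_add_distrib]
  refine Finset.sum_congr rfl fun i hi ↦ ?_
  have hi' := Finset.mem_range.1 hi
  have hint (j : ℕ) : IntervalIntegrable X volume 0 (j * (t / n)) := by
    refine (hX.mono fun s hs ↦ ?_).intervalIntegrable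
    rw [Set.uIcc_of_le (by positivity)] at hs
    exact hs.1
  have h1 := h i hi'.le
  have h2 := h (i + 1) hi'
  have h3 := intervalIntegral.integral_interval_sub_left (hint (i + 1)) (hint i)
  rw [← h3]
  linear_combination (Real.exp (-(a * (t - (i + 1 : ℕ) * (t / n))))) * (h2 - h1)

variable {Ω : Type*} [MeasurableSpace Ω] {P : Measure Ω}

/-- The solution of `X(t) = x₀ - a ∫₀ᵗ X ds + N(t)` is `e^{-at} x₀ + Y` if `Y` is the limit in
`L²(Ω)` of the Riemann sums for `∫₀ᵗ e^{-a(t-s)} dN(s)`. -/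
theorem variation_of_constants {X : ℝ → Ω → ℝ} {x₀ : Ω → ℝ} {a t : ℝ} (ha : 0 < a) (ht : 0 ≤ t)
    (N : ℝ → Lp ℝ 2 P) (Y : Lp ℝ 2 P) (hX : ∀ᵐ ω ∂P, ContinuousOn (fun s ↦ X s ω) (Set.Ici 0))
    (heq : ∀ s, 0 ≤ s → ∀ᵐ ω ∂P, X s ω = x₀ ω - a * (∫ r in (0 : ℝ)..s, X r ω) + N s ω)
    (hN : N 0 = 0)
    (hY : Tendsto (fun n : ℕ ↦ ∑ i ∈ Finset.range n, Real.exp (-(a * (t - (i + 1 : ℕ) * (t / n))))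
        • (N ((i + 1 : ℕ) * (t / n)) - N (i * (t / n)))) atTop (𝓝 Y)) :
    ∀ᵐ ω ∂P, X t ω = Real.exp (-(a * t)) * x₀ ω + Y ω := by
  obtain ⟨ns, hns, hlim⟩ := (tendstoInMeasure_of_tendsto_Lp hY).exists_seq_tendsto_ae
  have h1 : ∀ᵐ ω ∂P, ∀ n i : ℕ, X (i * (t / n)) ω
      = x₀ ω - a * (∫ r in (0 : ℝ)..(i * (t / n)), X r ω) + N (i * (t / n)) ω :=
    ae_all_iff.2 fun n ↦ ae_all_iff.2 fun i ↦ heq _ (by positivity)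
  have h2 : ∀ᵐ ω ∂P, ∀ n : ℕ,
      (∑ i ∈ Finset.range n, Real.exp (-(a * (t - (i + 1 : ℕ) * (t / n))))
        • (N ((i + 1 : ℕ) * (t / n)) - N (i * (t / n))) : Lp ℝ 2 P) ω
      = ∑ i ∈ Finset.range n, Real.exp (-(a * (t - (i + 1 : ℕ) * (t / n))))
        * (N ((i + 1 : ℕ) * (t / n)) ω - N (i * (t / n)) ω) := by
    refine ae_all_iff.2 fun n ↦ ?_
    have h3 : ∀ᵐ ω ∂P, ∀ i : ℕ, (Real.exp (-(a * (t - (i + 1 : ℕ) * (t / n))))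
        • (N ((i + 1 : ℕ) * (t / n)) - N (i * (t / n))) : Lp ℝ 2 P) ω
        = Real.exp (-(a * (t - (i + 1 : ℕ) * (t / n))))
        * (N ((i + 1 : ℕ) * (t / n)) ω - N (i * (t / n)) ω) := by
      refine ae_all_iff.2 fun i ↦ ?_
      filter_upwards [Lp.coeFn_smul (Real.exp (-(a * (t - (i + 1 : ℕ) * (t / n)))))
        (N ((i + 1 : ℕ) * (t / n)) - N (i * (t / n))),
        Lp.coeFn_sub (N ((i + 1 : ℕ) * (t / n))) (N (i * (t / n)))] with ω h4 h5
      rw [h4, Pi.smul_apply, h5, Pi.sub_apply, smul_eq_mul]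
    filter_upwards [h3, Lp.coeFn_finsetSum (Finset.range n) (fun i : ℕ ↦
      Real.exp (-(a * (t - (i + 1 : ℕ) * (t / n))))
        • (N ((i + 1 : ℕ) * (t / n)) - N (i * (t / n))))] with ω h4 h5
    rw [h5, Finset.sum_apply]
    exact Finset.sum_congr rfl fun i _ ↦ h4 i
  have hN0 : ∀ᵐ ω ∂P, N 0 ω = 0 := by
    rw [hN]
    filter_upwards [Lp.coeFn_zero ℝ 2 P] with ω h using h
  filter_upwards [hX, h1, h2, hlim, hN0, heq 0 le_rfl] with ω hXω h1 h2 hlim h0 h00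
  have hx0 : X 0 ω = x₀ ω := by simpa [h0] using h00
  rw [← hx0]
  have hr := (tendsto_riemann_error ha ht hXω).comp hns.tendsto_atTop
  have hs := hr.add hlim
  rw [zero_add] at hs
  have hc : Tendsto (fun _ : ℕ ↦ X t ω - Real.exp (-(a * t)) * X 0 ω) atTop (𝓝 (Y ω)) := by
    refine hs.congr' ?_
    filter_upwards [eventually_gt_atTop 0] with j hj
    have hpos : 0 < ns j := lt_of_lt_of_le hj (hns.id_le j)
    rw [summation_by_parts (X := fun s ↦ X s ω) (N := fun s ↦ N s ω) hXω ht hpos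
      fun i _ ↦ h1 (ns j) i]
    simp only [Function.comp_def, h2]
  linarith [tendsto_nhds_unique hc tendsto_const_nhds]

end

/-! ### The Ornstein-Uhlenbeck modes of the stochastic convolution -/

/-- The integrand `1_{(0, t]}(s) e^{-a(t-s)} φ(y)`. -/
noncomputable def ouFun (a t : ℝ) (φ : C(UnitAddCircle, ℝ)) (z : ℝ × UnitAddCircle) : ℝ :=
  (Set.Ioc 0 t).indicator (fun s ↦ Real.exp (-(a * (t - s)))) z.1 * φ z.2

theorem memLp_ouKer (a t : ℝ) : MemLp ((Set.Ioc 0 t).indicator fun s ↦ Real.exp (-(a * (t - s)))) 2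
    ((volume : Measure ℝ).restrict (Set.Ici 0)) := by
  rw [memLp_indicator_iff_restrict measurableSet_Ioc]
  have hc : Continuous fun s ↦ Real.exp (-(a * (t - s))) := by fun_prop
  obtain ⟨C, hC⟩ := isCompact_Icc.exists_bound_of_continuousOn (hc.continuousOn (s := Set.Icc 0 t))
  have : IsFiniteMeasure (((volume : Measure ℝ).restrict (Set.Ici 0)).restrict (Set.Ioc 0 t)) := by
    refine ⟨?_⟩
    rw [Measure.restrict_apply_univ]
    exact (Measure.restrict_apply_le _ _).trans_lt measure_Ioc_lt_top
  refine MemLp.of_bound hc.aestronglyMeasurable C ?_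
  filter_upwards [ae_restrict_mem measurableSet_Ioc] with s hs using hC s ⟨hs.1.le, hs.2⟩

theorem memLp_ouFun (a t : ℝ) (φ : C(UnitAddCircle, ℝ)) : MemLp (ouFun a t φ) 2 stMeasure := by
  have ha := memLp_ouKer a t
  have hb : MemLp φ 2 (volume : Measure UnitAddCircle) :=
    φ.continuous.memLp_of_hasCompactSupport (HasCompactSupport.of_compactSpace φ)
  refine (memLp_two_iff_integrable_sq (ha.1.comp_fst.mul hb.1.comp_snd)).2 ?_
  exact (ha.integrable_sq.mul_prod hb.integrable_sq).congr
    (ae_of_all _ fun z ↦ (mul_pow _ _ 2).symm)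

/-- The class of `1_{(0, t]}(s) e^{-a(t-s)} φ(y)` in `L²([0, ∞) × 𝕋)`. -/
noncomputable def ouLp (a t : ℝ) (φ : C(UnitAddCircle, ℝ)) : Lp ℝ 2 stMeasure :=
  (memLp_ouFun a t φ).toLp _

theorem ouLp_smul (a t r : ℝ) (φ : C(UnitAddCircle, ℝ)) :
    ouLp a t (r • φ) = r • ouLp a t φ := by
  rw [ouLp, ouLp, ← MemLp.toLp_const_smul]
  congr 1
  funext z
  simp only [ouFun, ContinuousMap.smul_apply, smul_eq_mul, Pi.smul_apply]
  ring

theorem ouLp_zero (a : ℝ) (φ : C(UnitAddCircle, ℝ)) : ouLp a 0 φ = 0 := by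
  have h : ouFun a 0 φ = 0 := funext fun z ↦ by simp [ouFun]
  simp only [ouLp, h]
  exact MemLp.toLp_zero _

theorem integral_ouKer_mul {a t s : ℝ} (ha : 0 < a) (ht : 0 ≤ t) (hs : 0 ≤ s) :
    ∫ r in Set.Ici (0 : ℝ), (Set.Ioc 0 t).indicator (fun r ↦ Real.exp (-(a * (t - r)))) r
      * (Set.Ioc 0 s).indicator (fun r ↦ Real.exp (-(a * (s - r)))) r = ouCov a t s := by
  have h1 (r : ℝ) : (Set.Ioc 0 t).indicator (fun r ↦ Real.exp (-(a * (t - r)))) r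
      * (Set.Ioc 0 s).indicator (fun r ↦ Real.exp (-(a * (s - r)))) r
      = (Set.Ioc 0 (min t s)).indicator (fun r ↦ Real.exp (-(a * (t + s)) + 2 * a * r)) r := by
    rw [← Set.inter_indicator_mul, Set.Ioc_inter_Ioc, max_self]
    congr 1
    funext r
    rw [← Real.exp_add]
    ring_nf
  simp only [h1]
  rw [setIntegral_indicator measurableSet_Ioc, Set.inter_eq_right.2 fun r hr ↦ hr.1.le,
    ← intervalIntegral.integral_of_le (le_min ht hs)]
  have hd (r : ℝ) : HasDerivAt (fun r ↦ Real.exp (-(a * (t + s)) + 2 * a * r) / (2 * a))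
      (Real.exp (-(a * (t + s)) + 2 * a * r)) r := by
    have h2 : HasDerivAt (fun r ↦ -(a * (t + s)) + 2 * a * r) (2 * a) r := by
      simpa using ((hasDerivAt_id r).const_mul (2 * a)).const_add (-(a * (t + s)))
    refine (h2.exp.div_const (2 * a)).congr_deriv ?_
    field_simp
  have hi : IntervalIntegrable (fun r ↦ Real.exp (-(a * (t + s)) + 2 * a * r)) volume 0 (min t s) :=
    Continuous.intervalIntegrable (by fun_prop) _ _
  rw [intervalIntegral.integral_eq_sub_of_hasDerivAt (fun r _ ↦ hd r) hi, ouCov, ← sub_div]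
  congr 2
  · congr 1
    rcases le_total t s with h | h
    · rw [min_eq_left h, abs_of_nonpos (by linarith)]
      ring
    · rw [min_eq_right h, abs_of_nonneg (by linarith)]
      ring
  · simp

theorem inner_ouLp {a t s : ℝ} (ha : 0 < a) (ht : 0 ≤ t) (hs : 0 ≤ s) (φ ψ : C(UnitAddCircle, ℝ)) :
    inner ℝ (ouLp a t φ) (ouLp a s ψ) = ouCov a t s * ∫ x, φ x * ψ x := by
  rw [ouLp, ouLp, inner_toLp_two, ← integral_ouKer_mul ha ht hs, stMeasure, ← integral_prod_mul]
  refine integral_congr_ae (ae_of_all _ fun z ↦ ?_)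
  simp only [ouFun]
  ring

theorem inner_ouLp_of_integral_eq_zero {a b t s : ℝ} {φ ψ : C(UnitAddCircle, ℝ)}
    (h : ∫ x, φ x * ψ x = 0) : inner ℝ (ouLp a t φ) (ouLp b s ψ) = 0 := by
  rw [ouLp, ouLp, inner_toLp_two]
  have h2 : (fun z ↦ ouFun a t φ z * ouFun b s ψ z) = fun z : ℝ × UnitAddCircle ↦
      ((Set.Ioc 0 t).indicator (fun r ↦ Real.exp (-(a * (t - r)))) z.1
      * (Set.Ioc 0 s).indicator (fun r ↦ Real.exp (-(b * (s - r)))) z.1) * (φ z.2 * ψ z.2) := by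
    funext z
    simp only [ouFun]
    ring
  rw [h2, stMeasure, integral_prod_mul (fun r : ℝ ↦
    (Set.Ioc 0 t).indicator (fun r ↦ Real.exp (-(a * (t - r)))) r
      * (Set.Ioc 0 s).indicator (fun r ↦ Real.exp (-(b * (s - r)))) r)
    (fun x : UnitAddCircle ↦ φ x * ψ x), h, mul_zero]

theorem slab_toLp (t : ℝ) {φ : UnitAddCircle → ℝ} (hφ : φ ∈ Ck ⊤) :
    (slab t φ hφ).2.toLp _ = ouLp 0 t ⟨φ, continuous_of_mem_Ck hφ⟩ := by
  rw [ouLp, MemLp.toLp_eq_toLp_iff]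
  exact ae_of_all _ fun z ↦ by simp [slab, ouFun]

/-- The step function `∑ᵢ e^{-a(t - tᵢ₊₁)} 1_{(tᵢ, tᵢ₊₁]}`, with `tᵢ = it/n`, differs from
`1_{(0, t]}(s) e^{-a(t - s)}` by at most `at/n` on `(0, t]`. -/
theorem abs_step_sub_le {a t : ℝ} (ha : 0 < a) (ht : 0 ≤ t) {n : ℕ} (hn : 0 < n) (s : ℝ) :
    |∑ i ∈ Finset.range n, Real.exp (-(a * (t - (i + 1 : ℕ) * (t / n))))
        * ((Set.Ioc 0 ((i + 1 : ℕ) * (t / n))).indicator (fun _ ↦ (1 : ℝ)) s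
          - (Set.Ioc 0 (i * (t / n))).indicator (fun _ ↦ (1 : ℝ)) s)
      - (Set.Ioc 0 t).indicator (fun s ↦ Real.exp (-(a * (t - s)))) s|
      ≤ a * (t / n) * (Set.Ioc 0 t).indicator (fun _ ↦ (1 : ℝ)) s := by
  set d := t / n with hd
  have hnpos : (0 : ℝ) < n := by exact_mod_cast hn
  have hnd : n * d = t := by rw [hd]; field_simp
  have hd0 : 0 ≤ d := by positivity
  have htel : ∑ i ∈ Finset.range n, ((Set.Ioc 0 ((i + 1 : ℕ) * d)).indicator (fun _ ↦ (1 : ℝ)) s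
      - (Set.Ioc 0 (i * d)).indicator (fun _ ↦ (1 : ℝ)) s)
      = (Set.Ioc 0 t).indicator (fun _ ↦ (1 : ℝ)) s := by
    rw [Finset.sum_range_sub fun i : ℕ ↦ (Set.Ioc 0 (i * d)).indicator (fun _ ↦ (1 : ℝ)) s, hnd]
    simp
  have hE : (Set.Ioc 0 t).indicator (fun s ↦ Real.exp (-(a * (t - s)))) s
      = Real.exp (-(a * (t - s))) * (Set.Ioc 0 t).indicator (fun _ ↦ (1 : ℝ)) s := by
    by_cases h : s ∈ Set.Ioc 0 t <;> simp [h]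
  rw [hE, ← htel, Finset.mul_sum, Finset.mul_sum, ← Finset.sum_sub_distrib]
  refine (Finset.abs_sum_le_sum_abs _ _).trans (Finset.sum_le_sum fun i hi ↦ ?_)
  rw [← sub_mul, abs_mul]
  have hi' : ((i + 1 : ℕ) : ℝ) ≤ n := by exact_mod_cast Finset.mem_range.1 hi
  have hit : ((i + 1 : ℕ) : ℝ) * d ≤ t := by
    rw [← hnd]; exact mul_le_mul_of_nonneg_right hi' hd0
  have hle : (i : ℝ) * d ≤ (i + 1 : ℕ) * d := by push_cast; linarith
  have hlen : ((i + 1 : ℕ) : ℝ) * d = i * d + d := by push_cast; ring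
  by_cases h1 : s ∈ Set.Ioc (i * d) ((i + 1 : ℕ) * d)
  · have hi0 : 0 ≤ (i : ℝ) * d := by positivity
    have h2 : s ∈ Set.Ioc 0 ((i + 1 : ℕ) * d) := ⟨hi0.trans_lt h1.1, h1.2⟩
    have h3 : s ∉ Set.Ioc 0 (i * d) := fun h ↦ h1.1.not_ge h.2
    rw [Set.indicator_of_mem h2, Set.indicator_of_notMem h3, sub_zero, abs_one, mul_one, mul_one]
    refine (abs_exp_neg_sub_exp_neg_le (mul_nonneg ha.le (by linarith))
      (mul_nonneg ha.le (by linarith [h1.2]))).trans ?_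
    rw [← mul_sub, abs_mul, abs_of_pos ha]
    refine mul_le_mul_of_nonneg_left ?_ ha.le
    rw [abs_le]
    constructor <;> linarith [h1.1, h1.2]
  · have h2 : (Set.Ioc 0 ((i + 1 : ℕ) * d)).indicator (fun _ ↦ (1 : ℝ)) s
        = (Set.Ioc 0 (i * d)).indicator (fun _ ↦ (1 : ℝ)) s := by
      refine Set.indicator_eq_indicator ?_ rfl
      constructor
      · intro h
        exact ⟨h.1, not_lt.1 fun h' ↦ h1 ⟨h', h.2⟩⟩
      · exact fun h ↦ ⟨h.1, h.2.trans hle⟩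
    rw [h2, sub_self, abs_zero, mul_zero, mul_zero]

/-- The Riemann sums of the stochastic convolution converge in `L²([0, ∞) × 𝕋)`. -/
theorem tendsto_step_ouLp {a t : ℝ} (ha : 0 < a) (ht : 0 ≤ t) (φ : C(UnitAddCircle, ℝ)) :
    Tendsto (fun n : ℕ ↦ ∑ i ∈ Finset.range n, Real.exp (-(a * (t - (i + 1 : ℕ) * (t / n))))
        • (ouLp 0 ((i + 1 : ℕ) * (t / n)) φ - ouLp 0 (i * (t / n)) φ)) atTop
      (𝓝 (ouLp a t φ)) := by
  rw [tendsto_iff_norm_sub_tendsto_zero]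
  have hlim : Tendsto (fun n : ℕ ↦ a * (t / (n : ℝ)) * ‖ouLp 0 t φ‖) atTop (𝓝 0) := by
    simpa using ((tendsto_const_div_atTop_nhds_zero_nat t).const_mul a).mul_const ‖ouLp 0 t φ‖
  refine squeeze_zero' (Eventually.of_forall fun n ↦ norm_nonneg _) ?_ hlim
  filter_upwards [eventually_gt_atTop 0] with n hn
  refine Lp.norm_le_mul_norm_of_ae_le_mul ?_
  set E : ℕ → ℝ := fun i ↦ Real.exp (-(a * (t - (i + 1 : ℕ) * (t / n))))
  have hcoe (b r : ℝ) : ouLp b r φ =ᵐ[stMeasure] ouFun b r φ := (memLp_ouFun b r φ).coeFn_toLp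
  have h0 : ∀ᵐ z ∂stMeasure, ∀ i : ℕ, ouLp 0 (i * (t / n)) φ z = ouFun 0 (i * (t / n)) φ z :=
    ae_all_iff.2 fun i ↦ hcoe 0 _
  have h1 : ∀ᵐ z ∂stMeasure, ∀ i : ℕ,
      (E i • (ouLp 0 ((i + 1 : ℕ) * (t / n)) φ - ouLp 0 (i * (t / n)) φ) : Lp ℝ 2 stMeasure) z
      = E i * (ouFun 0 ((i + 1 : ℕ) * (t / n)) φ z - ouFun 0 (i * (t / n)) φ z) := by
    refine ae_all_iff.2 fun i ↦ ?_
    filter_upwards [h0, Lp.coeFn_smul (E i) (ouLp 0 ((i + 1 : ℕ) * (t / n)) φ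
      - ouLp 0 (i * (t / n)) φ), Lp.coeFn_sub (ouLp 0 ((i + 1 : ℕ) * (t / n)) φ)
      (ouLp 0 (i * (t / n)) φ)] with z h2 h3 h4
    rw [h3, Pi.smul_apply, h4, Pi.sub_apply, h2, h2, smul_eq_mul]
  filter_upwards [h1, hcoe a t, hcoe 0 t, Lp.coeFn_finsetSum (Finset.range n) (fun i : ℕ ↦
    (E i • (ouLp 0 ((i + 1 : ℕ) * (t / n)) φ - ouLp 0 (i * (t / n)) φ) : Lp ℝ 2 stMeasure)),
    Lp.coeFn_sub (∑ i ∈ Finset.range n, E i • (ouLp 0 ((i + 1 : ℕ) * (t / n)) φ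
      - ouLp 0 (i * (t / n)) φ)) (ouLp a t φ)] with z h1 h2 h3 h4 h5
  rw [h5, Pi.sub_apply, h4, Finset.sum_apply, h2, h3, Finset.sum_congr rfl fun i _ ↦ h1 i]
  have hs := abs_step_sub_le ha ht hn z.1
  have h6 : ∑ i ∈ Finset.range n, E i * (ouFun 0 ((i + 1 : ℕ) * (t / n)) φ z
      - ouFun 0 (i * (t / n)) φ z) - ouFun a t φ z
      = (∑ i ∈ Finset.range n, E i
        * ((Set.Ioc 0 ((i + 1 : ℕ) * (t / n))).indicator (fun _ ↦ (1 : ℝ)) z.1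
          - (Set.Ioc 0 (i * (t / n))).indicator (fun _ ↦ (1 : ℝ)) z.1)
      - (Set.Ioc 0 t).indicator (fun s ↦ Real.exp (-(a * (t - s)))) z.1) * φ z.2 := by
    simp only [ouFun, zero_mul, neg_zero, Real.exp_zero]
    rw [sub_mul, Finset.sum_mul]
    congr 1
    exact Finset.sum_congr rfl fun i _ ↦ by ring
  rw [h6, norm_mul, Real.norm_eq_abs, Real.norm_eq_abs]
  have h7 : ‖ouFun 0 t φ z‖ = (Set.Ioc 0 t).indicator (fun _ ↦ (1 : ℝ)) z.1 * |φ z.2| := by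
    rw [ouFun, norm_mul, Real.norm_eq_abs, Real.norm_eq_abs]
    simp only [zero_mul, neg_zero, Real.exp_zero]
    rw [abs_of_nonneg (Set.indicator_nonneg (fun _ _ ↦ zero_le_one) _)]
  rw [h7, ← mul_assoc]
  exact mul_le_mul_of_nonneg_right hs (abs_nonneg _)

/-- The `k`-th mode `1_{(0, t]}(s) e^{-λ_k(t-s)} cas_k(y)` of the heat kernel, `λ_k = eig lam k`. -/
noncomputable def mode (lam t : ℝ) (k : ℤ) : Lp ℝ 2 stMeasure := ouLp (eig lam k) t (cas k)

theorem inner_mode {lam t s : ℝ} (h : 0 < lam) (ht : 0 ≤ t) (hs : 0 ≤ s) (k l : ℤ) :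
    inner ℝ (mode lam t k) (mode lam s l) = if k = l then ouCov (eig lam k) t s else 0 := by
  split_ifs with hkl
  · subst hkl
    rw [mode, mode, inner_ouLp (eig_pos h k) ht hs, integral_cas_mul_cas, if_pos rfl, mul_one]
  · exact inner_ouLp_of_integral_eq_zero (by rw [integral_cas_mul_cas, if_neg hkl])

theorem norm_mode_sq_le {lam t : ℝ} (h : 0 < lam) (ht : 0 ≤ t) (k : ℤ) :
    ‖mode lam t k‖ ^ 2 ≤ 1 / (2 * eig lam k) := by
  rw [← real_inner_self_eq_norm_sq, inner_mode h ht ht, if_pos rfl, ouCov]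
  refine div_le_div_of_nonneg_right ?_ (by linarith [eig_pos h k])
  simp [Real.exp_nonneg]

/-! ### The modes of a solution -/

section

theorem tderiv_smul (r : ℝ) (f : UnitAddCircle → ℝ) : tderiv (r • f) = r • tderiv f := by
  funext x
  exact deriv_const_mul_field r

theorem laplaceSub_casTest (lam : ℝ) (k : ℤ) :
    laplaceSub lam (casTest k) = -(eig lam k) • casTest k := by
  refine Subtype.ext ?_
  change tderiv (tderiv (cas k)) - lam • ⇑(cas k) = -(eig lam k) • ⇑(cas k)
  rw [tderiv_cas, tderiv_smul, tderiv_cas, neg_neg, eig]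
  funext x
  simp only [Pi.sub_apply, Pi.smul_apply, smul_eq_mul, Int.cast_neg]
  ring

variable {Ω : Type*} [MeasurableSpace Ω] {P : Measure Ω} {W₁ W : Integrand → Ω → ℝ}
  {c c₁ c₂ K : ℝ} {u₀ : Ω → Lp ℝ 2 (volume : Measure UnitAddCircle)} {Ψ : ℝ → Ω → Distrib}

/-- The contribution of the initial value and of `W₁` to the `k`-th mode of a solution. The
derivative of `cas_k` is `2πk cas_{-k}`, so the mode `-k` of `W₁` appears. -/
noncomputable def zeta (hW₁ : IsWhiteNoise P W₁) (lam b t : ℝ)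
    (u₀ : Ω → Lp ℝ 2 (volume : Measure UnitAddCircle)) (ω : Ω) (k : ℤ) : ℝ :=
  Real.exp (-(eig lam k * t)) * inner ℝ (u₀ ω) (casLp k)
    + b * (2 * Real.pi * k) * hW₁.isometry (mode lam t (-k)) ω

/-- Each mode of a solution is an Ornstein-Uhlenbeck process: `cas_k` is an eigenfunction of
`Δ - cK`, so that `variation_of_constants` applies to `⟨Ψ(t), cas_k⟩`. -/
theorem IsSolution.toLin_casTest (h : IsSolution P W₁ W c c₁ c₂ K u₀ Ψ)
    (hW₁ : IsWhiteNoise P W₁) (hW : IsWhiteNoise P W) (hcK : 0 < c * K) {t : ℝ} (ht : 0 ≤ t)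
    (k : ℤ) : ∀ᵐ ω ∂P, (Ψ t ω).toLin (casTest k)
      = zeta hW₁ (c * K) (-(c₁ * K ^ (-(1 / 4) : ℝ))) t u₀ ω k
        + c₂ * K ^ (1 / 4 : ℝ) * hW.isometry (mode (c * K) t k) ω := by
  set b : ℝ := -(c₁ * K ^ (-(1 / 4) : ℝ)) with hb
  set d : ℝ := c₂ * K ^ (1 / 4 : ℝ) with hd
  set a := eig (c * K) k with ha
  have hapos : 0 < a := eig_pos hcK k
  let N : ℝ → Lp ℝ 2 P := fun s ↦ (b * (2 * Real.pi * k)) • hW₁.isometry (ouLp 0 s (cas (-k)))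
    + d • hW.isometry (ouLp 0 s (cas k))
  let Y : Lp ℝ 2 P := (b * (2 * Real.pi * k)) • hW₁.isometry (ouLp a t (cas (-k)))
    + d • hW.isometry (ouLp a t (cas k))
  have hN0 : N 0 = 0 := by simp [N, ouLp_zero]
  have hY : Tendsto (fun n : ℕ ↦ ∑ i ∈ Finset.range n, Real.exp (-(a * (t - (i + 1 : ℕ) * (t / n))))
        • (N ((i + 1 : ℕ) * (t / n)) - N (i * (t / n)))) atTop (𝓝 Y) := by
    have h1 := ((hW₁.isometry.continuous.tendsto _).comp
      (tendsto_step_ouLp hapos ht (cas (-k)))).const_smul (b * (2 * Real.pi * k))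
    have h2 := ((hW.isometry.continuous.tendsto _).comp
      (tendsto_step_ouLp hapos ht (cas k))).const_smul d
    refine (h1.add h2).congr fun n ↦ ?_
    simp only [Function.comp_apply, map_sum, map_smul, map_sub, Finset.smul_sum]
    rw [← Finset.sum_add_distrib]
    refine Finset.sum_congr rfl fun i _ ↦ ?_
    simp only [N]
    module
  have hcoe (x y : ℝ) (f g : Lp ℝ 2 P) :
      ∀ᵐ ω ∂P, (x • f + y • g : Lp ℝ 2 P) ω = x * f ω + y * g ω := by
    filter_upwards [Lp.coeFn_add (x • f) (y • g), Lp.coeFn_smul x f, Lp.coeFn_smul y g]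
      with ω h1 h2 h3
    rw [h1, Pi.add_apply, h2, h3]
    rfl
  have heq (s : ℝ) (hs : 0 ≤ s) : ∀ᵐ ω ∂P, (Ψ s ω).toLin (casTest k)
      = inner ℝ (u₀ ω) (casLp k) - a * (∫ r in (0 : ℝ)..s, (Ψ r ω).toLin (casTest k)) + N s ω := by
    have e1 := hW₁.ae_eq_isometry (slab s (tderiv (casTest k).1) (tderiv_mem (casTest k).2))
    have e2 := hW.ae_eq_isometry (slab s (casTest k).1 (casTest k).2)
    rw [slab_toLp] at e1 e2
    have e3 : (⟨tderiv (casTest k).1, continuous_of_mem_Ck (tderiv_mem (casTest k).2)⟩ :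
        C(UnitAddCircle, ℝ)) = (2 * Real.pi * k) • cas (-k) := by
      ext x
      exact congrFun (tderiv_cas k) x
    have e4 : (⟨(casTest k).1, continuous_of_mem_Ck (casTest k).2⟩ : C(UnitAddCircle, ℝ)) = cas k :=
      rfl
    rw [e3, ouLp_smul, map_smul] at e1
    rw [e4] at e2
    filter_upwards [h.weak_eq (casTest k) s hs, e1, e2, hcoe (b * (2 * Real.pi * k)) d
      (hW₁.isometry (ouLp 0 s (cas (-k)))) (hW.isometry (ouLp 0 s (cas k))),
      Lp.coeFn_smul (2 * Real.pi * k) (hW₁.isometry (ouLp 0 s (cas (-k))))] with ω h0 h1 h2 h3 h4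
    rw [h0, h1, h2, h3, h4, casLp, inner_toLp_right, laplaceSub_casTest]
    simp only [map_smul, smul_eq_mul, intervalIntegral.integral_const_mul, Pi.smul_apply]
    have e5 : (casTest k).1 = cas k := rfl
    rw [e5, hb]
    ring
  filter_upwards [variation_of_constants hapos ht N Y (h.continuousOn (casTest k)) heq hN0 hY,
    hcoe (b * (2 * Real.pi * k)) d (hW₁.isometry (ouLp a t (cas (-k))))
      (hW.isometry (ouLp a t (cas k)))] with ω h1 h2
  rw [h1, h2, zeta, mode, mode, eig_neg, ha, add_assoc]

/-! ### The part of order at most one -/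

/-- An almost sure limit of a sequence that converges in `L²` is its limit in `L²`. -/
theorem ae_eq_of_tendsto_Lp {F : ℕ → Lp ℝ 2 P} {Y : Lp ℝ 2 P} {g : Ω → ℝ}
    (hF : Tendsto F atTop (𝓝 Y)) (hg : ∀ᵐ ω ∂P, Tendsto (fun n ↦ F n ω) atTop (𝓝 (g ω))) :
    g =ᵐ[P] Y := by
  obtain ⟨ns, hns, hlim⟩ := (tendstoInMeasure_of_tendsto_Lp hF).exists_seq_tendsto_ae
  filter_upwards [hg, hlim] with ω h1 h2
  exact tendsto_nhds_unique (h1.comp hns.tendsto_atTop) h2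

theorem ae_eq_of_hasSum_Lp {f : ℤ → Lp ℝ 2 P} {Y : Lp ℝ 2 P} {g : Ω → ℝ}
    (hf : HasSum f Y) (hg : ∀ᵐ ω ∂P, HasSum (fun k ↦ f k ω) (g ω)) : g =ᵐ[P] Y := by
  obtain ⟨S, hS⟩ := exists_seq_tendsto (atTop : Filter (Finset ℤ))
  simp only [HasSum, SummationFilter.unconditional_filter] at hf hg
  have hf' : Tendsto (fun n ↦ ∑ k ∈ S n, f k) atTop (𝓝 Y) := hf.comp hS
  refine ae_eq_of_tendsto_Lp hf' ?_
  have h1 : ∀ᵐ ω ∂P, ∀ n, (∑ k ∈ S n, f k : Lp ℝ 2 P) ω = ∑ k ∈ S n, f k ω :=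
    ae_all_iff.2 fun n ↦ by
      filter_upwards [Lp.coeFn_finsetSum (S n) f] with ω h
      rw [h, Finset.sum_apply]
  filter_upwards [hg, h1] with ω h2 h3
  simp only [h3]
  exact h2.comp hS

theorem casCoeff_add {f g : UnitAddCircle → ℝ} (hf : Continuous f) (hg : Continuous g) (k : ℤ) :
    casCoeff (f + g) k = casCoeff f k + casCoeff g k := by
  have h1 : Integrable fun x ↦ f x * cas k x := integrable_of_continuous (hf.mul (cas k).continuous)
  have h2 : Integrable fun x ↦ g x * cas k x := integrable_of_continuous (hg.mul (cas k).continuous)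
  rw [casCoeff, casCoeff, casCoeff, ← integral_add h1 h2]
  exact integral_congr_ae (ae_of_all _ fun x ↦ add_mul _ _ _)

theorem casCoeff_smul (r : ℝ) (f : UnitAddCircle → ℝ) (k : ℤ) :
    casCoeff (r • f) k = r * casCoeff f k := by
  rw [casCoeff, casCoeff, ← integral_const_mul]
  exact integral_congr_ae (ae_of_all _ fun x ↦ mul_assoc _ _ _)

/-- Coefficients in `H^{-1}` pair with functions of class `C¹`, by the Cauchy-Schwarz inequality. -/
theorem summable_casCoeff_mul {z : ℤ → ℝ}
    (hz : Summable fun k : ℤ ↦ (1 + (2 * Real.pi * k) ^ 2)⁻¹ * z k ^ 2) {f : UnitAddCircle → ℝ}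
    (hf : f ∈ Ck 1) {M : ℝ} (hM : ∀ x, |f x| ≤ M) (hM' : ∀ x, |tderiv f x| ≤ M) :
    Summable (fun k ↦ casCoeff f k * z k) ∧ |∑' k, casCoeff f k * z k|
      ≤ (√2 * √(∑' k : ℤ, (1 + (2 * Real.pi * k) ^ 2)⁻¹ * z k ^ 2)) * M := by
  obtain ⟨hs, hb⟩ := summable_weight_mul_sq hf hM hM'
  set w : ℤ → ℝ := fun k ↦ 1 + (2 * Real.pi * k) ^ 2 with hw
  have hw0 (k : ℤ) : 0 < w k := by positivity
  have hM0 : 0 ≤ M := (abs_nonneg _).trans (hM 0)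
  have h1 (k : ℤ) : (√(w k) * |casCoeff f k|) ^ (2 : ℝ) = w k * casCoeff f k ^ 2 := by
    rw [Real.rpow_two, mul_pow, Real.sq_sqrt (hw0 k).le, sq_abs]
  have h2 (k : ℤ) : ((√(w k))⁻¹ * |z k|) ^ (2 : ℝ) = (w k)⁻¹ * z k ^ 2 := by
    rw [Real.rpow_two, mul_pow, inv_pow, Real.sq_sqrt (hw0 k).le, sq_abs]
  have h3 (k : ℤ) : (√(w k) * |casCoeff f k|) * ((√(w k))⁻¹ * |z k|) = |casCoeff f k * z k| := by
    have : √(w k) ≠ 0 := (Real.sqrt_pos.2 (hw0 k)).ne'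
    rw [abs_mul]
    field_simp
  obtain ⟨hS, hB⟩ := Real.summable_and_inner_le_Lp_mul_Lq_tsum_of_nonneg (p := 2) (q := 2)
    (f := fun k ↦ √(w k) * |casCoeff f k|) (g := fun k ↦ (√(w k))⁻¹ * |z k|)
    (by constructor <;> norm_num) (fun k ↦ by positivity) (fun k ↦ by positivity)
    (by simpa only [h1] using hs) (by simpa only [h2] using hz)
  simp only [h1, h2, h3] at hS hB
  refine ⟨hS.of_abs, ?_⟩
  have h4 : |∑' k, casCoeff f k * z k| ≤ ∑' k, |casCoeff f k * z k| := by
    rw [← Real.norm_eq_abs]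
    exact norm_tsum_le_tsum_norm hS
  refine h4.trans (hB.trans ?_)
  rw [← Real.sqrt_eq_rpow, ← Real.sqrt_eq_rpow]
  have h5 : √(∑' k, w k * casCoeff f k ^ 2) ≤ √2 * M := by
    rw [← Real.sqrt_sq hM0, ← Real.sqrt_mul zero_le_two]
    exact Real.sqrt_le_sqrt hb
  calc _ ≤ (√2 * M) * √(∑' k, (w k)⁻¹ * z k ^ 2) :=
        mul_le_mul_of_nonneg_right h5 (Real.sqrt_nonneg _)
    _ = _ := by ring

theorem summable_casCoeff_mul' {z : ℤ → ℝ}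
    (hz : Summable fun k : ℤ ↦ (1 + (2 * Real.pi * k) ^ 2)⁻¹ * z k ^ 2) {f : UnitAddCircle → ℝ}
    (hf : f ∈ Ck 1) : Summable fun k ↦ casCoeff f k * z k := by
  obtain ⟨M, hM, hM'⟩ := exists_C1_bound hf
  exact (summable_casCoeff_mul hz hf hM hM').1

open Classical in
/-- The distribution of order at most one with given Hartley coefficients in `H^{-1}` (and zero if
the coefficients are not in `H^{-1}`). -/
noncomputable def dualOfCoeff (z : ℤ → ℝ) : DualCk 1 :=
  if hz : Summable fun k : ℤ ↦ (1 + (2 * Real.pi * k) ^ 2)⁻¹ * z k ^ 2 then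
    { toLin :=
        { toFun := fun φ ↦ ∑' k, casCoeff φ.1 k * z k
          map_add' := fun φ ψ ↦ by
            rw [← (summable_casCoeff_mul' hz φ.2).tsum_add (summable_casCoeff_mul' hz ψ.2)]
            refine tsum_congr fun k ↦ ?_
            rw [Submodule.coe_add, casCoeff_add (continuous_of_mem_Ck φ.2)
              (continuous_of_mem_Ck ψ.2), add_mul]
          map_smul' := fun r φ ↦ by
            rw [RingHom.id_apply, smul_eq_mul, ← tsum_mul_left]
            refine tsum_congr fun k ↦ ?_
            rw [Submodule.coe_smul, casCoeff_smul, mul_assoc] }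
      bounded := ⟨1, le_rfl, _, fun φ _ h ↦
        (summable_casCoeff_mul hz φ.2 (h 0 zero_le_one) (h 1 le_rfl)).2⟩ }
  else
    { toLin := 0
      bounded := ⟨0, zero_le, 0, fun φ M _ ↦ by simp⟩ }

theorem hasSum_dualOfCoeff {z : ℤ → ℝ}
    (hz : Summable fun k : ℤ ↦ (1 + (2 * Real.pi * k) ^ 2)⁻¹ * z k ^ 2) (φ : Ck 1) :
    HasSum (fun k ↦ casCoeff φ.1 k * z k) ((dualOfCoeff z).toLin φ) := by
  rw [dualOfCoeff, dif_pos hz]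
  exact (summable_casCoeff_mul' hz φ.2).hasSum

end

section

variable {Ω : Type*} [MeasurableSpace Ω] {P : Measure Ω} {W₁ : Integrand → Ω → ℝ}
  {lam b t : ℝ} {u₀ : Ω → Lp ℝ 2 (volume : Measure UnitAddCircle)}

/-- The space derivative of the modes is bounded uniformly in the frequency. -/
theorem sq_mul_norm_mode_sq_le (hlam : 0 < lam) (ht : 0 ≤ t) (k : ℤ) :
    (2 * Real.pi * k) ^ 2 * ‖mode lam t k‖ ^ 2 ≤ 1 := by
  have h1 := norm_mode_sq_le hlam ht k
  have he := eig_pos hlam k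
  calc (2 * Real.pi * k) ^ 2 * ‖mode lam t k‖ ^ 2
      ≤ (2 * Real.pi * k) ^ 2 * (1 / (2 * eig lam k)) := mul_le_mul_of_nonneg_left h1 (sq_nonneg _)
    _ ≤ 1 := by
        rw [mul_one_div, div_le_one (by linarith), eig]
        nlinarith [sq_nonneg (2 * Real.pi * k)]

theorem abs_mul_norm_mode_le (hlam : 0 < lam) (ht : 0 ≤ t) (k : ℤ) :
    |2 * Real.pi * k| * ‖mode lam t (-k)‖ ≤ 1 := by
  have h := sq_mul_norm_mode_sq_le hlam ht (-k)
  rw [← abs_of_nonneg (norm_nonneg (mode lam t (-k))), ← abs_mul, ← sq_le_one_iff_abs_le_one,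
    mul_pow]
  simpa using h

theorem lintegral_sq_Lp (f : Lp ℝ 2 P) :
    ∫⁻ ω, ENNReal.ofReal (f ω ^ 2) ∂P = ENNReal.ofReal (‖f‖ ^ 2) := by
  rw [← ofReal_integral_eq_lintegral_ofReal (Lp.memLp f).integrable_sq
    (ae_of_all _ fun ω ↦ sq_nonneg _), ← real_inner_self_eq_norm_sq, L2.inner_def]
  congr 1
  exact integral_congr_ae (ae_of_all _ fun ω ↦ by simp [sq])

/-- Almost surely, the contribution of the initial value and of `W₁` lies in `H^{-1}`. -/
theorem ae_summable_zeta (hW₁ : IsWhiteNoise P W₁) (hlam : 0 < lam) (ht : 0 ≤ t) :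
    ∀ᵐ ω ∂P, Summable fun k : ℤ ↦
      (1 + (2 * Real.pi * k) ^ 2)⁻¹ * zeta hW₁ lam b t u₀ ω k ^ 2 := by
  set w : ℤ → ℝ := fun k ↦ (1 + (2 * Real.pi * k) ^ 2)⁻¹ with hw
  have hw0 (k : ℤ) : 0 < w k := by positivity
  set η : ℤ → Ω → ℝ := fun k ω ↦ (2 * Real.pi * k) * hW₁.isometry (mode lam t (-k)) ω with hη
  have hmeas (k : ℤ) : AEMeasurable (fun ω ↦ ENNReal.ofReal (w k * η k ω ^ 2)) P := by
    have : AEMeasurable (hW₁.isometry (mode lam t (-k))) P := (Lp.memLp _).1.aemeasurable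
    fun_prop
  have hint (k : ℤ) : ∫⁻ ω, ENNReal.ofReal (w k * η k ω ^ 2) ∂P ≤ ENNReal.ofReal (w k) := by
    have h1 (ω : Ω) : ENNReal.ofReal (w k * η k ω ^ 2)
        = ENNReal.ofReal (w k * (2 * Real.pi * k) ^ 2)
          * ENNReal.ofReal (hW₁.isometry (mode lam t (-k)) ω ^ 2) := by
      rw [← ENNReal.ofReal_mul (by positivity), hη]
      ring_nf
    simp only [h1]
    rw [lintegral_const_mul' _ _ ENNReal.ofReal_ne_top, lintegral_sq_Lp, hW₁.isometry.norm_map,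
      ← ENNReal.ofReal_mul (by positivity)]
    refine ENNReal.ofReal_le_ofReal ?_
    have h2 := sq_mul_norm_mode_sq_le hlam ht (-k)
    rw [mul_assoc]
    refine mul_le_of_le_one_right (hw0 k).le ?_
    simpa using h2
  have hfin : ∫⁻ ω, ∑' k, ENNReal.ofReal (w k * η k ω ^ 2) ∂P ≠ ∞ := by
    rw [lintegral_tsum hmeas]
    refine ne_top_of_le_ne_top ?_ (ENNReal.tsum_le_tsum hint)
    rw [← ENNReal.ofReal_tsum_of_nonneg (fun k ↦ (hw0 k).le) summable_weight]
    exact ENNReal.ofReal_ne_top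
  filter_upwards [ae_lt_top' (AEMeasurable.tsum hmeas) hfin] with ω hω
  have hs1 : Summable fun k ↦ w k * η k ω ^ 2 := by
    have := ENNReal.summable_toReal hω.ne
    refine this.congr fun k ↦ ENNReal.toReal_ofReal (mul_nonneg (hw0 k).le (sq_nonneg _))
  refine Summable.of_nonneg_of_le (fun k ↦ mul_nonneg (hw0 k).le (sq_nonneg _)) (fun k ↦ ?_)
    ((summable_weight.mul_right (2 * ‖u₀ ω‖ ^ 2)).add (hs1.mul_left (2 * b ^ 2)))
  have h1 : |inner ℝ (u₀ ω) (casLp k)| ≤ ‖u₀ ω‖ := by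
    have := abs_real_inner_le_norm (u₀ ω) (casLp k)
    rwa [orthonormal_casLp.1 k, mul_one] at this
  have h2 : (Real.exp (-(eig lam k * t)) * inner ℝ (u₀ ω) (casLp k)) ^ 2 ≤ ‖u₀ ω‖ ^ 2 := by
    rw [← sq_abs, abs_mul, abs_of_pos (Real.exp_pos _)]
    refine pow_le_pow_left₀ (by positivity) ?_ 2
    refine (mul_le_of_le_one_left (abs_nonneg _) ?_).trans h1
    exact Real.exp_le_one_iff.2 (neg_nonpos.2 (mul_nonneg (eig_pos hlam k).le ht))
  have h3 : zeta hW₁ lam b t u₀ ω k ^ 2 ≤ 2 * ‖u₀ ω‖ ^ 2 + 2 * b ^ 2 * η k ω ^ 2 := by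
    have h4 : zeta hW₁ lam b t u₀ ω k
        = Real.exp (-(eig lam k * t)) * inner ℝ (u₀ ω) (casLp k) + b * η k ω := by
      rw [zeta, hη]
      ring
    rw [h4]
    refine (add_sq_le).trans ?_
    linarith [mul_pow b (η k ω) 2]
  calc w k * zeta hW₁ lam b t u₀ ω k ^ 2
      ≤ w k * (2 * ‖u₀ ω‖ ^ 2 + 2 * b ^ 2 * η k ω ^ 2) := mul_le_mul_of_nonneg_left h3 (hw0 k).le
    _ = w k * (2 * ‖u₀ ω‖ ^ 2) + 2 * b ^ 2 * (w k * η k ω ^ 2) := by ring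

/-- The contribution of the initial value and of `W₁`, paired with a function of class `C¹`. -/
theorem exists_repr_dualOfCoeff_zeta (hW₁ : IsWhiteNoise P W₁) (hlam : 0 < lam) (ht : 0 ≤ t)
    (φ : Ck 1) : ∃ (g : Lp ℝ 2 (volume : Measure UnitAddCircle)) (h : Lp ℝ 2 stMeasure),
      ‖g‖ ≤ Real.exp (-(lam * t)) * ∑' k, |casCoeff φ.1 k| ∧ ‖h‖ ≤ |b| * ∑' k, |casCoeff φ.1 k| ∧
      (fun ω ↦ (dualOfCoeff (zeta hW₁ lam b t u₀ ω)).toLin φ)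
        =ᵐ[P] fun ω ↦ inner ℝ (u₀ ω) g + hW₁.isometry h ω := by
  have hc := summable_abs_casCoeff φ.2
  have hg1 (k : ℤ) : ‖(casCoeff φ.1 k * Real.exp (-(eig lam k * t))) • casLp k‖
      ≤ Real.exp (-(lam * t)) * |casCoeff φ.1 k| := by
    rw [norm_smul, orthonormal_casLp.1 k, mul_one, norm_mul, Real.norm_eq_abs,
      Real.norm_of_nonneg (Real.exp_pos _).le, mul_comm]
    refine mul_le_mul_of_nonneg_right (Real.exp_le_exp.2 (neg_le_neg ?_)) (abs_nonneg _)
    exact mul_le_mul_of_nonneg_right (le_eig lam k) ht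
  have hh1 (k : ℤ) : ‖(casCoeff φ.1 k * (b * (2 * Real.pi * k))) • mode lam t (-k)‖
      ≤ |b| * |casCoeff φ.1 k| := by
    rw [norm_smul, norm_mul, norm_mul, Real.norm_eq_abs, Real.norm_eq_abs, Real.norm_eq_abs]
    calc |casCoeff φ.1 k| * (|b| * |2 * Real.pi * k|) * ‖mode lam t (-k)‖
        = |b| * |casCoeff φ.1 k| * (|2 * Real.pi * k| * ‖mode lam t (-k)‖) := by ring
      _ ≤ |b| * |casCoeff φ.1 k| :=
        mul_le_of_le_one_right (by positivity) (abs_mul_norm_mode_le hlam ht k)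
  have hgs : Summable fun k ↦ (casCoeff φ.1 k * Real.exp (-(eig lam k * t))) • casLp k :=
    Summable.of_norm_bounded (hc.mul_left _) hg1
  have hhs : Summable fun k : ℤ ↦ (casCoeff φ.1 k * (b * (2 * Real.pi * k))) • mode lam t (-k) :=
    Summable.of_norm_bounded (hc.mul_left _) hh1
  refine ⟨∑' k, (casCoeff φ.1 k * Real.exp (-(eig lam k * t))) • casLp k,
    ∑' k : ℤ, (casCoeff φ.1 k * (b * (2 * Real.pi * k))) • mode lam t (-k),
    tsum_of_norm_bounded (hc.hasSum.mul_left _) hg1,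
    tsum_of_norm_bounded (hc.hasSum.mul_left _) hh1, ?_⟩
  set g := ∑' k, (casCoeff φ.1 k * Real.exp (-(eig lam k * t))) • casLp k
  set h := ∑' k : ℤ, (casCoeff φ.1 k * (b * (2 * Real.pi * k))) • mode lam t (-k)
  have hJ : HasSum (fun k : ℤ ↦ hW₁.isometry ((casCoeff φ.1 k * (b * (2 * Real.pi * k)))
      • mode lam t (-k))) (hW₁.isometry h) :=
    hhs.hasSum.mapL hW₁.isometry.toContinuousLinearMap
  have hcoe : ∀ᵐ ω ∂P, ∀ k : ℤ, hW₁.isometry ((casCoeff φ.1 k * (b * (2 * Real.pi * k)))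
      • mode lam t (-k)) ω
      = casCoeff φ.1 k * (b * (2 * Real.pi * k) * hW₁.isometry (mode lam t (-k)) ω) := by
    refine ae_all_iff.2 fun k ↦ ?_
    rw [map_smul]
    filter_upwards [Lp.coeFn_smul (casCoeff φ.1 k * (b * (2 * Real.pi * k)))
      (hW₁.isometry (mode lam t (-k)))] with ω h1
    rw [h1, Pi.smul_apply, smul_eq_mul]
    ring
  have key := ae_eq_of_hasSum_Lp (g := fun ω ↦ (dualOfCoeff (zeta hW₁ lam b t u₀ ω)).toLin φ
    - inner ℝ (u₀ ω) g) hJ ?_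
  · filter_upwards [key] with ω h1
    linarith
  · filter_upwards [hcoe, ae_summable_zeta (b := b) (u₀ := u₀) hW₁ hlam ht] with ω h1 h2
    have h3 := hasSum_dualOfCoeff h2 φ
    have h4 : HasSum (fun k ↦ inner ℝ (u₀ ω)
        ((casCoeff φ.1 k * Real.exp (-(eig lam k * t))) • casLp k)) (inner ℝ (u₀ ω) g) :=
      hgs.hasSum.mapL (innerSL ℝ (u₀ ω))
    refine (h3.sub h4).congr_fun fun k ↦ ?_
    rw [h1, zeta, inner_smul_right]
    ring

theorem eLpNorm_inner_le (u₀ : Ω → Lp ℝ 2 (volume : Measure UnitAddCircle))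
    (g : Lp ℝ 2 (volume : Measure UnitAddCircle)) :
    eLpNorm (fun ω ↦ inner ℝ (u₀ ω) g) 2 P ≤ ENNReal.ofReal ‖g‖ * eLpNorm u₀ 2 P :=
  eLpNorm_le_mul_eLpNorm_of_ae_le_mul (ae_of_all _ fun ω ↦ by
    rw [mul_comm]
    exact norm_inner_le_norm _ _) 2

/-- The pairing of the first part with a `C¹` function is square integrable. -/
theorem memLp_dualOfCoeff_zeta (hW₁ : IsWhiteNoise P W₁) (hlam : 0 < lam) (ht : 0 ≤ t)
    (hu : MemLp u₀ 2 P) (φ : Ck 1) :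
    MemLp (fun ω ↦ (dualOfCoeff (zeta hW₁ lam b t u₀ ω)).toLin φ) 2 P := by
  obtain ⟨g, h, -, -, he⟩ := exists_repr_dualOfCoeff_zeta (b := b) (u₀ := u₀) hW₁ hlam ht φ
  refine MemLp.ae_eq he.symm (MemLp.add ⟨hu.1.inner aestronglyMeasurable_const, ?_⟩ (Lp.memLp _))
  exact (eLpNorm_inner_le u₀ g).trans_lt (ENNReal.mul_lt_top ENNReal.ofReal_lt_top hu.2)

/-- The bound that makes the first part vanish: exponential decay of the initial value, and
linear dependence on the strength `b` of the noise. -/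
theorem eLpNorm_dualOfCoeff_zeta_le (hW₁ : IsWhiteNoise P W₁) (hlam : 0 < lam) (ht : 0 ≤ t)
    (hu : AEStronglyMeasurable u₀ P) (φ : Ck 1) :
    eLpNorm (fun ω ↦ (dualOfCoeff (zeta hW₁ lam b t u₀ ω)).toLin φ) 2 P
      ≤ ENNReal.ofReal (Real.exp (-(lam * t)) * ∑' k, |casCoeff φ.1 k|) * eLpNorm u₀ 2 P
        + ENNReal.ofReal (|b| * ∑' k, |casCoeff φ.1 k|) := by
  obtain ⟨g, h, hg, hh, he⟩ := exists_repr_dualOfCoeff_zeta (b := b) (u₀ := u₀) hW₁ hlam ht φ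
  rw [eLpNorm_congr_ae he]
  refine (eLpNorm_add_le (hu.inner aestronglyMeasurable_const) (Lp.memLp _).1 one_le_two).trans ?_
  refine add_le_add ((eLpNorm_inner_le u₀ g).trans ?_) ?_
  · gcongr
  · rw [← Lp.enorm_def, ← ofReal_norm, hW₁.isometry.norm_map]
    exact ENNReal.ofReal_le_ofReal hh

end

/-! ### Sobolev norms of dyadic blocks -/

section

/-- A Sobolev inequality on the circle; the parameter `N` is the frequency of `f`. -/
theorem pow_four_le_integral {f : UnitAddCircle → ℝ} (hf : f ∈ Ck 1) {N : ℝ} (hN : 0 < N)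
    (x : UnitAddCircle) :
    f x ^ 4 ≤ ∫ y, ((1 + 3 * N) * f y ^ 4 + (N ^ 3)⁻¹ * tderiv f y ^ 4) := by
  have hc := continuous_of_mem_Ck hf
  have hc' := continuous_tderiv hf
  induction x using QuotientAddGroup.induction_on with
  | H r =>
  have hq : Continuous fun r : ℝ ↦ (r : UnitAddCircle) := continuous_quotient_mk'
  have hd (s : ℝ) : HasDerivAt (fun s : ℝ ↦ f (s : UnitAddCircle) ^ 4)
      (4 * f (s : UnitAddCircle) ^ 3 * tderiv f (s : UnitAddCircle)) s := by
    exact ((hasDerivAt_of_mem_Ck hf s).pow 4).congr_deriv (by norm_num)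
  have hcd : Continuous fun s : ℝ ↦
      4 * f (s : UnitAddCircle) ^ 3 * tderiv f (s : UnitAddCircle) :=
    ((continuous_const.mul ((hc.comp hq).pow 3)).mul (hc'.comp hq))
  have h1 (y : UnitAddCircle) :
      f (r : UnitAddCircle) ^ 4 ≤ f y ^ 4 + ∫ z, |4 * f z ^ 3 * tderiv f z| := by
    obtain ⟨s, hs, rfl⟩ : ∃ s ∈ Set.Ioc (r - 1) r, (s : UnitAddCircle) = y := by
      refine ⟨(AddCircle.equivIoc 1 (r - 1) y : ℝ), ?_, AddCircle.coe_equivIoc⟩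
      simpa using (AddCircle.equivIoc 1 (r - 1) y).2
    have hftc := intervalIntegral.integral_eq_sub_of_hasDerivAt (fun u _ ↦ hd u)
      (hcd.intervalIntegrable s r)
    have hle : ∫ u in s..r, 4 * f (u : UnitAddCircle) ^ 3 * tderiv f (u : UnitAddCircle)
        ≤ ∫ z, |4 * f z ^ 3 * tderiv f z| := by
      rw [← UnitAddCircle.intervalIntegral_preimage (r - 1), sub_add_cancel]
      refine (intervalIntegral.integral_mono_on hs.2 (hcd.intervalIntegrable _ _)
        (hcd.abs.intervalIntegrable _ _) fun u _ ↦ le_abs_self _).trans ?_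
      exact intervalIntegral.integral_mono_interval hs.1.le hs.2 le_rfl
        (ae_of_all _ fun u ↦ abs_nonneg _) (hcd.abs.intervalIntegrable _ _)
    linarith
  have hi4 : Integrable fun y ↦ f y ^ 4 := integrable_of_continuous (hc.pow 4)
  have hi4' : Integrable fun y ↦ tderiv f y ^ 4 := integrable_of_continuous (hc'.pow 4)
  have hiabs : Integrable fun y ↦ |4 * f y ^ 3 * tderiv f y| :=
    integrable_of_continuous ((continuous_const.mul (hc.pow 3)).mul hc').abs
  have h2 : f (r : UnitAddCircle) ^ 4 ≤ ∫ y, (f y ^ 4 + |4 * f y ^ 3 * tderiv f y|) := by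
    have := integral_mono (integrable_const _) (hi4.add (integrable_const _)) h1
    rw [integral_add hi4 hiabs]
    simp only [Pi.add_apply] at this
    rw [integral_add hi4 (integrable_const _)] at this
    simpa using this
  refine h2.trans (integral_mono (hi4.add hiabs)
    ((hi4.const_mul (1 + 3 * N)).add (hi4'.const_mul (N ^ 3)⁻¹)) fun y ↦ ?_)
  -- Young's inequality `4 p³ q ≤ 3 p⁴ + q⁴` with `p = |f|`, `q = |f'| / N`
  have h3 : 4 * |f y| ^ 3 * (|tderiv f y| / N) ≤ 3 * |f y| ^ 4 + (|tderiv f y| / N) ^ 4 := by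
    have hp := abs_nonneg (f y)
    have hq : 0 ≤ |tderiv f y| / N := by positivity
    nlinarith [mul_nonneg (sq_nonneg (|f y| - |tderiv f y| / N))
      (by positivity : 0 ≤ 3 * |f y| ^ 2 + 2 * |f y| * (|tderiv f y| / N) + (|tderiv f y| / N) ^ 2)]
  have h4 : |4 * f y ^ 3 * tderiv f y| = N * (4 * |f y| ^ 3 * (|tderiv f y| / N)) := by
    rw [abs_mul, abs_mul, abs_pow, abs_of_pos (four_pos : (0 : ℝ) < 4)]
    field_simp
  have h5 : (N ^ 3)⁻¹ * tderiv f y ^ 4 = N * (|tderiv f y| / N) ^ 4 := by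
    rw [div_pow, (by decide : Even 4).pow_abs]
    field_simp
  rw [h4, h5, ← (by decide : Even 4).pow_abs (f y)]
  nlinarith [mul_le_mul_of_nonneg_left h3 hN.le]

/-- The frequencies below `2ⁿ`. -/
noncomputable def freq (n : ℕ) : Finset ℤ := Finset.Ioo (-2 ^ n) (2 ^ n)

/-- The dyadic block of frequencies between `2ⁿ` and `2ⁿ⁺¹`. -/
noncomputable def block (n : ℕ) : Finset ℤ := freq (n + 1) \ freq n

theorem freq_subset_succ (n : ℕ) : freq n ⊆ freq (n + 1) := by
  have h : (2 : ℤ) ^ n ≤ 2 ^ (n + 1) := pow_le_pow_right₀ one_le_two n.le_succ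
  exact Finset.Ioo_subset_Ioo (neg_le_neg h) h

theorem tendsto_freq : Tendsto freq atTop atTop := by
  refine tendsto_atTop_finset_of_monotone (monotone_nat_of_le_succ freq_subset_succ) fun k ↦ ?_
  refine ⟨k.natAbs, ?_⟩
  have h : (k.natAbs : ℤ) < 2 ^ k.natAbs := by exact_mod_cast Nat.lt_two_pow_self
  rw [freq, Finset.mem_Ioo]
  omega

theorem card_block_le (n : ℕ) : ((block n).card : ℝ) ≤ 4 * 2 ^ n := by
  have h1 : (block n).card ≤ (freq (n + 1)).card := Finset.card_le_card Finset.sdiff_subset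
  have h2 : (freq (n + 1)).card ≤ 4 * 2 ^ n := by
    rw [freq, Int.card_Ioo]
    have : (2 : ℤ) ^ (n + 1) = 2 * ((2 ^ n : ℕ) : ℤ) := by push_cast; ring
    rw [this]
    omega
  exact_mod_cast h1.trans h2

theorem le_abs_of_mem_block {n : ℕ} {k : ℤ} (hk : k ∈ block n) : (2 : ℝ) ^ n ≤ |(k : ℝ)| := by
  rw [block, Finset.mem_sdiff, freq, freq, Finset.mem_Ioo, Finset.mem_Ioo] at hk
  have h : (2 : ℤ) ^ n ≤ |k| := by
    by_contra hc
    rw [not_le, abs_lt] at hc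
    exact hk.2 hc
  exact_mod_cast h

/-- Modes of different frequencies are orthogonal. -/
theorem norm_sum_smul_mode_sq {lam t : ℝ} (hlam : 0 < lam) (ht : 0 ≤ t) (S : Finset ℤ) (a : ℤ → ℝ) :
    ‖∑ k ∈ S, a k • mode lam t k‖ ^ 2 = ∑ k ∈ S, a k ^ 2 * ‖mode lam t k‖ ^ 2 := by
  rw [← real_inner_self_eq_norm_sq, sum_inner]
  refine Finset.sum_congr rfl fun k hk ↦ ?_
  rw [inner_sum, Finset.sum_eq_single k]
  · rw [real_inner_smul_left, real_inner_smul_right, real_inner_self_eq_norm_sq]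
    ring
  · intro l _ hl
    rw [real_inner_smul_left, real_inner_smul_right, inner_mode hlam ht ht, if_neg hl.symm]
    simp
  · exact fun h ↦ absurd hk h

/-- A block has about `2ⁿ` modes, each of squared norm at most of order `4⁻ⁿ`. -/
theorem norm_block_sq_le {lam t : ℝ} (hlam : 0 < lam) (ht : 0 ≤ t) (n : ℕ) (x : UnitAddCircle) :
    ‖∑ k ∈ block n, cas k x • mode lam t k‖ ^ 2 ≤ 16 * (1 / 2) ^ n := by
  rw [norm_sum_smul_mode_sq hlam ht]
  have h1 (k : ℤ) (hk : k ∈ block n) : cas k x ^ 2 * ‖mode lam t k‖ ^ 2 ≤ 4 * (1 / 4) ^ n := by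
    have h2 : cas k x ^ 2 ≤ 4 := by
      have := sq_le_sq' (abs_le.1 (abs_cas_le k x)).1 (abs_le.1 (abs_cas_le k x)).2
      linarith
    have h3 : (4 : ℝ) ^ n ≤ (2 * Real.pi * k) ^ 2 := by
      have h4 := pow_le_pow_left₀ (by positivity) (le_abs_of_mem_block hk) 2
      rw [sq_abs, ← pow_mul, mul_comm n, pow_mul] at h4
      have h5 : (1 : ℝ) ≤ (2 * Real.pi) ^ 2 := by nlinarith [Real.pi_gt_three]
      rw [mul_pow]
      norm_num at h4 ⊢
      nlinarith [sq_nonneg (k : ℝ)]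
    have h6 : (4 : ℝ) ^ n * ‖mode lam t k‖ ^ 2 ≤ 1 :=
      (mul_le_mul_of_nonneg_right h3 (sq_nonneg _)).trans (sq_mul_norm_mode_sq_le hlam ht k)
    have h7 : ‖mode lam t k‖ ^ 2 ≤ (1 / 4) ^ n := by
      rw [one_div, inv_pow, ← one_div, le_div_iff₀ (by positivity)]
      linarith
    exact mul_le_mul h2 h7 (sq_nonneg _) (by norm_num)
  refine (Finset.sum_le_card_nsmul _ _ _ h1).trans ?_
  rw [nsmul_eq_mul]
  calc ((block n).card : ℝ) * (4 * (1 / 4) ^ n) ≤ (4 * 2 ^ n) * (4 * (1 / 4) ^ n) :=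
        mul_le_mul_of_nonneg_right (card_block_le n) (by positivity)
    _ = 16 * (1 / 2) ^ n := by
        rw [mul_mul_mul_comm, ← mul_pow]
        norm_num

/-- A block has about `2ⁿ` modes, whose space derivatives have bounded norm. -/
theorem norm_block_deriv_sq_le {lam t : ℝ} (hlam : 0 < lam) (ht : 0 ≤ t) (n : ℕ)
    (x : UnitAddCircle) :
    ‖∑ k ∈ block n, (2 * Real.pi * k * cas (-k) x) • mode lam t k‖ ^ 2 ≤ 16 * 2 ^ n := by
  rw [norm_sum_smul_mode_sq hlam ht]
  have h1 (k : ℤ) (_ : k ∈ block n) :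
      (2 * Real.pi * k * cas (-k) x) ^ 2 * ‖mode lam t k‖ ^ 2 ≤ 4 := by
    have h2 : cas (-k) x ^ 2 ≤ 4 := by
      have := sq_le_sq' (abs_le.1 (abs_cas_le (-k) x)).1 (abs_le.1 (abs_cas_le (-k) x)).2
      linarith
    calc (2 * Real.pi * k * cas (-k) x) ^ 2 * ‖mode lam t k‖ ^ 2
        = cas (-k) x ^ 2 * ((2 * Real.pi * k) ^ 2 * ‖mode lam t k‖ ^ 2) := by ring
      _ ≤ 4 * 1 := mul_le_mul h2 (sq_mul_norm_mode_sq_le hlam ht k) (by positivity) (by norm_num)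
      _ = 4 := mul_one 4
  refine (Finset.sum_le_card_nsmul _ _ _ h1).trans ?_
  rw [nsmul_eq_mul]
  linarith [card_block_le n]

variable {Ω : Type*} [MeasurableSpace Ω] {P : Measure Ω} {W : Integrand → Ω → ℝ}

theorem measurable_isometry (hW : IsWhiteNoise P W) (f : Lp ℝ 2 stMeasure) :
    Measurable (hW.isometry f) :=
  (Lp.stronglyMeasurable (hW.isometry f)).measurable

/-- The sum of the modes `ξ_k cas_k`, `k ∈ S`, of the stochastic convolution. -/
noncomputable def modeSum (hW : IsWhiteNoise P W) (lam t : ℝ) (S : Finset ℤ) (ω : Ω) :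
    C(UnitAddCircle, ℝ) :=
  ∑ k ∈ S, hW.isometry (mode lam t k) ω • cas k

theorem modeSum_apply (hW : IsWhiteNoise P W) (lam t : ℝ) (S : Finset ℤ) (ω : Ω)
    (x : UnitAddCircle) :
    modeSum hW lam t S ω x = ∑ k ∈ S, cas k x * hW.isometry (mode lam t k) ω := by
  simp only [modeSum, ContinuousMap.coe_sum, Finset.sum_apply, ContinuousMap.smul_apply,
    smul_eq_mul, mul_comm]

theorem modeSum_mem_Ck (hW : IsWhiteNoise P W) (lam t : ℝ) (S : Finset ℤ) (ω : Ω) :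
    ⇑(modeSum hW lam t S ω) ∈ Ck 1 := by
  have h : ⇑(modeSum hW lam t S ω) = ∑ k ∈ S, hW.isometry (mode lam t k) ω • ⇑(cas k) := by
    simp [modeSum]
  rw [h]
  exact Submodule.sum_mem _ fun k _ ↦ Submodule.smul_mem _ _ (cas_mem_Ck 1 k)

theorem tderiv_modeSum (hW : IsWhiteNoise P W) (lam t : ℝ) (S : Finset ℤ) (ω : Ω)
    (x : UnitAddCircle) : tderiv (modeSum hW lam t S ω) x
      = ∑ k ∈ S, (2 * Real.pi * k * cas (-k) x) * hW.isometry (mode lam t k) ω := by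
  induction x using QuotientAddGroup.induction_on with
  | H r =>
    have h : HasDerivAt (fun r : ℝ ↦ modeSum hW lam t S ω (r : UnitAddCircle))
        (∑ k ∈ S, (2 * Real.pi * k * cas (-k) (r : UnitAddCircle))
          * hW.isometry (mode lam t k) ω) r := by
      simp only [modeSum_apply]
      exact HasDerivAt.fun_sum fun k _ ↦ (hasDerivAt_cas k r).mul_const _
    exact (tderiv_coe _ r).trans h.deriv

theorem isometry_sum_smul (hW : IsWhiteNoise P W) (lam t : ℝ) (S : Finset ℤ) (a : ℤ → ℝ) :
    ∀ᵐ ω ∂P, hW.isometry (∑ k ∈ S, a k • mode lam t k) ω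
      = ∑ k ∈ S, a k * hW.isometry (mode lam t k) ω := by
  have h1 : ∀ᵐ ω ∂P, ∀ k, (a k • hW.isometry (mode lam t k) : Lp ℝ 2 P) ω
      = a k * hW.isometry (mode lam t k) ω := ae_all_iff.2 fun k ↦ by
    filter_upwards [Lp.coeFn_smul (a k) (hW.isometry (mode lam t k))] with ω h
    rw [h]
    rfl
  simp only [map_sum, map_smul]
  filter_upwards [h1, Lp.coeFn_finsetSum S fun k ↦ a k • hW.isometry (mode lam t k)] with ω h2 h3
  rw [h3, Finset.sum_apply]
  exact Finset.sum_congr rfl fun k _ ↦ h2 k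

/-- The fourth moment of a Gaussian variable in terms of a bound on its variance. -/
theorem lintegral_pow_four_sum_le [IsProbabilityMeasure P] (hW : IsWhiteNoise P W) (lam t : ℝ)
    (S : Finset ℤ) (a : ℤ → ℝ) {v : ℝ} (hv : ‖∑ k ∈ S, a k • mode lam t k‖ ^ 2 ≤ v) :
    ∫⁻ ω, ENNReal.ofReal ((∑ k ∈ S, a k * hW.isometry (mode lam t k) ω) ^ 4) ∂P
      ≤ ENNReal.ofReal (v ^ 2) * gaussFourth := by
  have h1 : ∫⁻ ω, ENNReal.ofReal ((∑ k ∈ S, a k * hW.isometry (mode lam t k) ω) ^ 4) ∂P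
      = ∫⁻ ω, ENNReal.ofReal (hW.isometry (∑ k ∈ S, a k • mode lam t k) ω ^ 4) ∂P := by
    refine lintegral_congr_ae ?_
    filter_upwards [isometry_sum_smul hW lam t S a] with ω h
    rw [h]
  rw [h1, hW.lintegral_fourth]
  gcongr
  calc ‖∑ k ∈ S, a k • mode lam t k‖ ^ 4 = (‖∑ k ∈ S, a k • mode lam t k‖ ^ 2) ^ 2 := by ring
    _ ≤ v ^ 2 := pow_le_pow_left₀ (sq_nonneg _) hv 2

/-- The Sobolev bound for the fourth power of the supremum of a dyadic block. -/
noncomputable def blockBound (hW : IsWhiteNoise P W) (lam t : ℝ) (n : ℕ) (ω : Ω) : ℝ :=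
  ∫ y, ((1 + 3 * 2 ^ n) * modeSum hW lam t (block n) ω y ^ 4
    + ((2 ^ n) ^ 3)⁻¹ * tderiv (modeSum hW lam t (block n) ω) y ^ 4)

theorem blockBound_nonneg (hW : IsWhiteNoise P W) (lam t : ℝ) (n : ℕ) (ω : Ω) :
    0 ≤ blockBound hW lam t n ω :=
  integral_nonneg fun y ↦ add_nonneg
    (mul_nonneg (by positivity) ((by decide : Even 4).pow_nonneg _))
    (mul_nonneg (by positivity) ((by decide : Even 4).pow_nonneg _))

theorem norm_modeSum_block_le (hW : IsWhiteNoise P W) (lam t : ℝ) (n : ℕ) (ω : Ω) :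
    ‖modeSum hW lam t (block n) ω‖ ^ 4 ≤ blockBound hW lam t n ω := by
  set f := modeSum hW lam t (block n) ω
  obtain ⟨x, -, hx⟩ :=
    isCompact_univ.exists_isMaxOn Set.univ_nonempty f.continuous.norm.continuousOn
  have h : ‖f‖ ≤ |f x| := (ContinuousMap.norm_le _ (abs_nonneg _)).2 fun y ↦ hx (Set.mem_univ y)
  refine (pow_le_pow_left₀ (norm_nonneg _) h 4).trans ?_
  rw [(by decide : Even 4).pow_abs]
  exact pow_four_le_integral (modeSum_mem_Ck hW lam t (block n) ω) (by positivity) x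

end

/-! ### The stochastic convolution -/

section

variable {Ω : Type*} [MeasurableSpace Ω] {P : Measure Ω} [IsProbabilityMeasure P]
  {W : Integrand → Ω → ℝ} {lam t : ℝ}

theorem blockBound_const_le (n : ℕ) : (1 + 3 * 2 ^ n) * (16 * (1 / 2 : ℝ) ^ n) ^ 2
    + ((2 ^ n) ^ 3)⁻¹ * (16 * 2 ^ n) ^ 2 ≤ 1280 * (1 / 2) ^ n := by
  have h5 : (1 : ℝ) ≤ 2 ^ n := one_le_pow₀ one_le_two
  rw [one_div, inv_pow]
  generalize (2 : ℝ) ^ n = N at h5 ⊢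
  field_simp
  nlinarith

theorem lintegral_block_le (hW : IsWhiteNoise P W) (hlam : 0 < lam) (ht : 0 ≤ t) (n : ℕ) {A B : ℝ}
    (hA : 0 ≤ A) (hB : 0 ≤ B) (y : UnitAddCircle) :
    ∫⁻ ω, (ENNReal.ofReal A
        * ENNReal.ofReal ((∑ k ∈ block n, cas k y * hW.isometry (mode lam t k) ω) ^ 4)
      + ENNReal.ofReal B * ENNReal.ofReal ((∑ k ∈ block n,
        (2 * Real.pi * k * cas (-k) y) * hW.isometry (mode lam t k) ω) ^ 4)) ∂P
      ≤ ENNReal.ofReal (A * (16 * (1 / 2) ^ n) ^ 2 + B * (16 * 2 ^ n) ^ 2) * gaussFourth := by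
  have hm : Measurable fun ω ↦ ENNReal.ofReal A
      * ENNReal.ofReal ((∑ k ∈ block n, cas k y * hW.isometry (mode lam t k) ω) ^ 4) := by
    have := fun k : ℤ ↦ measurable_isometry hW (mode lam t k)
    fun_prop
  have hF := lintegral_pow_four_sum_le hW lam t (block n) (fun k ↦ cas k y)
    (norm_block_sq_le hlam ht n y)
  have hG := lintegral_pow_four_sum_le hW lam t (block n) (fun k ↦ 2 * Real.pi * k * cas (-k) y)
    (norm_block_deriv_sq_le hlam ht n y)
  rw [lintegral_add_left hm, lintegral_const_mul' _ _ ENNReal.ofReal_ne_top,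
    lintegral_const_mul' _ _ ENNReal.ofReal_ne_top, ENNReal.ofReal_add (by positivity)
    (by positivity), add_mul, ENNReal.ofReal_mul hA, ENNReal.ofReal_mul hB, mul_assoc, mul_assoc]
  exact add_le_add (mul_le_mul_right hF _) (mul_le_mul_right hG _)

/-- Exchanging the integrals over `Ω` and `𝕋` reduces the bound to moments at a fixed point. -/
theorem lintegral_blockBound_le (hW : IsWhiteNoise P W) (hlam : 0 < lam) (ht : 0 ≤ t) (n : ℕ) :
    ∫⁻ ω, ENNReal.ofReal (blockBound hW lam t n ω) ∂P
      ≤ ENNReal.ofReal (1280 * (1 / 2) ^ n) * gaussFourth := by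
  set A : ℝ := 1 + 3 * 2 ^ n
  set B : ℝ := ((2 ^ n) ^ 3)⁻¹
  have hA0 : 0 ≤ A := by positivity
  have hB0 : 0 ≤ B := by positivity
  let F : Ω → UnitAddCircle → ℝ := fun ω y ↦
    ∑ k ∈ block n, cas k y * hW.isometry (mode lam t k) ω
  let G : Ω → UnitAddCircle → ℝ := fun ω y ↦
    ∑ k ∈ block n, (2 * Real.pi * k * cas (-k) y) * hW.isometry (mode lam t k) ω
  have hFm : Measurable (Function.uncurry F) := by
    refine Finset.measurable_fun_sum _ fun k _ ↦ ?_
    exact ((cas k).continuous.measurable.comp measurable_snd).mul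
      ((measurable_isometry hW _).comp measurable_fst)
  have hGm : Measurable (Function.uncurry G) := by
    refine Finset.measurable_fun_sum _ fun k _ ↦ ?_
    exact (((cas (-k)).continuous.measurable.comp measurable_snd).const_mul _).mul
      ((measurable_isometry hW _).comp measurable_fst)
  have h4 (r : ℝ) : 0 ≤ r ^ 4 := (by decide : Even 4).pow_nonneg r
  have h1 (ω : Ω) : ENNReal.ofReal (blockBound hW lam t n ω)
      = ∫⁻ y, ENNReal.ofReal A * ENNReal.ofReal (F ω y ^ 4)
        + ENNReal.ofReal B * ENNReal.ofReal (G ω y ^ 4) := by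
    have hc : Continuous fun y ↦ A * modeSum hW lam t (block n) ω y ^ 4
        + B * tderiv (modeSum hW lam t (block n) ω) y ^ 4 :=
      (continuous_const.mul ((modeSum hW lam t (block n) ω).continuous.pow 4)).add
        (continuous_const.mul ((continuous_tderiv (modeSum_mem_Ck hW lam t (block n) ω)).pow 4))
    rw [blockBound, ofReal_integral_eq_lintegral_ofReal (integrable_of_continuous hc)
      (ae_of_all _ fun y ↦ add_nonneg (mul_nonneg hA0 (h4 _)) (mul_nonneg hB0 (h4 _)))]
    refine lintegral_congr fun y ↦ ?_
    rw [ENNReal.ofReal_add (mul_nonneg hA0 (h4 _)) (mul_nonneg hB0 (h4 _)),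
      ENNReal.ofReal_mul hA0, ENNReal.ofReal_mul hB0, modeSum_apply, tderiv_modeSum]
  simp only [h1]
  have hF4 : Measurable fun p : Ω × UnitAddCircle ↦
      ENNReal.ofReal A * ENNReal.ofReal (F p.1 p.2 ^ 4) :=
    (ENNReal.measurable_ofReal.comp (hFm.pow_const 4)).const_mul _
  have hG4 : Measurable fun p : Ω × UnitAddCircle ↦
      ENNReal.ofReal B * ENNReal.ofReal (G p.1 p.2 ^ 4) :=
    (ENNReal.measurable_ofReal.comp (hGm.pow_const 4)).const_mul _
  rw [lintegral_lintegral_swap (hF4.add hG4).aemeasurable]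
  have h2 (y : UnitAddCircle) := (lintegral_block_le hW hlam ht n hA0 hB0 y).trans
    (mul_le_mul_left (ENNReal.ofReal_le_ofReal (blockBound_const_le n)) _)
  calc _ ≤ ∫⁻ _y : UnitAddCircle, ENNReal.ofReal (1280 * (1 / 2) ^ n) * gaussFourth :=
        lintegral_mono h2
    _ = _ := by simp

/-- The stochastic convolution converges uniformly along the dyadic frequencies, almost surely. -/
theorem ae_cauchySeq_modeSum (hW : IsWhiteNoise P W) (hlam : 0 < lam) (ht : 0 ≤ t) :
    ∀ᵐ ω ∂P, CauchySeq fun n ↦ modeSum hW lam t (freq n) ω := by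
  -- the expected fourth powers of the blocks are of order `2⁻ⁿ`, and `ρ⁻⁴ / 2 < 4 / 5`, so the
  -- blocks are almost surely `O(ρⁿ)`
  set ρ : ℝ := 9 / 10
  have hmeas (n : ℕ) : AEMeasurable (fun ω ↦ ENNReal.ofReal (((ρ ^ n) ^ 4)⁻¹)
      * ENNReal.ofReal (blockBound hW lam t n ω)) P := by
    have h : StronglyMeasurable (blockBound hW lam t n) := by
      refine StronglyMeasurable.integral_prod_right (f := fun ω y ↦
        (1 + 3 * 2 ^ n) * modeSum hW lam t (block n) ω y ^ 4
        + ((2 ^ n) ^ 3)⁻¹ * tderiv (modeSum hW lam t (block n) ω) y ^ 4) ?_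
      simp only [modeSum_apply, tderiv_modeSum]
      refine Measurable.stronglyMeasurable ?_
      have h1 (k : ℤ) : Measurable fun p : Ω × UnitAddCircle ↦ hW.isometry (mode lam t k) p.1 :=
        (measurable_isometry hW _).comp measurable_fst
      have h2 (k : ℤ) : Measurable fun p : Ω × UnitAddCircle ↦ cas k p.2 :=
        (cas k).continuous.measurable.comp measurable_snd
      refine (((Finset.measurable_fun_sum _ fun k _ ↦ ?_).pow_const 4).const_mul _).add
        (((Finset.measurable_fun_sum _ fun k _ ↦ ?_).pow_const 4).const_mul _)
      · exact (h2 k).mul (h1 k)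
      · exact ((h2 (-k)).const_mul _).mul (h1 k)
    exact (h.measurable.ennreal_ofReal.const_mul _).aemeasurable
  have hfin : ∫⁻ ω, ∑' n, ENNReal.ofReal (((ρ ^ n) ^ 4)⁻¹)
      * ENNReal.ofReal (blockBound hW lam t n ω) ∂P ≠ ∞ := by
    rw [lintegral_tsum hmeas]
    have h1 (n : ℕ) : ∫⁻ ω, ENNReal.ofReal (((ρ ^ n) ^ 4)⁻¹)
        * ENNReal.ofReal (blockBound hW lam t n ω) ∂P
        ≤ ENNReal.ofReal (1280 * (4 / 5) ^ n) * gaussFourth := by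
      rw [lintegral_const_mul' _ _ ENNReal.ofReal_ne_top]
      refine (mul_le_mul_right (lintegral_blockBound_le hW hlam ht n) _).trans ?_
      rw [← mul_assoc, ← ENNReal.ofReal_mul (by positivity)]
      refine mul_le_mul_left (ENNReal.ofReal_le_ofReal ?_) _
      rw [← pow_mul, mul_comm n 4, pow_mul, ← inv_pow, mul_left_comm, ← mul_pow]
      refine mul_le_mul_of_nonneg_left (pow_le_pow_left₀ (by positivity) ?_ n) (by norm_num)
      norm_num [ρ]
    refine ne_top_of_le_ne_top ?_ (ENNReal.tsum_le_tsum h1)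
    rw [ENNReal.tsum_mul_right, ← ENNReal.ofReal_tsum_of_nonneg (fun n ↦ by positivity)
      ((summable_geometric_of_lt_one (by norm_num) (by norm_num)).mul_left _)]
    exact ENNReal.mul_ne_top ENNReal.ofReal_ne_top gaussFourth_lt_top.ne
  filter_upwards [ae_lt_top' (AEMeasurable.tsum hmeas) hfin] with ω hω
  set M : ℝ := (∑' n, ENNReal.ofReal (((ρ ^ n) ^ 4)⁻¹)
      * ENNReal.ofReal (blockBound hW lam t n ω)).toReal
  have hρ : 0 < ρ := by norm_num [ρ]
  have hM (n : ℕ) : blockBound hW lam t n ω ≤ M * (ρ ^ n) ^ 4 := by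
    have h1 := ENNReal.le_tsum (f := fun n ↦ ENNReal.ofReal (((ρ ^ n) ^ 4)⁻¹)
      * ENNReal.ofReal (blockBound hW lam t n ω)) n
    have h2 := ENNReal.toReal_mono hω.ne h1
    rw [← ENNReal.ofReal_mul (by positivity), ENNReal.toReal_ofReal
      (mul_nonneg (by positivity) (blockBound_nonneg _ _ _ _ _))] at h2
    rwa [inv_mul_le_iff₀ (by positivity), mul_comm] at h2
  -- `max M 1` dominates the fourth root of `M`
  refine cauchySeq_of_le_geometric ρ (max M 1) (by norm_num [ρ]) fun n ↦ ?_
  have hsub : modeSum hW lam t (freq (n + 1)) ω - modeSum hW lam t (freq n) ω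
      = modeSum hW lam t (block n) ω := by
    rw [sub_eq_iff_eq_add, modeSum, modeSum, modeSum, block,
      Finset.sum_sdiff (freq_subset_succ n)]
  rw [dist_comm, dist_eq_norm, hsub]
  have hm1 : 1 ≤ max M 1 := le_max_right _ _
  refine le_of_pow_le_pow_left₀ four_ne_zero (by positivity) ?_
  refine (norm_modeSum_block_le hW lam t n ω).trans ((hM n).trans ?_)
  rw [mul_pow]
  refine mul_le_mul_of_nonneg_right ((le_max_left M 1).trans ?_) (by positivity)
  exact le_self_pow₀ hm1 four_ne_zero

/-- The stochastic convolution `∫₀ᵗ∫ e^{-λ(t-s)} p_{t-s}(x, y) W(ds dy)` as a random continuous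
function of `x`, defined as the limit of its dyadic partial sums, which exists almost surely. -/
noncomputable def stochConv (hW : IsWhiteNoise P W) (lam t : ℝ) (ω : Ω) : C(UnitAddCircle, ℝ) :=
  limUnder atTop fun n ↦ modeSum hW lam t (freq n) ω

theorem ae_tendsto_modeSum (hW : IsWhiteNoise P W) (hlam : 0 < lam) (ht : 0 ≤ t) :
    ∀ᵐ ω ∂P, Tendsto (fun n ↦ modeSum hW lam t (freq n) ω) atTop (𝓝 (stochConv hW lam t ω)) := by
  filter_upwards [ae_cauchySeq_modeSum hW hlam ht] with ω h using h.tendsto_limUnder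

/-- The integrand `1_{(0, t]}(s) e^{-λ(t-s)} p_{t-s}(x, y)`, with `p` the heat kernel of the
circle, defined as the limit in `L²` of its dyadic partial sums. -/
noncomputable def heatIntegrand (lam t : ℝ) (x : UnitAddCircle) : Lp ℝ 2 stMeasure :=
  limUnder atTop fun n ↦ ∑ k ∈ freq n, cas k x • mode lam t k

theorem tendsto_heatIntegrand (hlam : 0 < lam) (ht : 0 ≤ t) (x : UnitAddCircle) :
    Tendsto (fun n ↦ ∑ k ∈ freq n, cas k x • mode lam t k) atTop
      (𝓝 (heatIntegrand lam t x)) := by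
  refine CauchySeq.tendsto_limUnder (cauchySeq_of_le_geometric (3 / 4) 4 (by norm_num) fun n ↦ ?_)
  rw [dist_comm, dist_eq_norm, ← Finset.sum_sdiff (freq_subset_succ n), add_sub_cancel_right]
  refine le_of_pow_le_pow_left₀ two_ne_zero (by positivity)
    ((norm_block_sq_le hlam ht n x).trans ?_)
  rw [mul_pow, ← pow_mul, mul_comm n 2, pow_mul]
  refine mul_le_mul (by norm_num) (pow_le_pow_left₀ (by norm_num) (by norm_num) n)
    (by positivity) (by norm_num)

/-- The value of the stochastic convolution at a point is a white noise integral. -/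
theorem stochConv_ae_eq (hW : IsWhiteNoise P W) (hlam : 0 < lam) (ht : 0 ≤ t) (x : UnitAddCircle) :
    (fun ω ↦ stochConv hW lam t ω x) =ᵐ[P] hW.isometry (heatIntegrand lam t x) := by
  refine ae_eq_of_tendsto_Lp
    ((hW.isometry.continuous.tendsto _).comp (tendsto_heatIntegrand hlam ht x)) ?_
  have h1 : ∀ᵐ ω ∂P, ∀ n, hW.isometry (∑ k ∈ freq n, cas k x • mode lam t k) ω
      = ∑ k ∈ freq n, cas k x * hW.isometry (mode lam t k) ω :=
    ae_all_iff.2 fun n ↦ isometry_sum_smul hW lam t (freq n) fun k ↦ cas k x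
  filter_upwards [h1, ae_tendsto_modeSum hW hlam ht] with ω h2 h3
  simp only [Function.comp_apply, h2, ← modeSum_apply]
  exact ((continuous_eval_const x).tendsto _).comp h3

/-- Parseval's identity for the stochastic convolution, along the dyadic frequencies. -/
theorem tendsto_sum_casCoeff_mul (hW : IsWhiteNoise P W) (hlam : 0 < lam) (ht : 0 ≤ t) :
    ∀ᵐ ω ∂P, ∀ φ : C(UnitAddCircle, ℝ),
      Tendsto (fun n ↦ ∑ k ∈ freq n, casCoeff φ k * hW.isometry (mode lam t k) ω) atTop
        (𝓝 (∫ x, stochConv hW lam t ω x * φ x)) := by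
  filter_upwards [ae_tendsto_modeSum hW hlam ht] with ω h φ
  have h1 : Tendsto (fun n ↦ inner ℝ (ContinuousMap.toLp 2 (volume : Measure UnitAddCircle) ℝ
      (modeSum hW lam t (freq n) ω)) (ContinuousMap.toLp 2 volume ℝ φ)) atTop
      (𝓝 (inner ℝ (ContinuousMap.toLp 2 (volume : Measure UnitAddCircle) ℝ
        (stochConv hW lam t ω)) (ContinuousMap.toLp 2 volume ℝ φ))) :=
    (((ContinuousMap.toLp 2 (volume : Measure UnitAddCircle) ℝ).continuous.tendsto _).comp h).inner
      tendsto_const_nhds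
  rw [inner_toLp] at h1
  refine h1.congr fun n ↦ ?_
  rw [modeSum, map_sum, sum_inner]
  refine Finset.sum_congr rfl fun k _ ↦ ?_
  rw [map_smul, real_inner_smul_left, inner_toLp, casCoeff, mul_comm]
  congr 1
  exact integral_congr_ae (ae_of_all _ fun x ↦ mul_comm _ _)

/-- The covariance of the stochastic convolution. -/
theorem inner_heatIntegrand {s : ℝ} (hlam : 0 < lam) (ht : 0 ≤ t) (hs : 0 ≤ s)
    (x y : UnitAddCircle) : inner ℝ (heatIntegrand lam t x) (heatIntegrand lam s y)
      = ∑' k, cas k x * cas k y * ouCov (eig lam k) t s := by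
  have h1 := (tendsto_heatIntegrand hlam ht x).inner (𝕜 := ℝ) (tendsto_heatIntegrand hlam hs y)
  have h2 (n : ℕ) : inner ℝ (∑ k ∈ freq n, cas k x • mode lam t k)
      (∑ k ∈ freq n, cas k y • mode lam s k)
      = ∑ k ∈ freq n, cas k x * cas k y * ouCov (eig lam k) t s := by
    rw [sum_inner]
    refine Finset.sum_congr rfl fun k hk ↦ ?_
    rw [inner_sum, Finset.sum_eq_single k]
    · rw [real_inner_smul_left, real_inner_smul_right, inner_mode hlam ht hs, if_pos rfl]
      ring
    · intro l _ hl
      rw [real_inner_smul_left, real_inner_smul_right, inner_mode hlam ht hs, if_neg hl.symm]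
      simp
    · exact fun h ↦ absurd hk h
  simp only [h2] at h1
  have hsum : Summable fun k ↦ cas k x * cas k y * ouCov (eig lam k) t s := by
    refine Summable.of_norm_bounded ((summable_inv_eig hlam).mul_left 4) fun k ↦ ?_
    have he := eig_pos hlam k
    rw [norm_mul]
    refine mul_le_mul (abs_cas_mul_cas_le k x y) ?_ (norm_nonneg _) (by norm_num)
    have h3 : Real.exp (-(eig lam k * |t - s|)) ≤ 1 :=
      Real.exp_le_one_iff.2 (neg_nonpos.2 (mul_nonneg he.le (abs_nonneg _)))
    have h4 : Real.exp (-(eig lam k * (t + s))) ≤ 1 :=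
      Real.exp_le_one_iff.2 (neg_nonpos.2 (mul_nonneg he.le (by linarith)))
    have h5 := Real.exp_pos (-(eig lam k * |t - s|))
    have h6 := Real.exp_pos (-(eig lam k * (t + s)))
    rw [ouCov, norm_div, Real.norm_of_nonneg (by linarith : 0 ≤ 2 * eig lam k), ← one_div]
    refine div_le_div₀ zero_le_one ?_ he (by linarith)
    rw [Real.norm_eq_abs, abs_le]
    constructor <;> linarith
  have h3 : Tendsto (fun n ↦ ∑ k ∈ freq n, cas k x * cas k y * ouCov (eig lam k) t s) atTop
      (𝓝 (∑' k, cas k x * cas k y * ouCov (eig lam k) t s)) := by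
    have := hsum.hasSum
    simp only [HasSum, SummationFilter.unconditional_filter] at this
    exact this.comp tendsto_freq
  exact tendsto_nhds_unique h1 h3

end

/-! ### The scaling limit -/

section

/-- The characteristic function of a random vector in terms of its linear combinations. -/
theorem charFun_map_toLp {Ω : Type*} [MeasurableSpace Ω] {P : Measure Ω} {n : ℕ}
    {X : Ω → Fin n → ℝ} (hX : AEMeasurable X P) (v : EuclideanSpace ℝ (Fin n)) :
    charFun (P.map fun ω ↦ WithLp.toLp 2 (X ω)) v
      = charFun (P.map fun ω ↦ ∑ i, v i * X ω i) 1 := by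
  have h1 : AEMeasurable (fun ω ↦ ∑ i, v i * X ω i) P := by fun_prop
  have h2 : AEMeasurable (fun ω ↦ WithLp.toLp 2 (X ω)) P := by fun_prop
  rw [charFun_apply, charFun_apply, integral_map h1 (by fun_prop), integral_map h2 (by fun_prop)]
  refine integral_congr_ae (ae_of_all _ fun ω ↦ ?_)
  simp [PiLp.inner_apply]

/-- The Cramér-Wold form of Lévy's continuity theorem. -/
theorem tendstoInDistribution_of_tendsto_charFun {Ω Ω' : Type*} [MeasurableSpace Ω]
    [MeasurableSpace Ω'] {P : Measure Ω} [IsProbabilityMeasure P] {P' : Measure Ω'}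
    [IsProbabilityMeasure P'] {n : ℕ} {X : ℝ → Ω → Fin n → ℝ} {Y : Ω' → Fin n → ℝ}
    (hX : ∀ K, AEMeasurable (X K) P) (hY : AEMeasurable Y P')
    (h : ∀ v : Fin n → ℝ, Tendsto (fun K ↦ charFun (P.map fun ω ↦ ∑ i, v i * X K ω i) 1) atTop
      (𝓝 (charFun (P'.map fun ω ↦ ∑ i, v i * Y ω i) 1))) :
    TendstoInDistribution X atTop Y (fun _ ↦ P) P' := by
  have hX' (K : ℝ) : AEMeasurable (fun ω ↦ WithLp.toLp 2 (X K ω)) P := by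
    have := hX K
    fun_prop
  have hY' : AEMeasurable (fun ω ↦ WithLp.toLp 2 (Y ω)) P' := by fun_prop
  have hE : TendstoInDistribution (fun K ω ↦ WithLp.toLp 2 (X K ω)) atTop
      (fun ω ↦ WithLp.toLp 2 (Y ω)) (fun _ ↦ P) P' := by
    refine ⟨hX', hY', tendsto_of_seq_tendsto fun u hu ↦ ?_⟩
    refine ProbabilityMeasure.tendsto_of_tendsto_charFun (E := EuclideanSpace ℝ (Fin n)) fun v ↦ ?_
    have h1 := (h v).comp hu
    simp only [Function.comp_def, ← charFun_map_toLp (hX _) v, ← charFun_map_toLp hY v] at h1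
    exact h1
  exact hE.continuous_comp (g := WithLp.ofLp) (by fun_prop)

theorem charFun_map_one_of_hasGaussianLaw {Ω : Type*} [MeasurableSpace Ω] {P : Measure Ω}
    {X : Ω → ℝ} (hX : HasGaussianLaw X P) (h0 : ∫ ω, X ω ∂P = 0) :
    charFun (P.map X) 1 = Complex.exp (-(Var[X; P] : ℂ) / 2) := by
  rw [hX.map_eq_gaussianReal, charFun_gaussianReal, h0]
  congr 1
  have : ((Var[X; P].toNNReal : ℝ≥0) : ℝ) = Var[X; P] := Real.coe_toNNReal _ (variance_nonneg _ _)
  rw [show ((Var[X; P].toNNReal : ℝ≥0) : ℂ) = (Var[X; P] : ℂ) by rw [← this]; simp]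
  push_cast
  ring

/-- A linear combination of independent centred Gaussian variables, with repetitions allowed. -/
theorem charFun_sum_infinitePi {ι : Type*} [DecidableEq ι] (s : ℝ≥0) {n : ℕ} (v : Fin n → ℝ)
    (p : Fin n → ι) :
    charFun ((Measure.infinitePi fun _ : ι ↦ gaussianReal 0 s).map fun ω ↦ ∑ i, v i * ω (p i)) 1
      = Complex.exp (-((∑ i, ∑ j, v i * v j * (if p i = p j then (s : ℝ) else 0) : ℝ) : ℂ)
          / 2) := by
  set μ := Measure.infinitePi fun _ : ι ↦ gaussianReal 0 s
  have hind : iIndepFun (fun (i : ι) (ω : ι → ℝ) ↦ ω i) μ :=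
    iIndepFun_infinitePi (X := fun _ x ↦ x) fun _ ↦ measurable_id
  have hlaw (i : ι) : μ.map (fun ω ↦ ω i) = gaussianReal 0 s := Measure.infinitePi_map_eval _ i
  have hg (i : ι) : HasGaussianLaw (fun ω : ι → ℝ ↦ ω i) μ :=
    ⟨by rw [hlaw]; infer_instance⟩
  have hproc : IsGaussianProcess (fun (i : ι) (ω : ι → ℝ) ↦ ω i) μ :=
    ⟨fun I ↦ iIndepFun.hasGaussianLaw (fun i : I ↦ hg i) (hind.precomp Subtype.val_injective)⟩
  have hsum : HasGaussianLaw (fun ω : ι → ℝ ↦ ∑ i, v i * ω (p i)) μ :=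
    ((hproc.comp_right p).smul v).hasGaussianLaw_fun_sum (I := Finset.univ)
  have hmean (i : ι) : ∫ ω, ω i ∂μ = 0 := by
    have := integral_map (μ := μ) (measurable_pi_apply i).aemeasurable
      (f := id) (by fun_prop)
    rw [hlaw] at this
    simpa using this.symm
  have hmem (i : ι) : MemLp (fun ω : ι → ℝ ↦ ω i) 2 μ := (hg i).memLp_two
  have h0 : ∫ ω, ∑ i, v i * ω (p i) ∂μ = 0 := by
    rw [integral_finsetSum _ fun i _ ↦ ((hmem (p i)).integrable one_le_two).const_mul (v i)]
    simp [integral_const_mul, hmean]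
  have hcov (i j : ι) :
      cov[fun ω : ι → ℝ ↦ ω i, fun ω ↦ ω j; μ] = if i = j then (s : ℝ) else 0 := by
    split_ifs with hij
    · subst hij
      rw [covariance_self (measurable_pi_apply i).aemeasurable,
        ← variance_id_gaussianReal (μ := 0) (v := s), ← hlaw i,
        variance_map aemeasurable_id (measurable_pi_apply i).aemeasurable]
      rfl
    · exact (hind.indepFun hij).covariance_eq_zero (hmem i) (hmem j)
  rw [charFun_map_one_of_hasGaussianLaw hsum h0,
    variance_fun_sum fun i ↦ (hmem (p i)).const_mul (v i)]
  simp only [covariance_const_mul_left, covariance_const_mul_right, hcov]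
  exact congrArg (fun r : ℝ ↦ Complex.exp (-(r : ℂ) / 2))
    (Finset.sum_congr rfl fun i _ ↦ Finset.sum_congr rfl fun j _ ↦ by ring)

variable {Ω : Type*} [MeasurableSpace Ω] {P : Measure Ω} [IsProbabilityMeasure P]
  {W : Integrand → Ω → ℝ}

theorem charFun_map_isometry (hW : IsWhiteNoise P W) (f : Lp ℝ 2 stMeasure) :
    charFun (P.map (hW.isometry f)) 1 = Complex.exp (-((‖f‖ ^ 2 : ℝ) : ℂ) / 2) := by
  have h : (((‖f‖ ^ 2).toNNReal : ℝ≥0) : ℝ) = ‖f‖ ^ 2 := Real.coe_toNNReal _ (sq_nonneg _)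
  rw [hW.map_isometry, charFun_gaussianReal]
  congr 1
  generalize (‖f‖ ^ 2).toNNReal = r at h
  rw [← h]
  push_cast
  ring

open Classical in
/-- Convergence of the finite-dimensional distributions of images of integrands under white noise
to a field of independent Gaussian variables follows from convergence of the covariances. -/
theorem tendstoInDistribution_isometry (hW : IsWhiteNoise P W) {ι : Type*} (s : ℝ≥0)
    (f : ℝ → ι → Lp ℝ 2 stMeasure) (X : ℝ → Ω → ι → ℝ)
    (hXm : ∀ K i, AEMeasurable (fun ω ↦ X K ω i) P)
    (hX : ∀ᶠ K in atTop, ∀ i, (fun ω ↦ X K ω i) =ᵐ[P] hW.isometry (f K i))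
    (hf : ∀ i j, Tendsto (fun K ↦ inner ℝ (f K i) (f K j)) atTop
      (𝓝 (if i = j then (s : ℝ) else 0))) {n : ℕ} (p : Fin n → ι) :
    TendstoInDistribution (fun K ω i ↦ X K ω (p i)) atTop (fun ω i ↦ ω (p i)) (fun _ ↦ P)
      (Measure.infinitePi fun _ : ι ↦ gaussianReal 0 s) := by
  refine tendstoInDistribution_of_tendsto_charFun
    (fun K ↦ aemeasurable_pi_lambda _ fun i ↦ hXm K (p i))
    (measurable_pi_lambda _ fun i ↦ measurable_pi_apply (p i)).aemeasurable fun v ↦ ?_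
  rw [charFun_sum_infinitePi]
  have hlim : Tendsto (fun K ↦ ∑ i, ∑ j, v i * v j * inner ℝ (f K (p i)) (f K (p j))) atTop
      (𝓝 (∑ i, ∑ j, v i * v j * (if p i = p j then (s : ℝ) else 0))) :=
    tendsto_finsetSum _ fun i _ ↦ tendsto_finsetSum _ fun j _ ↦ (hf (p i) (p j)).const_mul _
  have hexp : Continuous fun r : ℝ ↦ Complex.exp (-(r : ℂ) / 2) := by fun_prop
  refine ((hexp.tendsto _).comp hlim).congr' ?_
  filter_upwards [hX] with K hK
  have h1 : (fun ω ↦ ∑ i, v i * X K ω (p i)) =ᵐ[P] hW.isometry (∑ i, v i • f K (p i)) := by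
    simp only [map_sum, map_smul]
    have h2 : ∀ᵐ ω ∂P, ∀ i, X K ω (p i) = hW.isometry (f K (p i)) ω :=
      ae_all_iff.2 fun i ↦ hK (p i)
    have h3 : ∀ᵐ ω ∂P, ∀ i, (v i • hW.isometry (f K (p i)) : Lp ℝ 2 P) ω
        = v i * hW.isometry (f K (p i)) ω := ae_all_iff.2 fun i ↦ by
      filter_upwards [Lp.coeFn_smul (v i) (hW.isometry (f K (p i)))] with ω h
      rw [h]
      rfl
    filter_upwards [h2, h3, Lp.coeFn_finsetSum Finset.univ fun i ↦ v i • hW.isometry (f K (p i))]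
      with ω h4 h5 h6
    rw [h6, Finset.sum_apply]
    exact Finset.sum_congr rfl fun i _ ↦ by rw [h4, h5]
  rw [Measure.map_congr h1, charFun_map_isometry, ← real_inner_self_eq_norm_sq, sum_inner]
  simp only [Function.comp_apply, inner_sum, real_inner_smul_left, real_inner_smul_right]
  exact congrArg (fun r : ℝ ↦ Complex.exp (-(r : ℂ) / 2))
    (Finset.sum_congr rfl fun i _ ↦ Finset.sum_congr rfl fun j _ ↦ by ring)

/-- The scaling limit of the covariances is that of independent variables of variance `σ²`. -/
theorem tendsto_inner_heatIntegrand {c : ℝ} (hc : 0 < c) (c₂ : ℝ) {t s : ℝ} (ht : 0 < t)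
    (hs : 0 < s) (x y : UnitAddCircle) :
    Tendsto (fun K : ℝ ↦ inner ℝ ((c₂ * K ^ (1 / 4 : ℝ)) • heatIntegrand (c * K) t x)
      ((c₂ * K ^ (1 / 4 : ℝ)) • heatIntegrand (c * K) s y)) atTop
      (𝓝 (if t = s ∧ x = y then sigmaSq c c₂ else 0)) := by
  have h := (tendsto_cov hc ht hs x y).const_mul (c₂ ^ 2)
  rw [mul_ite, mul_zero, ← sigmaSq_eq hc] at h
  refine h.congr' ?_
  filter_upwards [eventually_gt_atTop (0 : ℝ)] with K hK
  rw [real_inner_smul_left, real_inner_smul_right,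
    inner_heatIntegrand (mul_pos hc hK) ht.le hs.le, Real.sqrt_eq_rpow,
    show (1 / 2 : ℝ) = 1 / 4 + 1 / 4 by norm_num, Real.rpow_add hK]
  ring

end

/-! ### The decomposition of the solution -/

section

variable {Ω : Type*} [MeasurableSpace Ω] {P : Measure Ω}
  {W₁ W : Integrand → Ω → ℝ} {c c₁ c₂ : ℝ}

/-- The part of the solution produced by the initial value and by `W₁`. -/
noncomputable def roughPart (hW₁ : IsWhiteNoise P W₁) (c c₁ K t : ℝ)
    (u₀ : Ω → Lp ℝ 2 (volume : Measure UnitAddCircle)) (ω : Ω) : DualCk 1 :=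
  dualOfCoeff (zeta hW₁ (c * K) (-(c₁ * K ^ (-(1 / 4) : ℝ))) t u₀ ω)

open Classical in
/-- The part of the solution produced by `W`. It is given the value zero outside the range
`1 ≤ K`, `0 ≤ t`, so that it is measurable for all parameters. -/
noncomputable def fieldPart (hW : IsWhiteNoise P W) (c c₂ K t : ℝ) (ω : Ω) :
    C(UnitAddCircle, ℝ) :=
  if 1 ≤ K ∧ 0 ≤ t then (c₂ * K ^ (1 / 4 : ℝ)) • stochConv hW (c * K) t ω else 0

theorem fieldPart_of_le (hW : IsWhiteNoise P W) {K t : ℝ} (hK : 1 ≤ K) (ht : 0 ≤ t) (ω : Ω) :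
    fieldPart hW c c₂ K t ω = (c₂ * K ^ (1 / 4 : ℝ)) • stochConv hW (c * K) t ω :=
  if_pos ⟨hK, ht⟩

theorem fieldPart_ae_eq [IsProbabilityMeasure P] (hW : IsWhiteNoise P W) (hc : 0 < c) {K t : ℝ}
    (hK : 1 ≤ K) (ht : 0 ≤ t) (x : UnitAddCircle) : (fun ω ↦ fieldPart hW c c₂ K t ω x)
      =ᵐ[P] hW.isometry ((c₂ * K ^ (1 / 4 : ℝ)) • heatIntegrand (c * K) t x) := by
  have hcK : 0 < c * K := mul_pos hc (by linarith)
  rw [map_smul]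
  filter_upwards [stochConv_ae_eq hW hcK ht x, Lp.coeFn_smul (c₂ * K ^ (1 / 4 : ℝ))
    (hW.isometry (heatIntegrand (c * K) t x))] with ω h1 h2
  rw [h2, fieldPart_of_le hW hK ht, ContinuousMap.smul_apply, h1]
  rfl

theorem aemeasurable_fieldPart [IsProbabilityMeasure P] (hW : IsWhiteNoise P W) (hc : 0 < c)
    (K t : ℝ) (x : UnitAddCircle) : AEMeasurable (fun ω ↦ fieldPart hW c c₂ K t ω x) P := by
  by_cases h : 1 ≤ K ∧ 0 ≤ t
  · exact (measurable_isometry hW _).aemeasurable.congr (fieldPart_ae_eq hW hc h.1 h.2 x).symm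
  · simp only [fieldPart, if_neg h]
    exact aemeasurable_const

/-- The two parts add up to the solution: both sides have the same expansion along the Hartley
basis. -/
theorem IsSolution.toLin_eq_add [IsProbabilityMeasure P] {K t : ℝ}
    {u₀ : Ω → Lp ℝ 2 (volume : Measure UnitAddCircle)}
    {Ψ : ℝ → Ω → Distrib} (h : IsSolution P W₁ W c c₁ c₂ K u₀ Ψ) (hW₁ : IsWhiteNoise P W₁)
    (hW : IsWhiteNoise P W) (hc : 0 < c) (hK : 1 ≤ K) (ht : 0 ≤ t) :
    ∀ᵐ ω ∂P, ∀ φ : Ck ⊤, (Ψ t ω).toLin φ = (roughPart hW₁ c c₁ K t u₀ ω).toLin (toC1 φ)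
      + ∫ x, fieldPart hW c c₂ K t ω x * φ.1 x := by
  have hcK : 0 < c * K := mul_pos hc (by linarith)
  filter_upwards [ae_all_iff.2 fun k ↦ h.toLin_casTest hW₁ hW hcK ht k,
    ae_summable_zeta (b := -(c₁ * K ^ (-(1 / 4) : ℝ))) (u₀ := u₀) hW₁ hcK ht,
    tendsto_sum_casCoeff_mul hW hcK ht] with ω h1 h2 h3 φ
  have h4 := (hasSum_distrib (Ψ t ω) φ).sub (hasSum_dualOfCoeff h2 (toC1 φ))
  simp only [HasSum, SummationFilter.unconditional_filter] at h4
  have h5 := (h3 ⟨φ.1, continuous_of_mem_Ck φ.2⟩).const_mul (c₂ * K ^ (1 / 4 : ℝ))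
  have h6 := tendsto_nhds_unique (h4.comp tendsto_freq) (h5.congr fun n ↦ ?_)
  · rw [sub_eq_iff_eq_add'] at h6
    rw [h6, fieldPart_of_le hW hK ht, roughPart, ← integral_const_mul]
    simp only [ContinuousMap.smul_apply, smul_eq_mul, ContinuousMap.coe_mk, mul_assoc]
  · rw [Function.comp_apply, Finset.mul_sum]
    refine Finset.sum_congr rfl fun k _ ↦ ?_
    rw [h1]
    simp only [toC1, ContinuousMap.coe_mk]
    ring

/-- The first part is a linear functional of the initial value plus a stochastic integral with
respect to `W₁`. -/
theorem exists_repr_roughPart (hW₁ : IsWhiteNoise P W₁) (hc : 0 < c) {K t : ℝ} (hK : 1 ≤ K)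
    (ht : 0 ≤ t) (u₀ : Ω → Lp ℝ 2 (volume : Measure UnitAddCircle)) (φ : Ck 1) :
    ∃ g : UnitAddCircle → ℝ, MemLp g 2 volume ∧ ∃ h : Integrand,
      (fun ω ↦ (roughPart hW₁ c c₁ K t u₀ ω).toLin φ)
        =ᵐ[P] fun ω ↦ (∫ x, u₀ ω x * g x) + W₁ h ω := by
  obtain ⟨g, h, -, -, he⟩ := exists_repr_dualOfCoeff_zeta (b := -(c₁ * K ^ (-(1 / 4) : ℝ)))
    (u₀ := u₀) hW₁ (mul_pos hc (by linarith : 0 < K)) ht φ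
  refine ⟨g, Lp.memLp g, ⟨h, Lp.memLp h⟩, ?_⟩
  filter_upwards [he, hW₁.coeFn_isometry h] with ω h1 h2
  rw [roughPart, h1, h2, L2.inner_def]
  congr 1
  exact integral_congr_ae (ae_of_all _ fun x ↦ mul_comm _ _)

/-- The first part vanishes in `L²(Ω)`: the contribution of the initial value decays like
`e^{-cKt}`, that of `W₁` like `K^{-1/4}`. -/
theorem tendsto_eLpNorm_roughPart (hW₁ : IsWhiteNoise P W₁) (hc : 0 < c)
    {u₀ : ℝ → Ω → Lp ℝ 2 (volume : Measure UnitAddCircle)}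
    (hu₀m : ∀ K, 1 ≤ K → AEStronglyMeasurable (u₀ K) P)
    {C : ℝ≥0} (hC : ∀ K, 1 ≤ K → eLpNorm (u₀ K) 2 P ≤ C) {t : ℝ} (ht : 0 < t) (φ : Ck 1) :
    Tendsto (fun K ↦ eLpNorm (fun ω ↦ (roughPart hW₁ c c₁ K t (u₀ K) ω).toLin φ) 2 P) atTop
      (𝓝 0) := by
  set S : ℝ := ∑' k, |casCoeff φ.1 k|
  have hexp : Tendsto (fun K : ℝ ↦ Real.exp (-(c * K * t)) * S) atTop (𝓝 (0 * S)) := by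
    refine Tendsto.mul_const _ (Real.tendsto_exp_neg_atTop_nhds_zero.comp ?_)
    exact (tendsto_id.const_mul_atTop hc).atTop_mul_const ht
  have hpow : Tendsto (fun K : ℝ ↦ |-(c₁ * K ^ (-(1 / 4) : ℝ))| * S) atTop
      (𝓝 (|-(c₁ * 0)| * S)) :=
    (((tendsto_rpow_neg_atTop (by norm_num)).const_mul c₁).neg.abs).mul_const S
  have hlim : Tendsto (fun K : ℝ ↦ ENNReal.ofReal (Real.exp (-(c * K * t)) * S) * C
      + ENNReal.ofReal (|-(c₁ * K ^ (-(1 / 4) : ℝ))| * S)) atTop (𝓝 0) := by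
    have := (ENNReal.Tendsto.mul_const (b := (C : ℝ≥0∞)) (ENNReal.tendsto_ofReal hexp)
      (Or.inr ENNReal.coe_ne_top)).add (ENNReal.tendsto_ofReal hpow)
    simpa using this
  refine tendsto_of_tendsto_of_tendsto_of_le_of_le' tendsto_const_nhds hlim
    (Eventually.of_forall fun _ ↦ zero_le) ?_
  filter_upwards [eventually_ge_atTop (1 : ℝ)] with K hK
  refine (eLpNorm_dualOfCoeff_zeta_le hW₁ (mul_pos hc (by linarith)) ht.le (hu₀m K hK) φ).trans ?_
  gcongr
  exact hC K hK

theorem sigmaSq_nonneg (hc : 0 < c) (c₂ : ℝ) : 0 ≤ sigmaSq c c₂ := by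
  rw [sigmaSq_eq hc]
  positivity

/-- The finite-dimensional distributions of the second part converge to those of a family of
independent centred Gaussian variables of variance `σ²`. -/
theorem tendstoInDistribution_fieldPart [IsProbabilityMeasure P] (hW : IsWhiteNoise P W)
    (hc : 0 < c) (c₂ : ℝ) {n : ℕ} (p : Fin n → {t : ℝ // 0 < t} × UnitAddCircle) :
    TendstoInDistribution (fun K ω i ↦ fieldPart hW c c₂ K (p i).1 ω (p i).2) atTop
      (fun ω i ↦ ω (p i)) (fun _ ↦ P)
      (Measure.infinitePi fun _ : {t : ℝ // 0 < t} × UnitAddCircle ↦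
        gaussianReal 0 (sigmaSq c c₂).toNNReal) := by
  refine tendstoInDistribution_isometry hW (sigmaSq c c₂).toNNReal
    (fun K q ↦ (c₂ * K ^ (1 / 4 : ℝ)) • heatIntegrand (c * K) q.1 q.2)
    (fun K ω q ↦ fieldPart hW c c₂ K q.1 ω q.2)
    (fun K q ↦ aemeasurable_fieldPart hW hc K q.1 q.2) ?_ (fun q r ↦ ?_) p
  · filter_upwards [eventually_ge_atTop (1 : ℝ)] with K hK q
    exact fieldPart_ae_eq hW hc hK q.1.2.le q.2
  · rw [Real.coe_toNNReal _ (sigmaSq_nonneg hc c₂)]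
    have h := tendsto_inner_heatIntegrand hc c₂ q.1.2 r.1.2 q.2 r.2
    have hqr : ((q.1 : ℝ) = r.1 ∧ q.2 = r.2) ↔ q = r := by rw [Prod.ext_iff, Subtype.ext_iff]
    simp only [hqr] at h
    convert h

end

end TorusSPDE

theorem mainTheorem7 {Ω : Type*} [MeasurableSpace Ω] (P : Measure Ω) [IsProbabilityMeasure P]
    (W₁ W : TorusSPDE.Integrand → Ω → ℝ)
    (hW₁ : TorusSPDE.IsWhiteNoise P W₁) (hW : TorusSPDE.IsWhiteNoise P W)
    (hindep : IndepFun (fun ω f ↦ W₁ f ω) (fun ω f ↦ W f ω) P)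
    (c c₁ c₂ : ℝ) (hc : 0 < c)
    (u₀ : ℝ → Ω → Lp ℝ 2 (volume : Measure UnitAddCircle))
    (hu₀m : ∀ K, 1 ≤ K → AEStronglyMeasurable (u₀ K) P)
    (hu₀ : ∃ C : ℝ≥0, ∀ K, 1 ≤ K → eLpNorm (u₀ K) 2 P ≤ C)
    (Ψ : ℝ → ℝ → Ω → TorusSPDE.Distrib)
    (hΨ : ∀ K, 1 ≤ K → TorusSPDE.IsSolution P W₁ W c c₁ c₂ K (u₀ K) (Ψ K)) :
    ∃ (Ψ₁ : ℝ → ℝ → Ω → TorusSPDE.DualCk 1) (Ψ₂ : ℝ → ℝ → Ω → C(UnitAddCircle, ℝ)),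
      -- the decomposition `Ψ^K(t) = Ψ₁^K(t) + Ψ₂^K(t)` in `𝒟'(𝕋)`
      (∀ K, 1 ≤ K → ∀ t, 0 ≤ t → ∀ᵐ ω ∂P, ∀ φ : TorusSPDE.Ck ⊤,
        (Ψ K t ω).toLin φ
          = (Ψ₁ K t ω).toLin (TorusSPDE.toC1 φ) + (∫ x, Ψ₂ K t ω x * φ.1 x)) ∧
      -- `Ψ₁^K` only contains the contributions of the initial value and of `W₁`
      (∀ K, 1 ≤ K → ∀ t, 0 ≤ t → ∀ φ : TorusSPDE.Ck 1,
        ∃ g : UnitAddCircle → ℝ, MemLp g 2 volume ∧ ∃ h : TorusSPDE.Integrand,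
          (fun ω ↦ (Ψ₁ K t ω).toLin φ) =ᵐ[P] fun ω ↦ (∫ x, u₀ K ω x * g x) + W₁ h ω) ∧
      -- `Ψ₂^K` only contains the contribution of `W`, and is a centred Gaussian field
      (∀ K, 1 ≤ K → ∀ t, 0 ≤ t → ∀ x, ∃ h : TorusSPDE.Integrand,
        (fun ω ↦ Ψ₂ K t ω x) =ᵐ[P] W h) ∧
      (∀ K, 1 ≤ K → IsGaussianProcess
        (fun (p : {t : ℝ // 0 ≤ t} × UnitAddCircle) ω ↦ Ψ₂ K p.1 ω p.2) P) ∧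
      (∀ K, 1 ≤ K → ∀ t, 0 ≤ t → ∀ x, ∫ ω, Ψ₂ K t ω x ∂P = 0) ∧
      -- `⟨Ψ₁^K(t), φ⟩ → 0` in `L²(Ω)`
      (∀ K, 1 ≤ K → ∀ t, 0 ≤ t → ∀ φ : TorusSPDE.Ck 1,
        MemLp (fun ω ↦ (Ψ₁ K t ω).toLin φ) 2 P) ∧
      (∀ t, 0 < t → ∀ φ : TorusSPDE.Ck 1,
        Tendsto (fun K ↦ eLpNorm (fun ω ↦ (Ψ₁ K t ω).toLin φ) 2 P) atTop (𝓝 0)) ∧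
      -- the limit field and the convergence in law (of all finite-dimensional distributions)
      ∃ (Ω' : Type) (_ : MeasurableSpace Ω') (P' : Measure Ω') (_ : IsProbabilityMeasure P')
        (Z : ℝ → UnitAddCircle → Ω' → ℝ),
        (∀ t, 0 < t → ∀ x, HasLaw (Z t x)
          (gaussianReal 0 (TorusSPDE.sigmaSq c c₂).toNNReal) P') ∧
        iIndepFun (fun p : {t : ℝ // 0 < t} × UnitAddCircle ↦ Z p.1 p.2) P' ∧
        ∀ (n : ℕ) (p : Fin n → {t : ℝ // 0 < t} × UnitAddCircle),
          TendstoInDistribution (fun K ω i ↦ Ψ₂ K (p i).1 ω (p i).2) atTop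
            (fun ω i ↦ Z (p i).1 (p i).2 ω) (fun _ ↦ P) P' := by
  obtain ⟨C, hC⟩ := hu₀
  refine ⟨fun K t ω ↦ TorusSPDE.roughPart hW₁ c c₁ K t (u₀ K) ω,
    fun K t ω ↦ TorusSPDE.fieldPart hW c c₂ K t ω,
    fun K hK t ht ↦ (hΨ K hK).toLin_eq_add hW₁ hW hc hK ht,
    fun K hK t ht φ ↦ TorusSPDE.exists_repr_roughPart hW₁ hc hK ht (u₀ K) φ,
    fun K hK t ht x ↦ ⟨_, (TorusSPDE.fieldPart_ae_eq hW hc hK ht x).trans (hW.coeFn_isometry _)⟩,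
    fun K hK ↦ (hW.isGaussianProcess_isometry _).congr fun p ↦
      (TorusSPDE.fieldPart_ae_eq hW hc hK p.1.2 p.2).symm,
    fun K hK t ht x ↦ ?_, fun K hK t ht φ ↦ ?_,
    fun t ht φ ↦ TorusSPDE.tendsto_eLpNorm_roughPart hW₁ hc hu₀m hC ht φ, ?_⟩
  · rw [integral_congr_ae (TorusSPDE.fieldPart_ae_eq hW hc hK ht x), hW.integral_isometry]
  · exact TorusSPDE.memLp_dualOfCoeff_zeta hW₁ (mul_pos hc (by linarith)) ht
      ⟨hu₀m K hK, (hC K hK).trans_lt ENNReal.coe_lt_top⟩ φ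
  -- the limit field is the canonical process of an infinite product of normal distributions; it
  -- is set to zero at non-positive times
  · set μ : Measure ({t : ℝ // 0 < t} × UnitAddCircle → ℝ) :=
      Measure.infinitePi fun _ ↦ gaussianReal 0 (TorusSPDE.sigmaSq c c₂).toNNReal
    have hZ (p : {t : ℝ // 0 < t} × UnitAddCircle) :
        (fun ω : {t : ℝ // 0 < t} × UnitAddCircle → ℝ ↦
          if h : 0 < (p.1 : ℝ) then ω (⟨p.1, h⟩, p.2) else 0) = fun ω ↦ ω p := by
      simp only [p.1.2, dif_pos]
    refine ⟨{t : ℝ // 0 < t} × UnitAddCircle → ℝ, inferInstance, μ, inferInstance,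
      fun t x ω ↦ if h : 0 < t then ω (⟨t, h⟩, x) else 0, fun t ht x ↦ ?_, ?_, fun n p ↦ ?_⟩
    · simp only [ht, dif_pos]
      exact ⟨(measurable_pi_apply _).aemeasurable, Measure.infinitePi_map_eval _ _⟩
    · simp only [hZ]
      exact iIndepFun_infinitePi (X := fun _ x ↦ x) fun _ ↦ measurable_id
    · have h := TorusSPDE.tendstoInDistribution_fieldPart hW hc c₂ p
      convert h using 3 with ω i
      exact congrFun (hZ (p i)) ω
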